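/- **Setting.** Let $\mathcal G$ be a known directed acyclic graph on $[N]$, topologically ordered, with parent sets $\mathrm{pa}(i)$, maximum in-degree $d\ge 1$ and longest directed path of $L$ edges. Let $B,B^*\in\mathbb R^{N\times N}$ be unknown weight matrices supported on the edges of $\mathcal G$, with columns $[B]_i,[B^*]_i$ of Euclidean norm at most $1$. For $a\subseteq[N]$ let $[B_a]_i=[B^*]_i$ if $i\in a$ and $[B_a]_i=[B]_i$ if $i\notin a$. The exogenous noise $\epsilon$ has independent coordinates and known mean $\nu$, and each $\epsilon_i-\nu_i$ is $1$-sub-Gaussian. Let $\mu_a$ be the mean of $X_N$ in the model $X=B_a^\top X+\epsilon$, and $\mu_{a^*}=\max_a\mu_a$. In round $t=1,\dots,T$ (with $T\ge 1$) the actual, unknown model under intervention $a$ is a strictly upper triangular matrix $D_a(t)$, which may depend on the past. The learner picks $a(t)\subseteq[N]$ from the past and observes $X(t)=D_{a(t)}(t)^\top X(t)+\epsilon(t)$, where $\epsilon(t)$ is distributed as $\epsilon$ and independent of the past. The known budget $C>0$ satisfies $$\max_{i\in[N]}\sum_{t=1}^T\max_{a\subseteq[N]}\big\|[D_a(t)-B_a]_i\big\|\le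 C .$$ Let $m>0$ be a known constant such that almost surely $\|X\|\le m$, both for the nominal models $B_a$ and for the data $X(t)$. Let $\kappa>0$ be such that for all $i\in[N]$, $a\subseteq[N]$, $t\in[T]$ and all $v\in\mathbb R^N$ supported on $\mathrm{pa}(i)$, the state $X$ of the actual model $D_a(t)$ satisfies $\mathbb E[(v^\top X)^2]\ge\kappa\|v\|^2$, where the expectation is over the noise of round $t$ with $D_a(t)$ given by the past. The regret is $\mathbb E[R(T)]=T\mu_{a^*}-\sum_{t=1}^T\mathbb E[X_N(t)]$. **Algorithm (Robust-LCB).** Write $X_{\mathrm{pa}(i)}$ for $X$ with the coordinates outside $\mathrm{pa}(i)$ set to $0$, and $\|x\|_A=\sqrt{x^\top Ax}$. For $a\subseteq[N]$ let $S_{i,a}(t)$ be the set of $s\le t$ with $i\in a(s)$ if $i\in a$, and of those with $i\notin a(s)$ if $i\notin a$. Put $$V_{i,a}(t)=I+\sum_{s\in S_{i,a}(t)}w_i(s)X_{\mathrm{pa}(i)}(s)X_{\mathrm{pa}(i)}(s)^\top,\qquad \widetilde V_{i,a}(t)=I+\sum_{s\in S_{i,a}(t)}w_i(s)^2X_{\mathrm{pa}(i)}(s)X_{\mathrm{pa}(i)}(s)^\top,$$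 $$\hat\theta_{i,a}(t)=V_{i,a}(t)^{-1}\sum_{s\in S_{i,a}(t)}w_i(s)X_{\mathrm{pa}(i)}(s)(X_i(s)-\nu_i),\qquad w_i(t)=\min\Big\{\tfrac1C,\ \tfrac{1}{C\,\|X_{\mathrm{pa}(i)}(t)\|_{\widetilde V_{i,a(t)}(t)^{-1}}}\Big\},$$ where the last equation determines $w_i(t)$ uniquely (the second term is $+\infty$ if the norm is $0$). With $\delta=\frac1{2NT}$ let $$\beta_t=\sqrt{2\log(1/\delta)+d\log\big(1+m^2t/(dC^2)\big)}+1+m ,$$ and let $\mathcal C_{i,a}(t)$ be the set of $\theta\in\mathbb R^N$ supported on $\mathrm{pa}(i)$ with $\|\theta\|\le1$ and $\|\theta-\hat\theta_{i,a}(t-1)\|_{V\widetilde V^{-1}V}\le\beta_t$, where $V=V_{i,a}(t-1)$ and $\widetilde V=\widetilde V_{i,a}(t-1)$. In round $t$ the learner plays any maximiser $a(t)$ over $a\subseteq[N]$ of $$\mathrm{UCB}_a(t)=\max\Big\{\Big\langle\sum_{\ell=0}^L[\Theta^\ell]_N,\nu\Big\rangle:\ [\Theta]_i\in\mathcal C_{i,a}(t)\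 \text{for all } i\in[N]\Big\},$$ and an arbitrary $a(t)$ if some set $\mathcal C_{i,a}(t)$ is empty. **Theorem (Regret upper bound).** There are universal constants $K>0$ and $p\in\mathbb N$ such that in every such setting $$\mathbb E[R(T)]\le 2m+K\big((1+m)(1+\tfrac1\kappa)\big)^p\big(1+\log N+\log T+\log(1+\tfrac1C)\big)^p\,d^{L-\frac12}\big(\sqrt T+C\big),$$ that is, $\mathbb E[R(T)]\le 2m+\tilde{\mathcal O}\big(d^{L-1/2}(\sqrt T+C)\big)$, where $\tilde{\mathcal O}$ hides factors polynomial in $m$, $1/\kappa$ and in the logarithms of $N$, $T$ and $1/C$. In the time-invariant setting ($D_a(t)=B_a$ for all $a$ and $t$), the algorithm run with $C=1$ satisfies $$\mathbb E[R(T)]\le 2m+K\big((1+m)(1+\tfrac1\kappa)\big)^p\big(1+\log N+\log T\big)^p\,d^{L-\frac12}\sqrt T .$$ -/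

import Mathlib

open MeasureTheory ProbabilityTheory Matrix

/-- A directed acyclic graph on the nodes `0, …, n` (that is, on `N = n + 1` nodes) with the nodes in a
topological order: `pa i` is the set of parents of `i`, and `(j, i)` is an edge iff `j ∈ pa i`. -/
structure CausalGraph (n : ℕ) where
  pa : Fin (n + 1) → Finset (Fin (n + 1))
  lt_of_mem_pa : ∀ i, ∀ j ∈ pa i, j < i

namespace CausalGraph

variable {n : ℕ} (G : CausalGraph n)

/-- The maximum in-degree `d`. -/
def maxInDegree : ℕ := Finset.univ.sup fun i => (G.pa i).card

/-- There is a directed path with `ℓ` edges. -/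
def HasPath (ℓ : ℕ) : Prop :=
  ∃ p : Fin (ℓ + 1) → Fin (n + 1), ∀ k : Fin ℓ, p k.castSucc ∈ G.pa (p k.succ)

theorem hasPath_zero : G.HasPath 0 := ⟨fun _ => 0, fun k => k.elim0⟩

theorem le_of_hasPath {ℓ : ℕ} (h : G.HasPath ℓ) : ℓ ≤ n := by
  obtain ⟨p, hp⟩ := h
  have hmono : StrictMono p :=
    Fin.strictMono_iff_lt_succ.2 fun k => G.lt_of_mem_pa _ _ (hp k)
  have := Fintype.card_le_of_injective p hmono.injective
  simpa using this

theorem bddAbove_hasPath : BddAbove {ℓ | G.HasPath ℓ} := ⟨n, fun _ h => G.le_of_hasPath h⟩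

/-- The length `L` (number of edges) of a longest directed path. -/
noncomputable def longestPath : ℕ := sSup {ℓ | G.HasPath ℓ}

end CausalGraph

/-- The Euclidean norm of a coordinate vector. -/
noncomputable def l2norm {ι : Type*} [Fintype ι] (v : ι → ℝ) : ℝ := ‖WithLp.toLp 2 v‖

/-- The norm `‖v‖_A = √(vᵀ A v)`. -/
noncomputable def matNorm {ι : Type*} [Fintype ι] (A : Matrix ι ι ℝ) (v : ι → ℝ) : ℝ :=
  Real.sqrt (v ⬝ᵥ A *ᵥ v)

/-- The `i`-th column `[A]_i`. -/
def column {ι : Type*} (A : Matrix ι ι ℝ) (i : ι) : ι → ℝ := fun j => A j i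

/-- The state `x` of the linear structural equation model `x = Aᵀ x + e`. -/
noncomputable def semSolution {ι : Type*} [Fintype ι] [DecidableEq ι]
    (A : Matrix ι ι ℝ) (e : ι → ℝ) : ι → ℝ :=
  (1 - Aᵀ)⁻¹ *ᵥ e

theorem det_one_sub_transpose_eq_one {n : ℕ} (A : Matrix (Fin n) (Fin n) ℝ)
    (hA : ∀ j i, A j i ≠ 0 → j < i) : (1 - Aᵀ).det = 1 := by
  have hz : ∀ j i, ¬ j < i → A j i = 0 := fun j i h => by
    by_contra h0
    exact h (hA j i h0)
  rw [Matrix.det_of_isLowerTriangular]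
  · refine Finset.prod_eq_one fun i _ => ?_
    simp [hz i i (lt_irrefl i)]
  · intro i j hij
    have hij' : i < j := hij
    simp [Matrix.one_apply_ne hij'.ne, hz j i (not_lt.2 hij'.le)]

/-- For a strictly upper triangular weight matrix the model has exactly one state. -/
theorem eq_semSolution_iff {n : ℕ} (A : Matrix (Fin n) (Fin n) ℝ)
    (hA : ∀ j i, A j i ≠ 0 → j < i) (e x : Fin n → ℝ) :
    x = semSolution A e ↔ x = Aᵀ *ᵥ x + e := by
  have hdet : IsUnit (1 - Aᵀ).det := by
    rw [det_one_sub_transpose_eq_one A hA]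
    exact isUnit_one
  have key : x = semSolution A e ↔ (1 - Aᵀ) *ᵥ x = e := by
    unfold semSolution
    constructor
    · rintro rfl
      rw [Matrix.mulVec_mulVec, Matrix.mul_nonsing_inv _ hdet, Matrix.one_mulVec]
    · rintro rfl
      rw [Matrix.mulVec_mulVec, Matrix.nonsing_inv_mul _ hdet, Matrix.one_mulVec]
  rw [key, Matrix.sub_mulVec, Matrix.one_mulVec, sub_eq_iff_eq_add, add_comm]

/-- A nominal linear causal bandit on the graph `G`: observational weights `B`, interventional weights
`Bstar` (both supported on the edges of `G`, with columns in the unit ball), and the law of the exogenous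
noise, whose coordinates are independent and, once centred, `1`-sub-Gaussian. -/
structure CausalBandit {n : ℕ} (G : CausalGraph n) where
  B : Matrix (Fin (n + 1)) (Fin (n + 1)) ℝ
  Bstar : Matrix (Fin (n + 1)) (Fin (n + 1)) ℝ
  noise : Measure (Fin (n + 1) → ℝ)
  support_B : ∀ j i, B j i ≠ 0 → j ∈ G.pa i
  support_Bstar : ∀ j i, Bstar j i ≠ 0 → j ∈ G.pa i
  norm_B_le : ∀ i, l2norm (column B i) ≤ 1
  norm_Bstar_le : ∀ i, l2norm (column Bstar i) ≤ 1
  isProbabilityMeasure_noise : IsProbabilityMeasure noise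
  iIndepFun_noise : iIndepFun (fun (i : Fin (n + 1)) (e : Fin (n + 1) → ℝ) => e i) noise
  subgaussian_noise : ∀ i, HasSubgaussianMGF
    (fun e : Fin (n + 1) → ℝ => e i - ∫ e' : Fin (n + 1) → ℝ, e' i ∂noise) 1 noise

namespace CausalBandit

variable {n : ℕ} {G : CausalGraph n} (M : CausalBandit G)

/-- The noise mean `ν`. -/
noncomputable def nu : Fin (n + 1) → ℝ := fun i => ∫ e : Fin (n + 1) → ℝ, e i ∂M.noise

/-- The weight matrix `B_a` under the intervention `a`: the columns of intervened nodes are taken from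
`Bstar`, the others from `B`. -/
def weights (a : Finset (Fin (n + 1))) : Matrix (Fin (n + 1)) (Fin (n + 1)) ℝ :=
  Matrix.of fun j i => if i ∈ a then M.Bstar j i else M.B j i

/-- The expected reward `μ_a = E_a[X_N]`; the reward node is the last node. -/
noncomputable def meanReward (a : Finset (Fin (n + 1))) : ℝ :=
  ∫ e, semSolution (M.weights a) e (Fin.last n) ∂M.noise

end CausalBandit

namespace RobustLCB

variable {n : ℕ} (G : CausalGraph n)

/-- `X_{pa(i)}`: the vector `x` with the coordinates outside `pa i` set to zero. -/
def restrictPa (i : Fin (n + 1)) (x : Fin (n + 1) → ℝ) : Fin (n + 1) → ℝ :=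
  fun j => if j ∈ G.pa i then x j else 0

/-- The rounds `s ∈ {1, …, t}` in which node `i` was treated as it is under the intervention `A`: those
with `i ∈ a(s)` if `i ∈ A`, and those with `i ∉ a(s)` if `i ∉ A`. -/
def rounds (a : ℕ → Finset (Fin (n + 1))) (i : Fin (n + 1)) (A : Finset (Fin (n + 1))) (t : ℕ) :
    Finset ℕ :=
  (Finset.Icc 1 t).filter fun s => i ∈ a s ↔ i ∈ A

/-- The weighted Gram matrix `V_{i,A}(t)`, which is `V*_i(t)` if `i ∈ A` and `V_i(t)` if `i ∉ A`, along
the actions `a`, the data `X` and the weights `w`. -/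
noncomputable def gram (a : ℕ → Finset (Fin (n + 1))) (X : ℕ → Fin (n + 1) → ℝ)
    (w : Fin (n + 1) → ℕ → ℝ) (i : Fin (n + 1)) (A : Finset (Fin (n + 1))) (t : ℕ) :
    Matrix (Fin (n + 1)) (Fin (n + 1)) ℝ :=
  (∑ s ∈ rounds a i A t, w i s • vecMulVec (restrictPa G i (X s)) (restrictPa G i (X s))) + 1

/-- The Gram matrix `Ṽ_{i,A}(t)` with squared weights. -/
noncomputable def gramSq (a : ℕ → Finset (Fin (n + 1))) (X : ℕ → Fin (n + 1) → ℝ)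
    (w : Fin (n + 1) → ℕ → ℝ) (i : Fin (n + 1)) (A : Finset (Fin (n + 1))) (t : ℕ) :
    Matrix (Fin (n + 1)) (Fin (n + 1)) ℝ :=
  (∑ s ∈ rounds a i A t, (w i s) ^ 2 • vecMulVec (restrictPa G i (X s)) (restrictPa G i (X s))) + 1

/-- The weighted least squares estimate of column `i`: `[B*(t)]_i` if `i ∈ A`, `[B(t)]_i` if `i ∉ A`. -/
noncomputable def estimate (ν : Fin (n + 1) → ℝ) (a : ℕ → Finset (Fin (n + 1)))
    (X : ℕ → Fin (n + 1) → ℝ) (w : Fin (n + 1) → ℕ → ℝ) (i : Fin (n + 1))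
    (A : Finset (Fin (n + 1))) (t : ℕ) : Fin (n + 1) → ℝ :=
  (gram G a X w i A t)⁻¹ *ᵥ
    ∑ s ∈ rounds a i A t, (w i s * (X s i - ν i)) • restrictPa G i (X s)

/-- The confidence radius `β(t, δ)`. -/
noncomputable def confRadius (m C δ : ℝ) (t : ℕ) : ℝ :=
  Real.sqrt (2 * Real.log (1 / δ) +
    G.maxInDegree * Real.log (1 + m ^ 2 * t / (G.maxInDegree * C ^ 2))) + 1 + m

/-- The confidence ellipsoid `C_{i,A}(t)`, built from the data of the rounds before `t`. It consists of
weight vectors for the edges into node `i`, so of vectors supported on `pa i`. -/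
def confSet (ν : Fin (n + 1) → ℝ) (m C δ : ℝ) (a : ℕ → Finset (Fin (n + 1)))
    (X : ℕ → Fin (n + 1) → ℝ) (w : Fin (n + 1) → ℕ → ℝ) (i : Fin (n + 1))
    (A : Finset (Fin (n + 1))) (t : ℕ) : Set (Fin (n + 1) → ℝ) :=
  {θ | (∀ j, j ∉ G.pa i → θ j = 0) ∧ l2norm θ ≤ 1 ∧
    matNorm (gram G a X w i A (t - 1) * (gramSq G a X w i A (t - 1))⁻¹ * gram G a X w i A (t - 1))
      (θ - estimate G ν a X w i A (t - 1)) ≤ confRadius G m C δ t}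

/-- `⟨f(Θ), ν⟩` with `f(Θ) = ∑_{ℓ=0}^{L} [Θ^ℓ]_N`. -/
noncomputable def rewardOf (ν : Fin (n + 1) → ℝ) (Θ : Matrix (Fin (n + 1)) (Fin (n + 1)) ℝ) : ℝ :=
  (∑ ℓ ∈ Finset.range (G.longestPath + 1), column (Θ ^ ℓ) (Fin.last n)) ⬝ᵥ ν

/-- `UCB_A(t)`: the maximum of `⟨f(Θ), ν⟩` over the matrices `Θ` with `[Θ]_i ∈ C_{i,A}(t)` for all `i`. -/
noncomputable def ucb (ν : Fin (n + 1) → ℝ) (m C δ : ℝ) (a : ℕ → Finset (Fin (n + 1)))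
    (X : ℕ → Fin (n + 1) → ℝ) (w : Fin (n + 1) → ℕ → ℝ) (A : Finset (Fin (n + 1))) (t : ℕ) : ℝ :=
  sSup (rewardOf G ν '' {Θ | ∀ i, column Θ i ∈ confSet G ν m C δ a X w i A t})

/-- The actions `a`, data `X` and weights `w` of rounds `1, …, T` follow the algorithm.

* `weight_eq` is `w_i(t) = min {1/C, 1/(C r)}` with `r = ‖X_{pa(i)}(t)‖` in the norm of the inverse of
  `Ṽ_{i,a(t)}(t)`, written so that it reads `1/C` for `r = 0`. Since `Ṽ_{i,a(t)}(t)` contains the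
  round `t`, this is an equation for `w_i(t)`; it has exactly one solution.
* `action_max`: `a(t)` is a maximiser of `UCB`, with any tie-breaking. When some confidence set is empty, so
  that not every `UCB` is defined, nothing is asked of `a(t)`. -/
structure FollowsAlgorithm (ν : Fin (n + 1) → ℝ) (m C δ : ℝ) (T : ℕ)
    (a : ℕ → Finset (Fin (n + 1))) (X : ℕ → Fin (n + 1) → ℝ) (w : Fin (n + 1) → ℕ → ℝ) : Prop where
  weight_eq : ∀ t ∈ Finset.Icc 1 T, ∀ i,
    w i t = 1 / (C * max 1 (matNorm (gramSq G a X w i (a t) t)⁻¹ (restrictPa G i (X t))))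
  action_max : ∀ t ∈ Finset.Icc 1 T,
    (∀ i A, (confSet G ν m C δ a X w i A t).Nonempty) →
      ∀ A, ucb G ν m C δ a X w A t ≤ ucb G ν m C δ a X w (a t) t

end RobustLCB

/-- A run of the algorithm over the horizon `T`, with input budget `C`, on the nominal bandit `M` under
temporal model fluctuations.

`D t ω a` is the actual weight matrix in round `t` under the intervention `a`. It may be random and depend on
the past; a deterministic sequence of matrices is a special case. The number `m` bounds the norm of the state
under the nominal and the actual models; `κ` bounds from below the second moments of the parents, as a
quadratic form on the coordinates in `pa i`, for all nodes, interventions and rounds. -/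
structure RobustLCBRun {n : ℕ} {G : CausalGraph n} (M : CausalBandit G) (T : ℕ) (C m κ : ℝ)
    {Ω : Type*} [mΩ : MeasurableSpace Ω] (μ : Measure Ω) where
  /-- the information available after each round -/
  ℱ : Filtration ℕ mΩ
  /-- the noise -/
  ε : ℕ → Ω → Fin (n + 1) → ℝ
  /-- the actual models -/
  D : ℕ → Ω → Finset (Fin (n + 1)) → Matrix (Fin (n + 1)) (Fin (n + 1)) ℝ
  /-- the selected interventions -/
  a : ℕ → Ω → Finset (Fin (n + 1))
  /-- the data -/
  X : ℕ → Ω → Fin (n + 1) → ℝ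
  /-- the weights of the estimator -/
  w : Ω → Fin (n + 1) → ℕ → ℝ
  noise_adapted : ∀ t ∈ Finset.Icc 1 T, Measurable[ℱ t] (ε t)
  noise_law : ∀ t ∈ Finset.Icc 1 T, μ.map (ε t) = M.noise
  noise_indep : ∀ t ∈ Finset.Icc 1 T,
    Indep (MeasurableSpace.comap (ε t) inferInstance) (ℱ (t - 1)) μ
  model_predictable : ∀ t ∈ Finset.Icc 1 T, ∀ A j i, Measurable[ℱ (t - 1)] fun ω => D t ω A j i
  model_triangular : ∀ t ∈ Finset.Icc 1 T, ∀ ω A j i, D t ω A j i ≠ 0 → j < i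
  action_predictable : ∀ t ∈ Finset.Icc 1 T, ∀ A, MeasurableSet[ℱ (t - 1)] {ω | a t ω = A}
  data_eq : ∀ t ∈ Finset.Icc 1 T, ∀ ω, X t ω = semSolution (D t ω (a t ω)) (ε t ω)
  budget : ∀ᵐ ω ∂μ, ∀ i,
    ∑ t ∈ Finset.Icc 1 T, (⨆ A, l2norm (column (D t ω A - M.weights A) i)) ≤ C
  nominal_bounded : ∀ A, ∀ᵐ e ∂M.noise, l2norm (semSolution (M.weights A) e) ≤ m
  data_bounded : ∀ t ∈ Finset.Icc 1 T, ∀ᵐ ω ∂μ, l2norm (X t ω) ≤ m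
  second_moment_ge : ∀ t ∈ Finset.Icc 1 T, ∀ᵐ ω ∂μ, ∀ A i (v : Fin (n + 1) → ℝ),
    (∀ j, j ∉ G.pa i → v j = 0) →
      κ * l2norm v ^ 2 ≤ ∫ e, (v ⬝ᵥ semSolution (D t ω A) e) ^ 2 ∂M.noise
  follows : ∀ ω, RobustLCB.FollowsAlgorithm G M.nu m C (1 / (2 * ((n : ℝ) + 1) * T)) T
    (fun t => a t ω) (fun t => X t ω) (w ω)

/-- The expected cumulative regret `T μ_{a*} - ∑_{t=1}^{T} E[X_N(t)]`. -/
noncomputable def RobustLCBRun.expectedRegret {n : ℕ} {G : CausalGraph n} {M : CausalBandit G} {T : ℕ}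
    {C m κ : ℝ} {Ω : Type*} [MeasurableSpace Ω] {μ : Measure Ω} (R : RobustLCBRun M T C m κ μ) : ℝ :=
  T * (⨆ A, M.meanReward A) - ∑ t ∈ Finset.Icc 1 T, ∫ ω, R.X t ω (Fin.last n) ∂μ

/-! The argument is optimism with ellipsoidal confidence sets. The sum of the widths is controlled
by a trace potential whose decrease is measured in expectation, so no concentration of Gram matrices
is needed.

Validity. Multiplied by the Gram matrix, the estimation error splits into regularisation, model
fluctuation and noise (`matNorm_sub_estimate_le`). The weights keep `w` times the norm of the parent
vector below `1/C` in the dual norm, so fluctuations of total size `m C` contribute at most `m`. The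
weight and the parents of node `i` depend only on the past and on the noise of earlier nodes, hence
are independent of the noise at `i`; so the integrated likelihood ratio of the method of mixtures
has expectation at most `1` (`lintegral_mixture_le_one`). Markov's inequality at each fixed round,
for `2N` mixtures, gives failure probability at most `1/T`. A failed round costs at most `2m`, so
all failures together cost `2m`.

Regret of a valid round. By optimism it is at most the gap between the reward of some `Θ` in the
confidence region of the played action and the mean reward of the actual model `D`. This gap is
exactly a sum over nodes of a sensitivity times `⟨[Θ - D]_i, x⟩` (`semSolution_last_sub`). Columns
of `Θ^ℓ` have `ℓ¹` norm at most `d^{ℓ/2}`, and `ℓ/2 ≤ L - 1/2`: this is the source of `d^{L-1/2}`.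
Only the reward node and nodes with a child count. There are at most `m²/κ` of the latter, since
each has second moment at least `κ` in a state of norm at most `m` (`card_parents_le`). The same
number bounds `d` and `L`, so further powers of these are absorbed.

Widths. Let `φ` be the trace over the parents of the inverse Gram matrix of normalised parent
vectors. The Euclidean width of the ellipsoid is of order `(1 + βC)φ + β√φ`
(`l2norm_sub_le_potential`). Conditionally on the past, a visit lowers `log φ` on average by a
constant times `κφ/(d(1+m)²)` (`le_lintegral_potentialGain`), whereas `log φ` can fall by at most
`log(1+T)` altogether. Hence the expected sum of `φ` is logarithmic in `T`. The terms linear in `φ`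
then cost a multiple of `C`, up to logarithms, and AM-GM makes the terms in `√φ` cost a multiple of
`√T`. -/

/-! ### Quadratic forms and the norms they define. -/

section LinearAlgebra

variable {ι : Type*} [Fintype ι]

theorem l2norm_sq (v : ι → ℝ) : l2norm v ^ 2 = v ⬝ᵥ v := by
  rw [l2norm, EuclideanSpace.norm_sq_eq]
  simp [dotProduct, pow_two]

theorem l2norm_nonneg (v : ι → ℝ) : 0 ≤ l2norm v := norm_nonneg _

theorem l2norm_zero : l2norm (0 : ι → ℝ) = 0 := by
  simp [l2norm]

theorem l2norm_neg (v : ι → ℝ) : l2norm (-v) = l2norm v := by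
  simp [l2norm]

theorem l2norm_add_le (u v : ι → ℝ) : l2norm (u + v) ≤ l2norm u + l2norm v := by
  simpa [l2norm] using norm_add_le (WithLp.toLp 2 u) (WithLp.toLp 2 v)

theorem l2norm_sub_le (u v : ι → ℝ) : l2norm (u - v) ≤ l2norm u + l2norm v := by
  rw [sub_eq_add_neg, ← l2norm_neg v]
  exact l2norm_add_le _ _

theorem l2norm_eq_sqrt (v : ι → ℝ) : l2norm v = Real.sqrt (v ⬝ᵥ v) := by
  rw [← l2norm_sq, Real.sqrt_sq (l2norm_nonneg v)]

theorem abs_dotProduct_le (u v : ι → ℝ) : |u ⬝ᵥ v| ≤ l2norm u * l2norm v := by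
  have := abs_real_inner_le_norm (WithLp.toLp 2 u) (WithLp.toLp 2 v)
  simpa [l2norm, PiLp.inner_apply, dotProduct, mul_comm] using this

theorem abs_apply_le_l2norm (v : ι → ℝ) (j : ι) : |v j| ≤ l2norm v := by
  simpa [l2norm] using PiLp.norm_apply_le (WithLp.toLp 2 v) j

theorem quadForm_nonneg {A : Matrix ι ι ℝ} (hA : A.PosSemidef) (v : ι → ℝ) : 0 ≤ v ⬝ᵥ A *ᵥ v := by
  simpa using hA.dotProduct_mulVec_nonneg v

theorem dotProduct_mulVec_symm {A : Matrix ι ι ℝ} (hA : A.IsHermitian) (u v : ι → ℝ) :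
    u ⬝ᵥ A *ᵥ v = v ⬝ᵥ A *ᵥ u := by
  have h : Aᵀ = A := by simpa using hA.eq
  rw [dotProduct_mulVec, ← mulVec_transpose, h, dotProduct_comm]

/-- The Cauchy-Schwarz inequality for a positive semidefinite form. -/
theorem dotProduct_mulVec_sq_le {A : Matrix ι ι ℝ} (hA : A.PosSemidef) (u v : ι → ℝ) :
    (u ⬝ᵥ A *ᵥ v) ^ 2 ≤ (u ⬝ᵥ A *ᵥ u) * (v ⬝ᵥ A *ᵥ v) := by
  have h : ∀ t : ℝ, 0 ≤ (v ⬝ᵥ A *ᵥ v) * (t * t) + (2 * (u ⬝ᵥ A *ᵥ v)) * t + u ⬝ᵥ A *ᵥ u := by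
    intro t
    have h0 := quadForm_nonneg hA (u + t • v)
    have hs := dotProduct_mulVec_symm hA.isHermitian v u
    simp only [mulVec_add, mulVec_smul, dotProduct_add, add_dotProduct, smul_dotProduct,
      dotProduct_smul, smul_eq_mul, hs] at h0
    linarith
  have := discrim_le_zero h
  simp only [discrim] at this
  nlinarith

theorem matNorm_nonneg (A : Matrix ι ι ℝ) (v : ι → ℝ) : 0 ≤ matNorm A v := Real.sqrt_nonneg _

theorem matNorm_sq {A : Matrix ι ι ℝ} (hA : A.PosSemidef) (v : ι → ℝ) :
    matNorm A v ^ 2 = v ⬝ᵥ A *ᵥ v := Real.sq_sqrt (quadForm_nonneg hA v)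

theorem dotProduct_mulVec_le_matNorm {A : Matrix ι ι ℝ} (hA : A.PosSemidef) (u v : ι → ℝ) :
    u ⬝ᵥ A *ᵥ v ≤ matNorm A u * matNorm A v := by
  unfold matNorm
  rw [← Real.sqrt_mul (quadForm_nonneg hA u)]
  exact (le_abs_self _).trans (Real.abs_le_sqrt (dotProduct_mulVec_sq_le hA u v))

theorem matNorm_add_le {A : Matrix ι ι ℝ} (hA : A.PosSemidef) (u v : ι → ℝ) :
    matNorm A (u + v) ≤ matNorm A u + matNorm A v := by
  refine abs_le_of_sq_le_sq' ?_ (add_nonneg (matNorm_nonneg A u) (matNorm_nonneg A v)) |>.2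
  have h := dotProduct_mulVec_le_matNorm hA u v
  have hs := dotProduct_mulVec_symm hA.isHermitian v u
  rw [add_sq, matNorm_sq hA, matNorm_sq hA, matNorm_sq hA]
  simp only [mulVec_add, dotProduct_add, add_dotProduct, hs]
  linarith

theorem matNorm_smul (A : Matrix ι ι ℝ) (c : ℝ) (v : ι → ℝ) :
    matNorm A (c • v) = |c| * matNorm A v := by
  unfold matNorm
  rw [mulVec_smul, smul_dotProduct, dotProduct_smul, smul_eq_mul, smul_eq_mul, ← mul_assoc,
    Real.sqrt_mul (mul_self_nonneg c), Real.sqrt_mul_self_eq_abs]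

theorem matNorm_neg (A : Matrix ι ι ℝ) (v : ι → ℝ) : matNorm A (-v) = matNorm A v := by
  simp [matNorm, mulVec_neg]

theorem matNorm_zero (A : Matrix ι ι ℝ) : matNorm A 0 = 0 := by
  simp [matNorm]

theorem matNorm_sum_le {A : Matrix ι ι ℝ} (hA : A.PosSemidef) {σ : Type*} (s : Finset σ)
    (f : σ → ι → ℝ) : matNorm A (∑ k ∈ s, f k) ≤ ∑ k ∈ s, matNorm A (f k) := by
  classical
  induction s using Finset.induction_on with
  | empty => simp [matNorm_zero]
  | insert k s hk ih =>
    rw [Finset.sum_insert hk, Finset.sum_insert hk]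
    exact (matNorm_add_le hA _ _).trans (by gcongr)

theorem quadForm_vecMulVec (z v : ι → ℝ) : v ⬝ᵥ vecMulVec z z *ᵥ v = (z ⬝ᵥ v) ^ 2 := by
  rw [vecMulVec_mulVec]
  simp [dotProduct_comm v z, pow_two]

theorem posSemidef_vecMulVec (z : ι → ℝ) : (vecMulVec z z).PosSemidef := by
  simpa using posSemidef_vecMulVec_self_star z

theorem posDef_add_vecMulVec {A : Matrix ι ι ℝ} (hA : A.PosDef) (z : ι → ℝ) :
    (A + vecMulVec z z).PosDef := hA.add_posSemidef (posSemidef_vecMulVec z)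

/-! ### Inverses, rank-one updates and determinant bounds. -/

variable [DecidableEq ι]

theorem mulVec_inv_mulVec {A : Matrix ι ι ℝ} (hA : A.PosDef) (v : ι → ℝ) :
    A *ᵥ (A⁻¹ *ᵥ v) = v := by
  rw [mulVec_mulVec, mul_nonsing_inv _ ((isUnit_iff_isUnit_det A).1 hA.isUnit), one_mulVec]

/-- The Cauchy-Schwarz inequality for the dual pair of norms of `A` and `A⁻¹`. -/
theorem dotProduct_sq_le_inv {A : Matrix ι ι ℝ} (hA : A.PosDef) (u v : ι → ℝ) :
    (u ⬝ᵥ v) ^ 2 ≤ (u ⬝ᵥ A⁻¹ *ᵥ u) * (v ⬝ᵥ A *ᵥ v) := by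
  have h := dotProduct_mulVec_sq_le hA.posSemidef (A⁻¹ *ᵥ u) v
  have h1 : (A⁻¹ *ᵥ u) ⬝ᵥ A *ᵥ v = u ⬝ᵥ v := by
    rw [dotProduct_mulVec_symm hA.isHermitian, mulVec_inv_mulVec hA, dotProduct_comm]
  rw [h1, mulVec_inv_mulVec hA, dotProduct_comm (A⁻¹ *ᵥ u) u] at h
  exact h

theorem dotProduct_le_matNorm_inv {A : Matrix ι ι ℝ} (hA : A.PosDef) (u v : ι → ℝ) :
    u ⬝ᵥ v ≤ matNorm A⁻¹ u * matNorm A v := by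
  unfold matNorm
  rw [← Real.sqrt_mul (quadForm_nonneg hA.inv.posSemidef u)]
  exact (le_abs_self _).trans (Real.abs_le_sqrt (dotProduct_sq_le_inv hA u v))

/-- Inversion is antitone on positive definite forms. -/
theorem quadForm_inv_anti {A B : Matrix ι ι ℝ} (hA : A.PosDef) (hB : B.PosDef)
    (h : ∀ v : ι → ℝ, v ⬝ᵥ A *ᵥ v ≤ v ⬝ᵥ B *ᵥ v) (u : ι → ℝ) :
    u ⬝ᵥ B⁻¹ *ᵥ u ≤ u ⬝ᵥ A⁻¹ *ᵥ u := by
  -- With `b = uᵀB⁻¹u` and `a = uᵀA⁻¹u`, Cauchy-Schwarz at `B⁻¹u` gives `b² ≤ a b`, and a factor `b`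
  -- cancels.
  have h1 := dotProduct_sq_le_inv hA u (B⁻¹ *ᵥ u)
  have h2 := h (B⁻¹ *ᵥ u)
  rw [mulVec_inv_mulVec hB, dotProduct_comm (B⁻¹ *ᵥ u) u] at h2
  have h3 := quadForm_nonneg hB.inv.posSemidef u
  have h4 := quadForm_nonneg hA.inv.posSemidef u
  rcases h3.eq_or_lt with h0 | h0
  · rw [← h0]; exact h4
  · nlinarith [mul_le_mul_of_nonneg_left h2 h4]

theorem matNorm_inv_anti {A B : Matrix ι ι ℝ} (hA : A.PosDef) (hB : B.PosDef)
    (h : ∀ v : ι → ℝ, v ⬝ᵥ A *ᵥ v ≤ v ⬝ᵥ B *ᵥ v) (u : ι → ℝ) :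
    matNorm B⁻¹ u ≤ matNorm A⁻¹ u :=
  Real.sqrt_le_sqrt (quadForm_inv_anti hA hB h u)

/-- The Sherman-Morrison formula. It drives the mixture recursion, the closed form of the weights
and the decrease of the potential. -/
theorem inv_add_vecMulVec {A : Matrix ι ι ℝ} (hA : A.PosDef) (z : ι → ℝ) :
    (A + vecMulVec z z)⁻¹ =
      A⁻¹ - (1 + z ⬝ᵥ A⁻¹ *ᵥ z)⁻¹ • vecMulVec (A⁻¹ *ᵥ z) (A⁻¹ *ᵥ z) := by
  have hq := quadForm_nonneg hA.inv.posSemidef z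
  have hu := (isUnit_iff_isUnit_det A).1 hA.isUnit
  have hs : z ᵥ* A⁻¹ = A⁻¹ *ᵥ z := by
    rw [← mulVec_transpose]
    congr 1
    simpa using hA.inv.isHermitian.eq
  refine inv_eq_right_inv ?_
  rw [add_mul, mul_sub, mul_sub, mul_nonsing_inv _ hu, mul_smul_comm, mul_smul_comm,
    mul_vecMulVec, mulVec_inv_mulVec hA, vecMulVec_mul, hs, vecMulVec_mul_vecMulVec]
  have hq1 : (1 + z ⬝ᵥ A⁻¹ *ᵥ z) ≠ 0 := by positivity
  ext i j
  simp only [Matrix.add_apply, Matrix.sub_apply, Matrix.smul_apply, vecMulVec_apply, smul_eq_mul,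
    Pi.smul_apply]
  field_simp
  ring

theorem det_add_vecMulVec {A : Matrix ι ι ℝ} (hA : A.PosDef) (z : ι → ℝ) :
    (A + vecMulVec z z).det = A.det * (1 + z ⬝ᵥ A⁻¹ *ᵥ z) := by
  have hu := (isUnit_iff_isUnit_det A).1 hA.isUnit
  have := det_add_replicateCol_mul_replicateRow (ι := Unit) hu z z
  rw [← vecMulVec_eq] at this
  rw [this]
  rw [det_unique (n := Unit), Matrix.mul_assoc]
  rfl

/-- `log det` is at most its linearization at the identity. -/
theorem det_le_exp_trace_sub {A : Matrix ι ι ℝ} (hA : A.PosDef) :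
    A.det ≤ Real.exp (A.trace - Fintype.card ι) := by
  have h1 := hA.isHermitian.det_eq_prod_eigenvalues
  have h2 := hA.isHermitian.trace_eq_sum_eigenvalues
  simp only [RCLike.ofReal_real_eq_id, id_eq] at h1 h2
  rw [h1, h2, show (∑ i, hA.isHermitian.eigenvalues i) - (Fintype.card ι : ℝ) =
    ∑ i, (hA.isHermitian.eigenvalues i - 1) by simp [Finset.sum_sub_distrib], Real.exp_sum]
  refine Finset.prod_le_prod (fun i _ => (hA.eigenvalues_pos i).le) fun i _ => ?_
  have := Real.add_one_le_exp (hA.isHermitian.eigenvalues i - 1)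
  linarith

/-- A determinant bound for a positive definite matrix whose diagonal is `1` off a small set `P`. -/
theorem det_le_pow_of_diag {A : Matrix ι ι ℝ} (hA : A.PosDef) (P : Finset ι) (d : ℕ) (c : ℝ)
    (hc : 1 ≤ c) (hP : P.card ≤ d) (h1 : ∀ j ∉ P, A j j = 1)
    (h2 : ∑ j ∈ P, (A j j - 1) ≤ d * (c - 1)) : A.det ≤ c ^ d := by
  have hc0 : 0 < c := by linarith
  -- Rescaling the coordinates in `P` by `c^{-1/2}` before linearising `log det` at the identity
  -- yields a power of `c` in place of the exponential of a trace.
  set s : ι → ℝ := fun j => if j ∈ P then (Real.sqrt c)⁻¹ else 1 with hs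
  have hs2 : ∀ j, s j * s j = if j ∈ P then c⁻¹ else 1 := by
    intro j
    simp only [hs]
    split_ifs
    · rw [← mul_inv, Real.mul_self_sqrt hc0.le]
    · simp
  have hpos : ∀ j, s j ≠ 0 := by
    intro j
    simp only [hs]
    split_ifs
    · positivity
    · simp
  have hD : IsUnit (diagonal s) := by
    rw [isUnit_iff_isUnit_det, det_diagonal, isUnit_iff_ne_zero]
    exact Finset.prod_ne_zero_iff.2 fun j _ => hpos j
  have hB : (diagonal s * A * diagonal s).PosDef := by
    have := hA.conjTranspose_mul_mul_same (B := diagonal s)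
      (mulVec_injective_iff_isUnit.2 hD)
    simpa [diagonal_conjTranspose] using this
  have h := det_le_exp_trace_sub hB
  have hdet : (diagonal s * A * diagonal s).det = (c⁻¹) ^ P.card * A.det := by
    rw [det_mul, det_mul, det_diagonal, mul_right_comm, ← Finset.prod_mul_distrib,
      Finset.prod_congr rfl fun j _ => hs2 j, Finset.prod_ite_mem, Finset.univ_inter,
      Finset.prod_const]
  have htr : (diagonal s * A * diagonal s).trace - Fintype.card ι =
      ∑ j ∈ P, (c⁻¹ * A j j - 1) := by
    have : (Fintype.card ι : ℝ) = ∑ j : ι, 1 := by simp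
    rw [trace, this, ← Finset.sum_sub_distrib, ← Finset.sum_subset (Finset.subset_univ P)]
    · refine Finset.sum_congr rfl fun j hj => ?_
      have := hs2 j
      simp only [hj, if_true] at this
      simp only [diag_apply, mul_diagonal, diagonal_mul]
      rw [← this]; ring
    · intro j _ hj
      simp [diag_apply, mul_diagonal, diagonal_mul, h1 j hj, hs, hj]
  rw [hdet, htr] at h
  have hsum : ∑ j ∈ P, (c⁻¹ * A j j - 1) ≤ (d - P.card : ℝ) * (1 - c⁻¹) := by
    have : ∑ j ∈ P, (c⁻¹ * A j j - 1) = c⁻¹ * ∑ j ∈ P, (A j j - 1) - P.card * (1 - c⁻¹) := by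
      rw [Finset.mul_sum, ← nsmul_eq_mul, ← Finset.sum_const, ← Finset.sum_sub_distrib]
      exact Finset.sum_congr rfl fun j _ => by ring
    rw [this]
    have h3 := mul_le_mul_of_nonneg_left h2 (inv_nonneg.2 hc0.le)
    have h4 : c⁻¹ * (d * (c - 1)) = d * (1 - c⁻¹) := by field_simp
    linarith
  -- If `P` has fewer than `d` elements, the leftover exponent is paid for by the spare factors of
  -- `c`.
  have hexp : Real.exp ((d - P.card : ℝ) * (1 - c⁻¹)) ≤ c ^ (d - P.card) := by
    have h5 : Real.exp (1 - c⁻¹) ≤ c := by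
      have := Real.add_one_le_exp (-(1 - c⁻¹))
      rw [Real.exp_neg] at this
      have h6 : c⁻¹ ≤ (Real.exp (1 - c⁻¹))⁻¹ := by linarith
      exact (inv_le_inv₀ hc0 (Real.exp_pos _)).1 h6
    rw [← Nat.cast_sub hP, Real.exp_nat_mul]
    gcongr
  have h7 := h.trans ((Real.exp_le_exp.2 hsum).trans hexp)
  rw [inv_pow, inv_mul_le_iff₀ (by positivity), ← pow_add] at h7
  rwa [Nat.add_sub_cancel' hP] at h7

end LinearAlgebra

/-! ### Measurability of matrix operations. -/

section Measurability

variable {Ω ι : Type*} [Fintype ι] {mΩ : MeasurableSpace Ω}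

theorem measurable_dotProduct {u v : Ω → ι → ℝ} (hu : ∀ i, Measurable fun ω => u ω i)
    (hv : ∀ i, Measurable fun ω => v ω i) : Measurable fun ω => u ω ⬝ᵥ v ω := by
  simp only [dotProduct]
  exact Finset.measurable_sum _ fun i _ => (hu i).mul (hv i)

theorem measurable_mulVec {A : Ω → Matrix ι ι ℝ} {v : Ω → ι → ℝ}
    (hA : ∀ i j, Measurable fun ω => A ω i j) (hv : ∀ i, Measurable fun ω => v ω i) (i : ι) :
    Measurable fun ω => (A ω *ᵥ v ω) i :=
  measurable_dotProduct (fun j => hA i j) hv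

theorem measurable_quadForm {A : Ω → Matrix ι ι ℝ} {v : Ω → ι → ℝ}
    (hA : ∀ i j, Measurable fun ω => A ω i j) (hv : ∀ i, Measurable fun ω => v ω i) :
    Measurable fun ω => v ω ⬝ᵥ A ω *ᵥ v ω :=
  measurable_dotProduct hv (measurable_mulVec hA hv)

variable [DecidableEq ι]

theorem measurable_matrix_det {A : Ω → Matrix ι ι ℝ} (hA : ∀ i j, Measurable fun ω => A ω i j) :
    Measurable fun ω => (A ω).det := by
  simp only [det_apply]
  refine Finset.measurable_sum _ fun σ _ => Measurable.const_smul ?_ _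
  exact Finset.measurable_prod _ fun i _ => hA _ _

theorem measurable_matrix_inv {A : Ω → Matrix ι ι ℝ} (hA : ∀ i j, Measurable fun ω => A ω i j)
    (i j : ι) : Measurable fun ω => (A ω)⁻¹ i j := by
  simp only [inv_def, Matrix.smul_apply, smul_eq_mul, Ring.inverse_eq_inv', adjugate_apply]
  refine (measurable_matrix_det hA).inv.mul (measurable_matrix_det fun k l => ?_)
  simp only [updateRow_apply]
  split_ifs
  · exact measurable_const
  · exact hA k l

end Measurability

/-! ### Paths, nilpotency and the sensitivity of the reward node. -/

namespace CausalGraph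

variable {n : ℕ} (G : CausalGraph n)

theorem card_pa_le (i : Fin (n + 1)) : (G.pa i).card ≤ G.maxInDegree :=
  Finset.le_sup (f := fun i => (G.pa i).card) (Finset.mem_univ i)

/-- The nodes that have a child. -/
def parents : Finset (Fin (n + 1)) := Finset.univ.biUnion G.pa

theorem mem_parents {j : Fin (n + 1)} : j ∈ G.parents ↔ ∃ i, j ∈ G.pa i := by
  simp [parents]

theorem maxInDegree_le_card_parents : G.maxInDegree ≤ G.parents.card :=
  Finset.sup_le fun i _ => Finset.card_le_card
    (Finset.subset_biUnion_of_mem G.pa (Finset.mem_univ i))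

theorem hasPath_longestPath : G.HasPath G.longestPath :=
  Nat.sSup_mem ⟨0, G.hasPath_zero⟩ G.bddAbove_hasPath

theorem le_longestPath {ℓ : ℕ} (h : G.HasPath ℓ) : ℓ ≤ G.longestPath :=
  le_csSup G.bddAbove_hasPath h

/-- Every node of a longest path except the last has a child. Through this, `L` is eventually
bounded by `m²/κ`. -/
theorem longestPath_le_card_parents : G.longestPath ≤ G.parents.card := by
  obtain ⟨p, hp⟩ := G.hasPath_longestPath
  have hmono : StrictMono p :=
    Fin.strictMono_iff_lt_succ.2 fun k => G.lt_of_mem_pa _ _ (hp k)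
  have hinj : Function.Injective fun k : Fin G.longestPath => p k.castSucc :=
    hmono.injective.comp (Fin.castSucc_injective _)
  have := Finset.card_le_card_of_injOn (s := Finset.univ) (t := G.parents)
    (fun k : Fin G.longestPath => p k.castSucc)
    (fun k _ => G.mem_parents.2 ⟨_, hp k⟩) hinj.injOn
  simpa using this

theorem hasPath_one (h : 1 ≤ G.maxInDegree) : G.HasPath 1 := by
  by_contra hn
  have : ∀ i, (G.pa i).card = 0 := by
    intro i
    rw [Finset.card_eq_zero, Finset.eq_empty_iff_forall_notMem]
    intro j hj
    refine hn ⟨![j, i], fun k => ?_⟩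
    fin_cases k
    simpa using hj
  have h0 : G.maxInDegree ≤ 0 := Finset.sup_le fun i _ => (this i).le
  omega

theorem one_le_longestPath (h : 1 ≤ G.maxInDegree) : 1 ≤ G.longestPath :=
  G.le_longestPath (G.hasPath_one h)

/-- The weight matrix `Θ` is supported on the edges of `G`. -/
def Supports (Θ : Matrix (Fin (n + 1)) (Fin (n + 1)) ℝ) : Prop := ∀ j i, Θ j i ≠ 0 → j ∈ G.pa i

variable {G} {Θ : Matrix (Fin (n + 1)) (Fin (n + 1)) ℝ}

theorem Supports.lt (h : G.Supports Θ) : ∀ j i, Θ j i ≠ 0 → j < i :=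
  fun j i hji => G.lt_of_mem_pa i j (h j i hji)

theorem Supports.exists_path (h : G.Supports Θ) (ℓ : ℕ) (j i : Fin (n + 1))
    (hji : (Θ ^ ℓ) j i ≠ 0) :
    ∃ p : Fin (ℓ + 1) → Fin (n + 1), (∀ k : Fin ℓ, p k.castSucc ∈ G.pa (p k.succ)) ∧ p 0 = j := by
  induction ℓ generalizing j with
  | zero => exact ⟨fun _ => j, fun k => k.elim0, rfl⟩
  | succ ℓ ih =>
    rw [pow_succ', mul_apply] at hji
    obtain ⟨k, -, hk⟩ := Finset.exists_ne_zero_of_sum_ne_zero hji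
    obtain ⟨p, hp, hp0⟩ := ih k (right_ne_zero_of_mul hk)
    refine ⟨Fin.cons j p, fun r => ?_, rfl⟩
    refine Fin.cases ?_ (fun r => ?_) r
    · simpa [hp0] using h j k (left_ne_zero_of_mul hk)
    · rw [← Fin.succ_castSucc, Fin.cons_succ, Fin.cons_succ]
      exact hp r

theorem Supports.pow_eq_zero (h : G.Supports Θ) : Θ ^ (G.longestPath + 1) = 0 := by
  ext j i
  by_contra hji
  obtain ⟨p, hp, -⟩ := h.exists_path _ j i hji
  have := G.le_longestPath ⟨p, hp⟩
  omega

theorem Supports.l1_column_le (h : G.Supports Θ) (hn : ∀ i, l2norm (column Θ i) ≤ 1)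
    (i : Fin (n + 1)) : ∑ j, |Θ j i| ≤ Real.sqrt G.maxInDegree := by
  have h1 : ∑ j, |Θ j i| = ∑ j ∈ G.pa i, |Θ j i| := by
    refine (Finset.sum_subset (Finset.subset_univ _) fun j _ hj => ?_).symm
    rw [abs_eq_zero]
    by_contra h0
    exact hj (h j i h0)
  have h2 : (∑ j ∈ G.pa i, |Θ j i|) ^ 2 ≤ (G.pa i).card * ∑ j ∈ G.pa i, |Θ j i| ^ 2 :=
    sq_sum_le_card_mul_sum_sq
  have h3 : ∑ j ∈ G.pa i, |Θ j i| ^ 2 ≤ 1 := by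
    calc ∑ j ∈ G.pa i, |Θ j i| ^ 2 ≤ ∑ j, |Θ j i| ^ 2 :=
          Finset.sum_le_sum_of_subset_of_nonneg (Finset.subset_univ _) fun _ _ _ => sq_nonneg _
      _ = l2norm (column Θ i) ^ 2 := by
          rw [l2norm_sq]
          simp [dotProduct, column, pow_two]
      _ ≤ 1 := by
          have := hn i
          have := l2norm_nonneg (column Θ i)
          nlinarith
  rw [h1]
  refine Real.le_sqrt_of_sq_le (h2.trans ?_)
  have h4 : ((G.pa i).card : ℝ) ≤ G.maxInDegree := by exact_mod_cast G.card_pa_le i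
  have h5 : (0 : ℝ) ≤ (G.pa i).card := by positivity
  nlinarith

/-- The maximal `ℓ¹` norm of the columns is submultiplicative, so every further edge of a path costs
a factor `√d`. -/
theorem Supports.l1_column_pow_le (h : G.Supports Θ) (hn : ∀ i, l2norm (column Θ i) ≤ 1)
    (ℓ : ℕ) (i : Fin (n + 1)) : ∑ j, |(Θ ^ ℓ) j i| ≤ Real.sqrt G.maxInDegree ^ ℓ := by
  induction ℓ generalizing i with
  | zero =>
    simp only [pow_zero, one_apply]
    rw [Finset.sum_eq_single i] <;> simp +contextual
  | succ ℓ ih =>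
    calc ∑ j, |(Θ ^ (ℓ + 1)) j i| ≤ ∑ j, ∑ k, |(Θ ^ ℓ) j k| * |Θ k i| := by
          refine Finset.sum_le_sum fun j _ => ?_
          rw [pow_succ, mul_apply]
          refine (Finset.abs_sum_le_sum_abs _ _).trans_eq ?_
          exact Finset.sum_congr rfl fun k _ => abs_mul _ _
      _ = ∑ k, (∑ j, |(Θ ^ ℓ) j k|) * |Θ k i| := by
          rw [Finset.sum_comm]
          exact Finset.sum_congr rfl fun k _ => (Finset.sum_mul _ _ _).symm
      _ ≤ ∑ k, Real.sqrt G.maxInDegree ^ ℓ * |Θ k i| :=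
          Finset.sum_le_sum fun k _ => mul_le_mul_of_nonneg_right (ih k) (abs_nonneg _)
      _ = Real.sqrt G.maxInDegree ^ ℓ * ∑ k, |Θ k i| := (Finset.mul_sum _ _ _).symm
      _ ≤ _ := by
          rw [pow_succ]
          exact mul_le_mul_of_nonneg_left (h.l1_column_le hn i) (by positivity)

/-- The sensitivity of the reward node to a perturbation at node `i`. -/
noncomputable def sensitivity (G : CausalGraph n) (Θ : Matrix (Fin (n + 1)) (Fin (n + 1)) ℝ)
    (i : Fin (n + 1)) : ℝ :=
  ∑ ℓ ∈ Finset.range (G.longestPath + 1), (Θ ^ ℓ) i (Fin.last n)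

theorem Supports.sum_abs_sensitivity_le (h : G.Supports Θ) (hn : ∀ i, l2norm (column Θ i) ≤ 1)
    (hd : 1 ≤ G.maxInDegree) : ∑ i, |G.sensitivity Θ i| ≤
      (G.longestPath + 1) * (G.maxInDegree : ℝ) ^ ((G.longestPath : ℝ) - 1 / 2) := by
  have hd1 : (1 : ℝ) ≤ G.maxInDegree := by exact_mod_cast hd
  have hL : (1 : ℝ) ≤ G.longestPath := by exact_mod_cast G.one_le_longestPath hd
  calc ∑ i, |G.sensitivity Θ i|
      ≤ ∑ i, ∑ ℓ ∈ Finset.range (G.longestPath + 1), |(Θ ^ ℓ) i (Fin.last n)| :=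
        Finset.sum_le_sum fun i _ => Finset.abs_sum_le_sum_abs _ _
    _ = ∑ ℓ ∈ Finset.range (G.longestPath + 1), ∑ i, |(Θ ^ ℓ) i (Fin.last n)| := Finset.sum_comm
    _ ≤ ∑ ℓ ∈ Finset.range (G.longestPath + 1),
          (G.maxInDegree : ℝ) ^ ((G.longestPath : ℝ) - 1 / 2) := by
        refine Finset.sum_le_sum fun ℓ hℓ => (h.l1_column_pow_le hn ℓ _).trans ?_
        have hℓ' : (ℓ : ℝ) ≤ G.longestPath := by
          exact_mod_cast Nat.lt_succ_iff.1 (Finset.mem_range.1 hℓ)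
        rw [Real.sqrt_eq_rpow, ← Real.rpow_natCast, ← Real.rpow_mul (by positivity)]
        -- `ℓ/2 ≤ L - 1/2` because `ℓ ≤ L` and `L ≥ 1`.
        exact Real.rpow_le_rpow_of_exponent_le hd1 (by linarith)
    _ = _ := by simp

theorem Supports.abs_sensitivity_le (h : G.Supports Θ) (hn : ∀ i, l2norm (column Θ i) ≤ 1)
    (hd : 1 ≤ G.maxInDegree) (i : Fin (n + 1)) : |G.sensitivity Θ i| ≤
      (G.longestPath + 1) * (G.maxInDegree : ℝ) ^ ((G.longestPath : ℝ) - 1 / 2) :=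
  (Finset.single_le_sum (f := fun i => |G.sensitivity Θ i|) (fun _ _ => abs_nonneg _)
    (Finset.mem_univ i)).trans (h.sum_abs_sensitivity_le hn hd)

/-- No path of positive length leaves a childless node. This restricts the regret to few nodes and
avoids a factor `N`. -/
theorem Supports.sensitivity_eq_zero (h : G.Supports Θ) {i : Fin (n + 1)}
    (hi : i ∉ insert (Fin.last n) G.parents) : G.sensitivity Θ i = 0 := by
  simp only [Finset.mem_insert, not_or, G.mem_parents, not_exists] at hi
  refine Finset.sum_eq_zero fun ℓ _ => ?_
  cases ℓ with
  | zero => simpa [one_apply] using hi.1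
  | succ ℓ =>
    rw [pow_succ', mul_apply]
    refine Finset.sum_eq_zero fun k _ => ?_
    have : Θ i k = 0 := by
      by_contra h0
      exact hi.2 k (h i k h0)
    rw [this, zero_mul]

theorem Supports.semSolution_eq (h : G.Supports Θ) (e : Fin (n + 1) → ℝ) :
    semSolution Θ e = (∑ ℓ ∈ Finset.range (G.longestPath + 1), Θ ^ ℓ)ᵀ *ᵥ e := by
  have hinv : (1 - Θᵀ)⁻¹ = (∑ ℓ ∈ Finset.range (G.longestPath + 1), Θ ^ ℓ)ᵀ := by
    refine inv_eq_left_inv ?_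
    rw [← transpose_one, ← transpose_sub, ← transpose_mul, ← neg_sub Θ 1, neg_mul, mul_geom_sum,
      h.pow_eq_zero]
    simp
  rw [semSolution, hinv]

theorem Supports.semSolution_last (h : G.Supports Θ) (e : Fin (n + 1) → ℝ) :
    semSolution Θ e (Fin.last n) = ∑ i, G.sensitivity Θ i * e i := by
  rw [h.semSolution_eq, mulVec, dotProduct]
  refine Finset.sum_congr rfl fun i _ => ?_
  rw [transpose_apply, Matrix.sum_apply, sensitivity]

theorem Supports.rewardOf_eq (h : G.Supports Θ) (ν : Fin (n + 1) → ℝ) :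
    RobustLCB.rewardOf G ν Θ = semSolution Θ ν (Fin.last n) := by
  rw [h.semSolution_last, RobustLCB.rewardOf, dotProduct]
  refine Finset.sum_congr rfl fun i _ => ?_
  simp [sensitivity, column]

/-- The effect on the reward node of replacing the weights `D` by `Θ`. -/
theorem Supports.semSolution_last_sub (h : G.Supports Θ)
    {D : Matrix (Fin (n + 1)) (Fin (n + 1)) ℝ} (hD : ∀ j i, D j i ≠ 0 → j < i)
    (e : Fin (n + 1) → ℝ) :
    semSolution Θ e (Fin.last n) - semSolution D e (Fin.last n) =
      ∑ i, G.sensitivity Θ i * (column (Θ - D) i ⬝ᵥ semSolution D e) := by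
  -- The difference of the states solves the model `Θ` driven by `(Θ - D)ᵀ` applied to the state of
  -- `D`. Only `Θ` is expanded into paths, so `D` may have edges outside the graph.
  have h1 : semSolution Θ e - semSolution D e =
      semSolution Θ ((Θ - D)ᵀ *ᵥ semSolution D e) := by
    have hx := (eq_semSolution_iff D hD e _).1 rfl
    have hy := (eq_semSolution_iff Θ h.lt e _).1 rfl
    rw [eq_semSolution_iff Θ h.lt]
    calc semSolution Θ e - semSolution D e
        = (Θᵀ *ᵥ semSolution Θ e + e) - (Dᵀ *ᵥ semSolution D e + e) := by rw [← hx, ← hy]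
      _ = _ := by
        rw [transpose_sub, sub_mulVec, mulVec_sub]
        abel
  rw [← Pi.sub_apply, h1, h.semSolution_last]
  rfl

end CausalGraph

theorem CausalBandit.supports_weights {n : ℕ} {G : CausalGraph n} (M : CausalBandit G)
    (A : Finset (Fin (n + 1))) : G.Supports (M.weights A) := by
  intro j i hji
  by_cases hi : i ∈ A
  · exact M.support_Bstar j i (by simpa [weights, hi] using hji)
  · exact M.support_B j i (by simpa [weights, hi] using hji)

theorem CausalBandit.column_weights {n : ℕ} {G : CausalGraph n} (M : CausalBandit G)
    (A : Finset (Fin (n + 1))) (i : Fin (n + 1)) :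
    column (M.weights A) i = if i ∈ A then column M.Bstar i else column M.B i := by
  ext j
  by_cases hi : i ∈ A <;> simp [weights, hi, column]

theorem CausalBandit.l2norm_column_weights_le {n : ℕ} {G : CausalGraph n} (M : CausalBandit G)
    (A : Finset (Fin (n + 1))) (i : Fin (n + 1)) : l2norm (column (M.weights A) i) ≤ 1 := by
  rw [M.column_weights]
  split_ifs
  · exact M.norm_Bstar_le i
  · exact M.norm_B_le i

theorem column_sub {ι : Type*} (A B : Matrix ι ι ℝ) (i : ι) :
    column (A - B) i = column A i - column B i := rfl

/-- Each coordinate of the state is determined by the earlier ones and its own noise. -/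
theorem semSolution_apply {n : ℕ} {D : Matrix (Fin n) (Fin n) ℝ}
    (hD : ∀ j i, D j i ≠ 0 → j < i) (e : Fin n → ℝ) (i : Fin n) :
    semSolution D e i = column D i ⬝ᵥ semSolution D e + e i :=
  congrFun ((eq_semSolution_iff D hD e _).1 rfl) i

/-! ### Independence and integration of fresh noise. -/

section Independence

variable {Ω : Type*} {mΩ : MeasurableSpace Ω} {μ : Measure Ω}

/-- The identity into `Ω` with the smaller σ-algebra plays the role of the random variable "the
past". -/
theorem indepFun_id_of_indep {E : Type*} [mE : MeasurableSpace E] {m : MeasurableSpace Ω}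
    {η : Ω → E} (h : Indep m (mE.comap η) μ) : @IndepFun Ω Ω E mΩ m mE id η μ := by
  refine (@IndepFun_iff_Indep Ω Ω E mΩ m mE id η μ).2 ?_
  rwa [MeasurableSpace.comap_id]

variable [IsProbabilityMeasure μ]

/-- The joint law is a product, so `η` can be integrated out with `φ` frozen. With `φ` the past,
this takes the place of conditional expectations. -/
theorem lintegral_comp_indepFun {Ω' E : Type*} [MeasurableSpace Ω'] [MeasurableSpace E]
    {φ : Ω → Ω'} {η : Ω → E} (hφ : Measurable φ) (hη : Measurable η) (h : IndepFun φ η μ)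
    {f : Ω' × E → ENNReal} (hf : Measurable f) :
    ∫⁻ ω, f (φ ω, η ω) ∂μ = ∫⁻ ω, ∫⁻ x, f (φ ω, x) ∂(μ.map η) ∂μ := by
  have : IsProbabilityMeasure (μ.map η) := Measure.isProbabilityMeasure_map hη.aemeasurable
  have : IsProbabilityMeasure (μ.map φ) := Measure.isProbabilityMeasure_map hφ.aemeasurable
  rw [← lintegral_map (f := f) hf (hφ.prodMk hη),
    (indepFun_iff_map_prod_eq_prod_map_map hφ.aemeasurable hη.aemeasurable).1 h,
    lintegral_prod _ hf.aemeasurable, lintegral_map hf.lintegral_prod_right' hφ]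

/-- Freezing applied to the indicator of the complement, whose integral vanishes. -/
theorem ae_ae_of_indepFun {Ω' E : Type*} [MeasurableSpace Ω'] [MeasurableSpace E]
    {φ : Ω → Ω'} {η : Ω → E} (hφ : Measurable φ) (hη : Measurable η) (h : IndepFun φ η μ)
    {s : Set (Ω' × E)} (hs : MeasurableSet s) (hae : ∀ᵐ ω ∂μ, (φ ω, η ω) ∈ s) :
    ∀ᵐ ω ∂μ, ∀ᵐ x ∂(μ.map η), (φ ω, x) ∈ s := by
  have h1 := lintegral_comp_indepFun hφ hη h (f := sᶜ.indicator 1)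
    (measurable_one.indicator hs.compl)
  have h2 : ∫⁻ ω, sᶜ.indicator 1 (φ ω, η ω) ∂μ = 0 := by
    have h0 : (fun ω => sᶜ.indicator (1 : Ω' × E → ENNReal) (φ ω, η ω)) =ᵐ[μ] 0 := by
      filter_upwards [hae] with ω hω
      simp [hω]
    rw [lintegral_congr_ae h0]
    simp
  rw [h2] at h1
  have h3 := (lintegral_eq_zero_iff (f := fun ω => ∫⁻ x, sᶜ.indicator 1 (φ ω, x) ∂(μ.map η))
    ((measurable_one.indicator hs.compl).lintegral_prod_right'.comp hφ)).1 h1.symm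
  filter_upwards [h3] with ω hω
  have h4 := (lintegral_eq_zero_iff
    ((measurable_one.indicator hs.compl).comp measurable_prodMk_left)).1 hω
  filter_upwards [h4] with x hx
  by_contra hc
  simp [hc] at hx

theorem integral_comp_indepFun {Ω' E : Type*} [MeasurableSpace Ω'] [MeasurableSpace E]
    {φ : Ω → Ω'} {η : Ω → E} (hφ : Measurable φ) (hη : Measurable η) (h : IndepFun φ η μ)
    {f : Ω' × E → ℝ} (hf : Measurable f) (hint : Integrable (fun ω => f (φ ω, η ω)) μ) :
    ∫ ω, f (φ ω, η ω) ∂μ = ∫ ω, ∫ x, f (φ ω, x) ∂(μ.map η) ∂μ := by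
  have : IsProbabilityMeasure (μ.map η) := Measure.isProbabilityMeasure_map hη.aemeasurable
  have : IsProbabilityMeasure (μ.map φ) := Measure.isProbabilityMeasure_map hφ.aemeasurable
  have hm := (indepFun_iff_map_prod_eq_prod_map_map hφ.aemeasurable hη.aemeasurable).1 h
  have hi : Integrable f ((μ.map φ).prod (μ.map η)) := by
    rw [← hm]
    exact (integrable_map_measure hf.aestronglyMeasurable (hφ.prodMk hη).aemeasurable).2 hint
  rw [← integral_map (f := f) (hφ.prodMk hη).aemeasurable hf.aestronglyMeasurable, hm,
    integral_prod _ hi,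
    integral_map hφ.aemeasurable hf.stronglyMeasurable.integral_prod_right'.aestronglyMeasurable]

/-- The intersections `A ∩ B` form a π-system generating `m₁ ⊔ m₂`, and on it the two hypotheses
factor the measure. This joins independence over time with independence across nodes. -/
theorem indep_sup_of_indep {m₁ m₂ m₃ : MeasurableSpace Ω} (h₁ : m₁ ≤ mΩ) (h₂ : m₂ ≤ mΩ)
    (h₃ : m₃ ≤ mΩ) (h : Indep (m₂ ⊔ m₃) m₁ μ) (h' : Indep m₂ m₃ μ) : Indep (m₁ ⊔ m₂) m₃ μ := by
  set p : Set (Set Ω) := {s | ∃ A B, MeasurableSet[m₁] A ∧ MeasurableSet[m₂] B ∧ s = A ∩ B}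
    with hp
  have hgen : m₁ ⊔ m₂ = MeasurableSpace.generateFrom p := by
    refine le_antisymm (sup_le ?_ ?_) (MeasurableSpace.generateFrom_le ?_)
    · intro A hA
      exact MeasurableSpace.measurableSet_generateFrom
        ⟨A, Set.univ, hA, MeasurableSet.univ, by simp⟩
    · intro B hB
      exact MeasurableSpace.measurableSet_generateFrom
        ⟨Set.univ, B, MeasurableSet.univ, hB, by simp⟩
    · rintro s ⟨A, B, hA, hB, rfl⟩
      exact MeasurableSet.inter ((le_sup_left : m₁ ≤ m₁ ⊔ m₂) A hA)
        ((le_sup_right : m₂ ≤ m₁ ⊔ m₂) B hB)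
  have hpi : IsPiSystem p := by
    rintro _ ⟨A, B, hA, hB, rfl⟩ _ ⟨A', B', hA', hB', rfl⟩ -
    exact ⟨A ∩ A', B ∩ B', hA.inter hA', hB.inter hB', Set.inter_inter_inter_comm _ _ _ _⟩
  refine IndepSets.indep (sup_le h₁ h₂) h₃ hpi (@MeasurableSpace.isPiSystem_measurableSet Ω m₃)
    hgen MeasurableSpace.generateFrom_measurableSet.symm ?_
  rw [IndepSets_iff]
  rintro _ C ⟨A, B, hA, hB, rfl⟩ hC
  rw [Indep_iff] at h h'
  have hBC : MeasurableSet[m₂ ⊔ m₃] (B ∩ C) :=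
    MeasurableSet.inter ((le_sup_left : m₂ ≤ m₂ ⊔ m₃) B hB) ((le_sup_right : m₃ ≤ m₂ ⊔ m₃) C hC)
  have e1 := h (B ∩ C) A hBC hA
  have e2 := h B A ((le_sup_left : m₂ ≤ m₂ ⊔ m₃) B hB) hA
  have e3 := h' B C hB hC
  rw [Set.inter_assoc, Set.inter_comm A, e1, e3, Set.inter_comm A, e2]
  ring

end Independence

/-! ### The method of mixtures for self-normalised sums. -/

section SelfNormalized

open scoped NNReal

theorem lintegral_exp_gaussianReal (v : ℝ≥0) (t : ℝ) :
    ∫⁻ g, ENNReal.ofReal (Real.exp (t * g)) ∂(gaussianReal 0 v) =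
      ENNReal.ofReal (Real.exp (v * t ^ 2 / 2)) := by
  rw [← ofReal_integral_eq_lintegral_ofReal (integrable_exp_mul_gaussianReal t)
    (ae_of_all _ fun _ => (Real.exp_pos _).le)]
  have := mgf_gaussianReal (X := id) (p := gaussianReal 0 v) (μ := 0) (v := v) (by simp) t
  rw [mgf] at this
  simp only [id] at this
  rw [this]
  simp

/-- Since `1 - r/(1+r) = 1/(1+r)`, the integrand times the standard Gaussian density is a multiple
of the density of variance `1 + r` times a linear exponential, so a Gaussian moment generating
function remains. -/
theorem lintegral_exp_sq_gaussianReal (c r : ℝ) (hr : 0 ≤ r) :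
    ∫⁻ g, ENNReal.ofReal (Real.exp ((c + Real.sqrt (r / (1 + r)) * g) ^ 2 / 2))
      ∂(gaussianReal 0 1) =
      ENNReal.ofReal (Real.sqrt (1 + r) * Real.exp (c ^ 2 * (1 + r) / 2)) := by
  set s := Real.sqrt (r / (1 + r)) with hs
  have hr1 : 0 < 1 + r := by linarith
  have hs2 : s ^ 2 = r / (1 + r) := Real.sq_sqrt (by positivity)
  obtain ⟨v, hv⟩ : ∃ v : ℝ≥0, (v : ℝ) = 1 + r := ⟨⟨1 + r, hr1.le⟩, rfl⟩
  have hv0 : v ≠ 0 := by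
    rintro rfl
    rw [NNReal.coe_zero] at hv
    linarith
  have key : ∀ g, gaussianPDF 0 1 g * ENNReal.ofReal (Real.exp ((c + s * g) ^ 2 / 2)) =
      ENNReal.ofReal (Real.sqrt (1 + r) * Real.exp (c ^ 2 / 2)) *
        (gaussianPDF 0 v g * ENNReal.ofReal (Real.exp ((c * s) * g))) := by
    intro g
    simp only [gaussianPDF]
    rw [← ENNReal.ofReal_mul (gaussianPDFReal_nonneg _ _ _),
      ← ENNReal.ofReal_mul (gaussianPDFReal_nonneg _ _ _), ← ENNReal.ofReal_mul (by positivity)]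
    congr 1
    simp only [gaussianPDFReal, hv, NNReal.coe_one, sub_zero, mul_one]
    have h2 : Real.sqrt (2 * Real.pi * (1 + r)) = Real.sqrt (2 * Real.pi) * Real.sqrt (1 + r) :=
      Real.sqrt_mul (by positivity) _
    have h3 : Real.sqrt (1 + r) ≠ 0 := (Real.sqrt_pos.2 hr1).ne'
    have h4 : Real.sqrt (2 * Real.pi) ≠ 0 := (Real.sqrt_pos.2 (by positivity)).ne'
    rw [h2, mul_assoc, ← Real.exp_add]
    have h5 : -g ^ 2 / 2 + (c + s * g) ^ 2 / 2 =
        c ^ 2 / 2 + (-g ^ 2 / (2 * (1 + r)) + c * s * g) := by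
      have : (c + s * g) ^ 2 = c ^ 2 + 2 * c * s * g + s ^ 2 * g ^ 2 := by ring
      rw [this, hs2]
      field_simp
      ring
    rw [h5, Real.exp_add, Real.exp_add]
    field_simp
  have hmeas : ∀ w : ℝ≥0, Measurable (gaussianPDF 0 w) := fun w => measurable_gaussianPDF 0 w
  rw [gaussianReal_of_var_ne_zero _ one_ne_zero, lintegral_withDensity_eq_lintegral_mul _ (hmeas 1)
    (by fun_prop)]
  simp only [Pi.mul_apply, key]
  rw [lintegral_const_mul _ (by have := hmeas v; fun_prop)]
  have h6 := lintegral_exp_gaussianReal v (c * s)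
  rw [gaussianReal_of_var_ne_zero _ hv0, lintegral_withDensity_eq_lintegral_mul _ (hmeas v)
    (by fun_prop)] at h6
  simp only [Pi.mul_apply] at h6
  rw [h6, ← ENNReal.ofReal_mul (by positivity), mul_assoc, ← Real.exp_add]
  congr 3
  simp only [hv, mul_pow, hs2]
  field_simp

/-- The one-step estimate of the method of mixtures, in one dimension. -/
theorem lintegral_exp_quadratic_le {P : Measure ℝ} [IsProbabilityMeasure P]
    (h : HasSubgaussianMGF id 1 P) (b r : ℝ) (hr : 0 ≤ r) :
    ∫⁻ x, ENNReal.ofReal (Real.exp ((2 * b * x + r * x ^ 2 - b ^ 2) / (2 * (1 + r)))) ∂P ≤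
      ENNReal.ofReal (Real.sqrt (1 + r)) := by
  have hr1 : 0 < 1 + r := by linarith
  set s := Real.sqrt (r / (1 + r)) with hs
  have hs2 : s ^ 2 = r / (1 + r) := Real.sq_sqrt (by positivity)
  set c := b / (1 + r) with hc
  set q := Real.exp (-(c ^ 2 * (1 + r) / 2)) 
  -- A Gaussian average over `g` linearises the square in `x`. After exchanging the integrals, only
  -- exponential moments of `x` are needed.
  have hsplit : ∀ x, ENNReal.ofReal
      (Real.exp ((2 * b * x + r * x ^ 2 - b ^ 2) / (2 * (1 + r)))) =
      ENNReal.ofReal q * ∫⁻ g, ENNReal.ofReal (Real.exp ((c + s * g) * x)) ∂(gaussianReal 0 1) := by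
    intro x
    have h1 : ∀ g, ENNReal.ofReal (Real.exp ((c + s * g) * x)) =
        ENNReal.ofReal (Real.exp (c * x)) * ENNReal.ofReal (Real.exp ((s * x) * g)) := by
      intro g
      rw [← ENNReal.ofReal_mul (Real.exp_pos _).le, ← Real.exp_add]
      congr 2
      ring
    simp only [h1]
    rw [lintegral_const_mul _ (by fun_prop), lintegral_exp_gaussianReal,
      ← ENNReal.ofReal_mul (Real.exp_pos _).le, ← ENNReal.ofReal_mul (Real.exp_pos _).le,
      ← Real.exp_add, ← Real.exp_add]
    congr 2
    rw [mul_pow, hs2, hc, NNReal.coe_one]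
    field_simp
    ring
  simp only [hsplit]
  rw [lintegral_const_mul _ (by fun_prop), lintegral_lintegral_swap (by fun_prop)]
  have hx : ∀ t, ∫⁻ x, ENNReal.ofReal (Real.exp (t * x)) ∂P ≤
      ENNReal.ofReal (Real.exp (t ^ 2 / 2)) := by
    intro t
    have h2 := h.mgf_le t
    have h3 := h.integrable_exp_mul t
    simp only [mgf, id] at h2 h3
    rw [← ofReal_integral_eq_lintegral_ofReal h3 (ae_of_all _ fun _ => (Real.exp_pos _).le)]
    refine ENNReal.ofReal_le_ofReal (h2.trans_eq ?_)
    simp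
  calc ENNReal.ofReal q * ∫⁻ g, ∫⁻ x, ENNReal.ofReal (Real.exp ((c + s * g) * x)) ∂P
        ∂(gaussianReal 0 1)
      ≤ ENNReal.ofReal q * ∫⁻ g, ENNReal.ofReal (Real.exp ((c + s * g) ^ 2 / 2))
          ∂(gaussianReal 0 1) := by
        gcongr
        exact hx _
    _ = ENNReal.ofReal (Real.sqrt (1 + r)) := by
        rw [lintegral_exp_sq_gaussianReal c r hr, ← ENNReal.ofReal_mul (Real.exp_pos _).le,
          mul_left_comm, ← Real.exp_add]
        simp

variable {Ω ι : Type*} [DecidableEq ι]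

/-- The Gram matrix of the vectors `z 1, …, z t`, regularized by the identity. -/
def gramMatrix (z : ℕ → ι → ℝ) (t : ℕ) : Matrix ι ι ℝ :=
  (∑ s ∈ Finset.Icc 1 t, vecMulVec (z s) (z s)) + 1

theorem gramMatrix_succ (z : ℕ → ι → ℝ) (t : ℕ) :
    gramMatrix z (t + 1) = gramMatrix z t + vecMulVec (z (t + 1)) (z (t + 1)) := by
  rw [gramMatrix, gramMatrix, Finset.sum_Icc_succ_top (by omega)]
  abel

theorem measurable_gramMatrix {m : MeasurableSpace Ω} {z : ℕ → Ω → ι → ℝ} {t : ℕ}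
    (h : ∀ s ∈ Finset.Icc 1 t, ∀ i, Measurable fun ω => z s ω i) (i j : ι) :
    Measurable fun ω => gramMatrix (fun s => z s ω) t i j := by
  simp only [gramMatrix, Matrix.add_apply, Matrix.sum_apply, vecMulVec_apply]
  exact (Finset.measurable_sum _ fun s hs => (h s hs i).mul (h s hs j)).add_const _

variable [Fintype ι]

theorem posDef_gramMatrix (z : ℕ → ι → ℝ) (t : ℕ) : (gramMatrix z t).PosDef :=
  (PosDef.one).posSemidef_add (posSemidef_sum _ fun _ _ => posSemidef_vecMulVec _)

/-- The integrated likelihood ratio of the method of mixtures. -/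
noncomputable def mixtureValue (V : Matrix ι ι ℝ) (S : ι → ℝ) : ℝ :=
  Real.exp ((S ⬝ᵥ V⁻¹ *ᵥ S) / 2) / Real.sqrt V.det

/-- Sherman-Morrison and the determinant lemma isolate the new scalar `x` in the quadratic
exponential of `lintegral_exp_quadratic_le`. -/
theorem mixtureValue_step {V : Matrix ι ι ℝ} (hV : V.PosDef) (S z : ι → ℝ) (x : ℝ) :
    mixtureValue (V + vecMulVec z z) (S + x • z) =
      mixtureValue V S / Real.sqrt (1 + z ⬝ᵥ V⁻¹ *ᵥ z) *
        Real.exp ((2 * (z ⬝ᵥ V⁻¹ *ᵥ S) * x + (z ⬝ᵥ V⁻¹ *ᵥ z) * x ^ 2 - (z ⬝ᵥ V⁻¹ *ᵥ S) ^ 2) /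
          (2 * (1 + z ⬝ᵥ V⁻¹ *ᵥ z))) := by
  have hr := quadForm_nonneg hV.inv.posSemidef z
  have hsym := dotProduct_mulVec_symm hV.inv.isHermitian S z
  unfold mixtureValue
  rw [det_add_vecMulVec hV, Real.sqrt_mul hV.det_pos.le, inv_add_vecMulVec hV, div_div,
    div_mul_eq_mul_div, ← Real.exp_add]
  congr 2
  simp only [sub_mulVec, smul_mulVec, dotProduct_sub, dotProduct_smul, quadForm_vecMulVec,
    smul_eq_mul]
  have h1 : (V⁻¹ *ᵥ z) ⬝ᵥ (S + x • z) = z ⬝ᵥ V⁻¹ *ᵥ S + x * (z ⬝ᵥ V⁻¹ *ᵥ z) := by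
    rw [dotProduct_comm, add_dotProduct, smul_dotProduct, hsym, smul_eq_mul]
  rw [h1]
  simp only [mulVec_add, mulVec_smul, dotProduct_add, add_dotProduct, smul_dotProduct,
    dotProduct_smul, smul_eq_mul, hsym]
  field_simp
  ring

variable {mΩ : MeasurableSpace Ω} {μ : Measure Ω} [IsProbabilityMeasure μ]

theorem measurable_mixture_integrand {q b r : Ω → ℝ} (hq : Measurable q) (hb : Measurable b)
    (hr : Measurable r) : Measurable fun p : Ω × ℝ =>
      ENNReal.ofReal (q p.1 / Real.sqrt (1 + r p.1) *
        Real.exp ((2 * b p.1 * p.2 + r p.1 * p.2 ^ 2 - b p.1 ^ 2) / (2 * (1 + r p.1)))) := by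
  fun_prop

/-- The expected mixture value of a sub-Gaussian sum along predictable vectors is at most `1`. -/
theorem lintegral_mixtureValue_le_one (T : ℕ) (H : ℕ → MeasurableSpace Ω)
    (z : ℕ → Ω → ι → ℝ) (η : ℕ → Ω → ℝ)
    (hH : ∀ t ∈ Finset.Icc 1 T, H t ≤ mΩ)
    (hz : ∀ t ∈ Finset.Icc 1 T, ∀ s ∈ Finset.Icc 1 t, ∀ i, Measurable[H t] fun ω => z s ω i)
    (hη : ∀ t ∈ Finset.Icc 1 T, ∀ s ∈ Finset.Ico 1 t, Measurable[H t] (η s))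
    (hη' : ∀ t ∈ Finset.Icc 1 T, Measurable (η t))
    (hind : ∀ t ∈ Finset.Icc 1 T, Indep (H t) (MeasurableSpace.comap (η t) inferInstance) μ)
    (hsub : ∀ t ∈ Finset.Icc 1 T, HasSubgaussianMGF (η t) 1 μ) (t : ℕ) (ht : t ≤ T) :
    ∫⁻ ω, ENNReal.ofReal (mixtureValue (gramMatrix (fun s => z s ω) t)
      (∑ s ∈ Finset.Icc 1 t, η s ω • z s ω)) ∂μ ≤ 1 := by
  induction t with
  | zero => simp [mixtureValue, gramMatrix]
  | succ t ih =>
    have ht1 : t + 1 ∈ Finset.Icc 1 T := Finset.mem_Icc.2 ⟨by omega, ht⟩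
    refine le_trans ?_ (ih (by omega))
    have hlaw : IsProbabilityMeasure (μ.map (η (t + 1))) :=
      Measure.isProbabilityMeasure_map (hη' _ ht1).aemeasurable
    have hsubP : HasSubgaussianMGF id 1 (μ.map (η (t + 1))) := by
      refine ⟨fun u => ?_, fun u => ?_⟩
      · exact (integrable_map_measure (by fun_prop) (hη' _ ht1).aemeasurable).2
          ((hsub _ ht1).integrable_exp_mul u)
      · rw [mgf_id_map (hη' _ ht1).aemeasurable]
        exact (hsub _ ht1).mgf_le u
    set V : Ω → Matrix ι ι ℝ := fun ω => gramMatrix (fun s => z s ω) t with hV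
    set S : Ω → ι → ℝ := fun ω => ∑ s ∈ Finset.Icc 1 t, η s ω • z s ω with hS
    set b : Ω → ℝ := fun ω => z (t + 1) ω ⬝ᵥ (V ω)⁻¹ *ᵥ S ω with hb
    set r : Ω → ℝ := fun ω => z (t + 1) ω ⬝ᵥ (V ω)⁻¹ *ᵥ z (t + 1) ω with hr
    have hVp : ∀ ω, (V ω).PosDef := fun ω => posDef_gramMatrix _ _
    have hr0 : ∀ ω, 0 ≤ r ω := fun ω => quadForm_nonneg (hVp ω).inv.posSemidef _
    have hq0 : ∀ ω, 0 ≤ mixtureValue (V ω) (S ω) := fun ω => by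
      unfold mixtureValue; positivity
    have hzm := hz (t + 1) ht1
    have hVm : ∀ i j, Measurable[H (t + 1)] fun ω => V ω i j :=
      measurable_gramMatrix (m := H (t + 1)) fun s hs => hzm s
        (Finset.mem_Icc.2 ⟨(Finset.mem_Icc.1 hs).1, by have := (Finset.mem_Icc.1 hs).2; omega⟩)
    have hVi : ∀ i j, Measurable[H (t + 1)] fun ω => (V ω)⁻¹ i j :=
      measurable_matrix_inv (mΩ := H (t + 1)) hVm
    have hSm : ∀ i, Measurable[H (t + 1)] fun ω => S ω i := by
      intro i
      simp only [hS, Finset.sum_apply, Pi.smul_apply, smul_eq_mul]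
      refine Finset.measurable_sum _ fun s hs => ?_
      obtain ⟨hs1, hs2⟩ := Finset.mem_Icc.1 hs
      exact Measurable.mul (hη _ ht1 s (Finset.mem_Ico.2 ⟨hs1, by omega⟩))
        (hzm s (Finset.mem_Icc.2 ⟨hs1, by omega⟩) i)
    have hzt := hzm (t + 1) (Finset.mem_Icc.2 ⟨by omega, le_rfl⟩)
    have hbm : Measurable[H (t + 1)] b :=
      measurable_dotProduct (mΩ := H (t + 1)) hzt
        (measurable_mulVec (mΩ := H (t + 1)) hVi hSm)
    have hrm : Measurable[H (t + 1)] r := measurable_quadForm (mΩ := H (t + 1)) hVi hzt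
    have hqm : Measurable[H (t + 1)] fun ω => mixtureValue (V ω) (S ω) := by
      unfold mixtureValue
      have h1 := measurable_quadForm (mΩ := H (t + 1)) hVi hSm
      have h2 := measurable_matrix_det (mΩ := H (t + 1)) hVm
      fun_prop
    -- The old mixture value and the coefficients `b`, `r` are measurable for `H (t + 1)`, so they
    -- are frozen while the new noise is integrated out.
    have hstep := @lintegral_comp_indepFun Ω mΩ μ _ Ω ℝ (H (t + 1)) _ id (η (t + 1))
      (measurable_id'' (hH _ ht1)) (hη' _ ht1)
      (indepFun_id_of_indep (hind _ ht1))
      (fun p => ENNReal.ofReal (mixtureValue (V p.1) (S p.1) / Real.sqrt (1 + r p.1) *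
        Real.exp ((2 * b p.1 * p.2 + r p.1 * p.2 ^ 2 - b p.1 ^ 2) / (2 * (1 + r p.1)))))
      (@measurable_mixture_integrand Ω (H (t + 1)) _ _ _ hqm hbm hrm)
    have hrec : ∀ ω, mixtureValue (gramMatrix (fun s => z s ω) (t + 1))
        (∑ s ∈ Finset.Icc 1 (t + 1), η s ω • z s ω) =
        mixtureValue (V ω) (S ω) / Real.sqrt (1 + r ω) *
        Real.exp ((2 * b ω * η (t + 1) ω + r ω * η (t + 1) ω ^ 2 - b ω ^ 2) /
          (2 * (1 + r ω))) := by
      intro ω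
      rw [gramMatrix_succ, Finset.sum_Icc_succ_top (by omega)]
      exact mixtureValue_step (hVp ω) (S ω) (z (t + 1) ω) (η (t + 1) ω)
    simp only [hrec]
    simp only [id] at hstep
    rw [hstep]
    refine lintegral_mono fun ω => ?_
    have h1r : 0 < Real.sqrt (1 + r ω) := Real.sqrt_pos.2 (by linarith [hr0 ω])
    have h0 : 0 ≤ mixtureValue (V ω) (S ω) / Real.sqrt (1 + r ω) := by
      have := hq0 ω
      positivity
    simp only [ENNReal.ofReal_mul h0]
    rw [lintegral_const_mul _ (by fun_prop)]
    refine (mul_le_mul_right (lintegral_exp_quadratic_le hsubP (b ω) (r ω) (hr0 ω)) _).trans ?_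
    rw [← ENNReal.ofReal_mul h0, div_mul_cancel₀ _ h1r.ne']

end SelfNormalized

/-! ### Forms, inverses and determinants of Gram matrices. -/

section GramMatrix

variable {ι : Type*} [DecidableEq ι]

theorem gramMatrix_diag (z : ℕ → ι → ℝ) (t : ℕ) (j : ι) :
    gramMatrix z t j j = (∑ s ∈ Finset.Icc 1 t, z s j ^ 2) + 1 := by
  simp [gramMatrix, Matrix.sum_apply, vecMulVec_apply, pow_two]

variable [Fintype ι]

theorem quadForm_gramMatrix (z : ℕ → ι → ℝ) (t : ℕ) (v : ι → ℝ) :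
    v ⬝ᵥ gramMatrix z t *ᵥ v = (∑ s ∈ Finset.Icc 1 t, (z s ⬝ᵥ v) ^ 2) + l2norm v ^ 2 := by
  rw [gramMatrix, add_mulVec, dotProduct_add, one_mulVec, l2norm_sq, sum_mulVec, dotProduct_sum]
  simp only [quadForm_vecMulVec]

theorem quadForm_gramMatrix_mono (z : ℕ → ι → ℝ) {s t : ℕ} (h : s ≤ t) (v : ι → ℝ) :
    v ⬝ᵥ gramMatrix z s *ᵥ v ≤ v ⬝ᵥ gramMatrix z t *ᵥ v := by
  rw [quadForm_gramMatrix, quadForm_gramMatrix]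
  gcongr

theorem matNorm_gramMatrix_inv_le (z : ℕ → ι → ℝ) (t : ℕ) (v : ι → ℝ) :
    matNorm (gramMatrix z t)⁻¹ v ≤ l2norm v := by
  have h := matNorm_inv_anti (A := 1) PosDef.one (posDef_gramMatrix z t) (fun u => by
    rw [quadForm_gramMatrix, one_mulVec, l2norm_sq]
    have : 0 ≤ ∑ s ∈ Finset.Icc 1 t, (z s ⬝ᵥ u) ^ 2 := Finset.sum_nonneg fun _ _ => sq_nonneg _
    linarith) v
  refine h.trans_eq ?_
  rw [inv_one, matNorm, one_mulVec, l2norm_eq_sqrt]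

/-- Off `P` the diagonal is `1`, and on `P` the excess trace is at most `ρ k`. The slack `k ≤ t`
lets the radius of round `t` serve the data of rounds up to `t - 1`. -/
theorem det_gramMatrix_le (z : ℕ → ι → ℝ) (k t d : ℕ) (P : Finset ι) (ρ : ℝ) (hkt : k ≤ t)
    (hd : 1 ≤ d) (hP : P.card ≤ d) (hz : ∀ s ∈ Finset.Icc 1 k, ∀ j ∉ P, z s j = 0)
    (hρ : ∀ s ∈ Finset.Icc 1 k, l2norm (z s) ^ 2 ≤ ρ) (hρ0 : 0 ≤ ρ) :
    (gramMatrix z k).det ≤ (1 + ρ * t / d) ^ d := by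
  have hd0 : (0 : ℝ) < d := by exact_mod_cast hd
  refine det_le_pow_of_diag (posDef_gramMatrix z k) P d _ (by
    have : 0 ≤ ρ * t / d := by positivity
    linarith) hP ?_ ?_
  · intro j hj
    rw [gramMatrix_diag, Finset.sum_eq_zero, zero_add]
    intro s hs
    rw [hz s hs j hj]
    simp
  · calc ∑ j ∈ P, (gramMatrix z k j j - 1) = ∑ s ∈ Finset.Icc 1 k, ∑ j ∈ P, z s j ^ 2 := by
          rw [Finset.sum_comm]
          exact Finset.sum_congr rfl fun j _ => by rw [gramMatrix_diag]; ring
      _ ≤ ∑ s ∈ Finset.Icc 1 k, ρ := by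
          refine Finset.sum_le_sum fun s hs => le_trans ?_ (hρ s hs)
          rw [l2norm_sq, dotProduct]
          simp only [← pow_two]
          exact Finset.sum_le_sum_of_subset_of_nonneg (Finset.subset_univ _)
            fun _ _ _ => sq_nonneg _
      _ = ρ * k := by simp [mul_comm]
      _ ≤ ρ * t := by gcongr
      _ = _ := by field_simp; ring

/-- The form of `A` on vectors supported on `P` is at most the trace of `A` over `P`. -/
theorem quadForm_le_sum_diag {A : Matrix ι ι ℝ} (hA : A.PosSemidef) (P : Finset ι) (v : ι → ℝ)
    (hv : ∀ j ∉ P, v j = 0) : v ⬝ᵥ A *ᵥ v ≤ (∑ j ∈ P, A j j) * l2norm v ^ 2 := by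
  have hdiag : ∀ j, 0 ≤ A j j := fun j => hA.diag_nonneg
  -- Cauchy-Schwarz bounds off-diagonal entries by the diagonal, which makes the form at most the
  -- square of a single sum.
  have hentry : ∀ j k, v j * A j k * v k ≤ (|v j| * √(A j j)) * (|v k| * √(A k k)) := by
    intro j k
    have h := dotProduct_mulVec_sq_le hA (Pi.single j 1) (Pi.single k 1)
    simp only [mulVec_single_one, single_one_dotProduct, col_apply] at h
    have h1 : |A j k| ≤ √(A j j) * √(A k k) := by
      rw [← Real.sqrt_mul (hdiag j)]
      exact Real.abs_le_sqrt h
    calc v j * A j k * v k ≤ |v j * A j k * v k| := le_abs_self _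
      _ = |v j| * |v k| * |A j k| := by rw [abs_mul, abs_mul]; ring
      _ ≤ |v j| * |v k| * (√(A j j) * √(A k k)) := by gcongr
      _ = _ := by ring
  have h1 : v ⬝ᵥ A *ᵥ v = ∑ j ∈ P, ∑ k ∈ P, v j * A j k * v k := by
    simp only [dotProduct, mulVec, Finset.mul_sum]
    rw [← Finset.sum_subset (Finset.subset_univ P) (fun j _ hj => by simp [hv j hj])]
    refine Finset.sum_congr rfl fun j _ => ?_
    rw [← Finset.sum_subset (Finset.subset_univ P) (fun k _ hk => by simp [hv k hk])]
    exact Finset.sum_congr rfl fun k _ => by ring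
  have h2 : l2norm v ^ 2 = ∑ j ∈ P, |v j| ^ 2 := by
    rw [l2norm_sq, dotProduct,
      ← Finset.sum_subset (Finset.subset_univ P) (fun j _ hj => by simp [hv j hj])]
    exact Finset.sum_congr rfl fun j _ => by rw [sq_abs, pow_two]
  calc v ⬝ᵥ A *ᵥ v ≤ ∑ j ∈ P, ∑ k ∈ P, (|v j| * √(A j j)) * (|v k| * √(A k k)) := by
        rw [h1]
        exact Finset.sum_le_sum fun j _ => Finset.sum_le_sum fun k _ => hentry j k
    _ = (∑ j ∈ P, |v j| * √(A j j)) ^ 2 := by rw [pow_two, Finset.sum_mul_sum]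
    _ ≤ (∑ j ∈ P, |v j| ^ 2) * ∑ j ∈ P, √(A j j) ^ 2 := Finset.sum_mul_sq_le_sq_mul_sq _ _ _
    _ = _ := by
        rw [h2, mul_comm]
        congr 1
        exact Finset.sum_congr rfl fun j _ => Real.sq_sqrt (hdiag j)

end GramMatrix

/-! ### Estimation error and width of the confidence ellipsoids. -/

namespace RobustLCB

variable {n : ℕ} (G : CausalGraph n)

theorem restrictPa_of_notMem {i j : Fin (n + 1)} (hj : j ∉ G.pa i) (x : Fin (n + 1) → ℝ) :
    restrictPa G i x j = 0 := by simp [restrictPa, hj]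

theorem dotProduct_restrictPa {i : Fin (n + 1)} {v : Fin (n + 1) → ℝ}
    (hv : ∀ j, j ∉ G.pa i → v j = 0) (x : Fin (n + 1) → ℝ) :
    v ⬝ᵥ restrictPa G i x = v ⬝ᵥ x := by
  simp only [dotProduct]
  refine Finset.sum_congr rfl fun j _ => ?_
  by_cases hj : j ∈ G.pa i
  · simp [restrictPa, hj]
  · simp [hv j hj]

theorem restrictPa_dotProduct_comm (i : Fin (n + 1)) (u v : Fin (n + 1) → ℝ) :
    restrictPa G i u ⬝ᵥ v = u ⬝ᵥ restrictPa G i v := by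
  simp only [dotProduct, restrictPa]
  refine Finset.sum_congr rfl fun j _ => ?_
  split_ifs <;> simp

theorem l2norm_restrictPa_le (i : Fin (n + 1)) (x : Fin (n + 1) → ℝ) :
    l2norm (restrictPa G i x) ≤ l2norm x := by
  refine (sq_le_sq₀ (l2norm_nonneg _) (l2norm_nonneg _)).1 ?_
  rw [l2norm_sq, l2norm_sq]
  refine Finset.sum_le_sum fun j _ => ?_
  simp only [restrictPa]
  split_ifs
  · exact le_rfl
  · simpa using mul_self_nonneg (x j)

/-- The scaled parent vectors of the rounds in which node `i` is treated as under `A`. -/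
noncomputable def visitVec (a : ℕ → Finset (Fin (n + 1))) (X : ℕ → Fin (n + 1) → ℝ) (c : ℕ → ℝ)
    (i : Fin (n + 1)) (A : Finset (Fin (n + 1))) (s : ℕ) : Fin (n + 1) → ℝ :=
  open Classical in if (i ∈ a s ↔ i ∈ A) then c s • restrictPa G i (X s) else 0

variable {G} {a : ℕ → Finset (Fin (n + 1))} {X : ℕ → Fin (n + 1) → ℝ}
  {w : Fin (n + 1) → ℕ → ℝ} {i : Fin (n + 1)} {A : Finset (Fin (n + 1))}

theorem visitVec_of_notMem {c : ℕ → ℝ} {s : ℕ} {j : Fin (n + 1)} (hj : j ∉ G.pa i) :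
    visitVec G a X c i A s j = 0 := by
  unfold visitVec
  split_ifs
  · simp [restrictPa_of_notMem G hj]
  · rfl

theorem l2norm_visitVec_sq_le {c : ℕ → ℝ} {s : ℕ} {m ρ : ℝ} (hm : l2norm (X s) ≤ m)
    (hc : c s ^ 2 ≤ ρ) : l2norm (visitVec G a X c i A s) ^ 2 ≤ ρ * m ^ 2 := by
  have h0 := l2norm_nonneg (X s)
  unfold visitVec
  split_ifs
  · rw [l2norm_sq, smul_dotProduct, dotProduct_smul, ← l2norm_sq, smul_eq_mul, smul_eq_mul,
      ← mul_assoc, ← pow_two]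
    have h1 := l2norm_restrictPa_le G i (X s)
    have h2 := l2norm_nonneg (restrictPa G i (X s))
    have h3 : l2norm (restrictPa G i (X s)) ≤ m := h1.trans hm
    have h4 := (sq_nonneg (c s)).trans hc
    gcongr
  · rw [l2norm_zero]
    have := (sq_nonneg (c s)).trans hc
    simp only [ne_eq, OfNat.ofNat_ne_zero, not_false_eq_true, zero_pow]
    positivity

/-- Rounds that do not count carry the zero vector, so sums over the action-dependent set of rounds
become sums over `Icc 1 t`, where the results on `gramMatrix` apply. -/
theorem sum_visitVec {E : Type*} [AddCommMonoid E] (c : ℕ → ℝ) (t : ℕ)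
    (f : ℕ → (Fin (n + 1) → ℝ) → E) (hf : ∀ s, f s 0 = 0) :
    ∑ s ∈ Finset.Icc 1 t, f s (visitVec G a X c i A s) =
      ∑ s ∈ rounds a i A t, f s (c s • restrictPa G i (X s)) := by
  classical
  rw [rounds, Finset.sum_filter]
  refine Finset.sum_congr rfl fun s _ => ?_
  unfold visitVec
  split_ifs
  · rfl
  · exact hf s

theorem gramSq_eq (t : ℕ) :
    gramSq G a X w i A t = gramMatrix (visitVec G a X (w i) i A) t := by
  rw [gramSq, gramMatrix, sum_visitVec (w i) t (fun _ v => vecMulVec v v) (fun _ => by simp)]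
  congr 1
  refine Finset.sum_congr rfl fun s _ => ?_
  rw [smul_vecMulVec, vecMulVec_smul, smul_smul, pow_two]

theorem gram_eq {t : ℕ} (hw : ∀ s ∈ rounds a i A t, 0 ≤ w i s) :
    gram G a X w i A t = gramMatrix (visitVec G a X (fun s => √(w i s)) i A) t := by
  rw [gram, gramMatrix, sum_visitVec _ t (fun _ v => vecMulVec v v) (fun _ => by simp)]
  congr 1
  refine Finset.sum_congr rfl fun s hs => ?_
  rw [smul_vecMulVec, vecMulVec_smul, smul_smul, Real.mul_self_sqrt (hw s hs)]

theorem visitVec_congr {A' : Finset (Fin (n + 1))} (h : i ∈ A' ↔ i ∈ A) (c : ℕ → ℝ) :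
    visitVec G a X c i A' = visitVec G a X c i A := by
  funext s
  simp only [visitVec, h]

theorem gramSq_congr {A' : Finset (Fin (n + 1))} (h : i ∈ A' ↔ i ∈ A) (t : ℕ) :
    gramSq G a X w i A' t = gramSq G a X w i A t := by
  simp only [gramSq, rounds, h]

theorem mem_rounds {s t : ℕ} :
    s ∈ rounds a i A t ↔ s ∈ Finset.Icc 1 t ∧ (i ∈ a s ↔ i ∈ A) := by
  simp [rounds]

theorem quadForm_gramSq (t : ℕ) (v : Fin (n + 1) → ℝ) :
    v ⬝ᵥ gramSq G a X w i A t *ᵥ v =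
      (∑ s ∈ rounds a i A t, w i s ^ 2 * (restrictPa G i (X s) ⬝ᵥ v) ^ 2) + l2norm v ^ 2 := by
  rw [gramSq_eq, quadForm_gramMatrix, sum_visitVec (w i) t (fun _ u => (u ⬝ᵥ v) ^ 2) (by simp)]
  simp only [smul_dotProduct, smul_eq_mul, mul_pow]

theorem quadForm_gram {t : ℕ} (hw : ∀ s ∈ rounds a i A t, 0 ≤ w i s) (v : Fin (n + 1) → ℝ) :
    v ⬝ᵥ gram G a X w i A t *ᵥ v =
      (∑ s ∈ rounds a i A t, w i s * (restrictPa G i (X s) ⬝ᵥ v) ^ 2) + l2norm v ^ 2 := by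
  rw [gram_eq hw, quadForm_gramMatrix, sum_visitVec _ t (fun _ u => (u ⬝ᵥ v) ^ 2) (by simp)]
  simp only [smul_dotProduct, smul_eq_mul, mul_pow]
  congr 1
  exact Finset.sum_congr rfl fun s hs => by rw [Real.sq_sqrt (hw s hs)]

/-- In the dual norm of `V v` the inverse inside the estimator cancels. -/
theorem matNorm_sandwich {V W : Matrix (Fin (n + 1)) (Fin (n + 1)) ℝ} (hV : V.IsHermitian)
    (v : Fin (n + 1) → ℝ) : matNorm (V * W⁻¹ * V) v = matNorm W⁻¹ (V *ᵥ v) := by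
  unfold matNorm
  rw [Matrix.mul_assoc, ← mulVec_mulVec, ← mulVec_mulVec, dotProduct_mulVec_symm hV,
    dotProduct_comm]

/-- The error of the estimator in the norm of the confidence ellipsoid. -/
theorem matNorm_sub_estimate_le {ν θ : Fin (n + 1) → ℝ} {C m R : ℝ} {t : ℕ} {c η : ℕ → ℝ}
    (hC : 0 < C) (hθ : l2norm θ ≤ 1)
    (hX : ∀ s ∈ rounds a i A t, X s i - ν i = θ ⬝ᵥ restrictPa G i (X s) + c s + η s)
    (hw : ∀ s ∈ rounds a i A t, 0 ≤ w i s)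
    (hwr : ∀ s ∈ rounds a i A t,
      w i s * matNorm (gramSq G a X w i (a s) s)⁻¹ (restrictPa G i (X s)) ≤ 1 / C)
    (hc : ∑ s ∈ rounds a i A t, |c s| ≤ m * C)
    (hS : matNorm (gramSq G a X w i A t)⁻¹
      (∑ s ∈ Finset.Icc 1 t, η s • visitVec G a X (w i) i A s) ≤ R) :
    matNorm (gram G a X w i A t * (gramSq G a X w i A t)⁻¹ * gram G a X w i A t)
      (θ - estimate G ν a X w i A t) ≤ R + 1 + m := by
  have hVpos : (gram G a X w i A t).PosDef := by rw [gram_eq hw]; exact posDef_gramMatrix _ _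
  have hWpos : (gramSq G a X w i A t).PosDef := by rw [gramSq_eq]; exact posDef_gramMatrix _ _
  have hW := hWpos.inv.posSemidef
  set N := matNorm (gramSq G a X w i A t)⁻¹ with hN
  -- The summands are the regularisation, the model fluctuation and the noise.
  have hvec : gram G a X w i A t *ᵥ (θ - estimate G ν a X w i A t) =
      θ + -(∑ s ∈ rounds a i A t, (c s * w i s) • restrictPa G i (X s)) +
        -(∑ s ∈ Finset.Icc 1 t, η s • visitVec G a X (w i) i A s) := by
    rw [mulVec_sub, estimate, mulVec_inv_mulVec hVpos,
      sum_visitVec (w i) t (fun s u => η s • u) (by simp), gram, add_mulVec, one_mulVec, sum_mulVec]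
    have h1 : ∑ s ∈ rounds a i A t, (w i s * (X s i - ν i)) • restrictPa G i (X s) =
        (∑ s ∈ rounds a i A t, (w i s • vecMulVec (restrictPa G i (X s))
          (restrictPa G i (X s))) *ᵥ θ) +
        (∑ s ∈ rounds a i A t, (c s * w i s) • restrictPa G i (X s)) +
        ∑ s ∈ rounds a i A t, η s • w i s • restrictPa G i (X s) := by
      rw [← Finset.sum_add_distrib, ← Finset.sum_add_distrib]
      refine Finset.sum_congr rfl fun s hs => ?_
      rw [hX s hs, smul_mulVec, vecMulVec_mulVec]
      ext j
      simp only [Pi.add_apply, Pi.smul_apply, smul_eq_mul, op_smul_eq_smul,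
        dotProduct_comm (restrictPa G i (X s)) θ]
      ring
    rw [h1]
    abel
  rw [matNorm_sandwich hVpos.isHermitian, hvec]
  have h1 : N θ ≤ 1 := by
    rw [hN, gramSq_eq]
    exact (matNorm_gramMatrix_inv_le _ _ _).trans hθ
  have h2 : N (∑ s ∈ rounds a i A t, (c s * w i s) • restrictPa G i (X s)) ≤ m := by
    calc N (∑ s ∈ rounds a i A t, (c s * w i s) • restrictPa G i (X s))
        ≤ ∑ s ∈ rounds a i A t, N ((c s * w i s) • restrictPa G i (X s)) := matNorm_sum_le hW _ _
      _ ≤ ∑ s ∈ rounds a i A t, |c s| * (1 / C) := by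
          refine Finset.sum_le_sum fun s hs => ?_
          obtain ⟨hs1, hs2⟩ := mem_rounds.1 hs
          rw [hN, matNorm_smul, abs_mul, abs_of_nonneg (hw s hs), mul_assoc]
          refine mul_le_mul_of_nonneg_left (le_trans ?_ (hwr s hs)) (abs_nonneg _)
          refine mul_le_mul_of_nonneg_left ?_ (hw s hs)
          -- The weight was tuned to the Gram matrix at time `s`; the one at time `t ≥ s` is larger,
          -- so its dual norm is smaller.
          rw [gramSq_congr hs2, gramSq_eq, gramSq_eq]
          exact matNorm_inv_anti (posDef_gramMatrix _ _) (posDef_gramMatrix _ _)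
            (quadForm_gramMatrix_mono _ (Finset.mem_Icc.1 hs1).2) _
      _ = (∑ s ∈ rounds a i A t, |c s|) * (1 / C) := (Finset.sum_mul _ _ _).symm
      _ ≤ m * C * (1 / C) := by gcongr
      _ = m := by field_simp
  have h3 := matNorm_add_le hW (θ + -(∑ s ∈ rounds a i A t, (c s * w i s) • restrictPa G i (X s)))
    (-(∑ s ∈ Finset.Icc 1 t, η s • visitVec G a X (w i) i A s))
  have h4 := matNorm_add_le hW θ (-(∑ s ∈ rounds a i A t, (c s * w i s) • restrictPa G i (X s)))
  rw [matNorm_neg] at h3 h4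
  linarith

/-- The potential `∑_{j ∈ pa i} (U⁻¹)_{jj}` of the Gram matrix `U` of the parent vectors. -/
noncomputable def potential (G : CausalGraph n) (i : Fin (n + 1))
    (U : Matrix (Fin (n + 1)) (Fin (n + 1)) ℝ) : ℝ :=
  ∑ j ∈ G.pa i, U⁻¹ j j

/-- Inserting the first bound into the second and cancelling `q` bounds `q`. Then the first gives
`x² ≤ 16β²C²φ² + 8β²φ`. -/
theorem width_le_of_sq_le {x q β C φ : ℝ} (hC : 0 < C) (hφ : 0 ≤ φ) (hβ : 0 ≤ β) (hq : 0 ≤ q)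
    (h1 : x ^ 2 ≤ 2 * C * φ * q) (h2 : q ^ 2 ≤ (2 * β) ^ 2 * (x ^ 2 + q / C)) :
    x ≤ 4 * β * C * φ + 3 * β * √φ := by
  have h3 : q * q ≤ 4 * β ^ 2 * (2 * C * φ + 1 / C) * q := by
    calc q * q = q ^ 2 := (pow_two q).symm
      _ ≤ (2 * β) ^ 2 * (2 * C * φ * q + q / C) := by
          refine h2.trans (mul_le_mul_of_nonneg_left ?_ (sq_nonneg _))
          linarith
      _ = _ := by ring
  have h4 : q ≤ 4 * β ^ 2 * (2 * C * φ + 1 / C) := by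
    rcases hq.eq_or_lt with h0 | h0
    · rw [← h0]; positivity
    · exact le_of_mul_le_mul_right h3 h0
  have hs : √φ ^ 2 = φ := Real.sq_sqrt hφ
  have h5 : x ^ 2 ≤ (4 * β * C * φ + 3 * β * √φ) ^ 2 := by
    calc x ^ 2 ≤ 2 * C * φ * (4 * β ^ 2 * (2 * C * φ + 1 / C)) :=
          h1.trans (mul_le_mul_of_nonneg_left h4 (by positivity))
      _ = 16 * β ^ 2 * C ^ 2 * φ ^ 2 + 8 * β ^ 2 * φ := by
          field_simp
          ring
      _ ≤ 16 * β ^ 2 * C ^ 2 * φ ^ 2 + 24 * (β ^ 2 * C * φ * √φ) + 9 * β ^ 2 * φ := by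
          have e1 : 0 ≤ β ^ 2 * C * φ * √φ := by positivity
          have e2 : 0 ≤ β ^ 2 * φ := by positivity
          linarith
      _ = 16 * β ^ 2 * C ^ 2 * φ ^ 2 + 24 * (β ^ 2 * C * φ * √φ) + 9 * β ^ 2 * √φ ^ 2 := by
          rw [hs]
      _ = _ := by ring
  exact abs_le_of_sq_le_sq' h5 (by positivity) |>.2

/-- The Euclidean width of the confidence ellipsoid in terms of the potential. -/
theorem l2norm_sub_le_potential {β C m : ℝ} {t : ℕ} {θ θ' e : Fin (n + 1) → ℝ}
    (hC : 0 < C) (hm : 0 ≤ m) (hβ : 0 ≤ β)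
    (hθ : ∀ j, j ∉ G.pa i → θ j = 0) (hθ' : ∀ j, j ∉ G.pa i → θ' j = 0)
    (hn : l2norm θ ≤ 1) (hn' : l2norm θ' ≤ 1)
    (hw1 : ∀ s ∈ rounds a i A t, w i s ≤ 1 / C)
    (hw2 : ∀ s ∈ rounds a i A t, 1 / (C * (1 + m)) ≤ w i s)
    (hc : matNorm (gram G a X w i A t * (gramSq G a X w i A t)⁻¹ * gram G a X w i A t)
      (θ - e) ≤ β)
    (hc' : matNorm (gram G a X w i A t * (gramSq G a X w i A t)⁻¹ * gram G a X w i A t)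
      (θ' - e) ≤ β) {φ : ℝ}
    (hφ : φ = potential G i (gramMatrix (visitVec G a X (fun _ => 1 / (1 + m)) i A) t)) :
    l2norm (θ - θ') ≤ 4 * φ + 4 * β * C * φ + 3 * β * √φ := by
  have hM : 0 < 1 + m := by linarith
  have hw : ∀ s ∈ rounds a i A t, 0 ≤ w i s := fun s hs => le_trans (by positivity) (hw2 s hs)
  have hVpos : (gram G a X w i A t).PosDef := by rw [gram_eq hw]; exact posDef_gramMatrix _ _
  have hWpos : (gramSq G a X w i A t).PosDef := by rw [gramSq_eq]; exact posDef_gramMatrix _ _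
  have hUpos := posDef_gramMatrix (visitVec G a X (fun _ => 1 / (1 + m)) i A) t
  have hφ0 : 0 ≤ φ := by
    rw [hφ]
    exact Finset.sum_nonneg fun j _ => hUpos.inv.posSemidef.diag_nonneg
  set Δ := θ - θ' with hΔ
  have hΔs : ∀ j ∉ G.pa i, Δ j = 0 := fun j hj => by simp [hΔ, hθ j hj, hθ' j hj]
  have hΔ0 := l2norm_nonneg Δ
  have hs0 := Real.sqrt_nonneg φ
  -- For `φ > 1/2` the trivial bound `2` for points of the unit ball is below `4φ`. For `φ ≤ 1/2`
  -- the regularising term `φ‖Δ‖²` can be absorbed in `hU`.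
  rcases le_or_gt φ (1 / 2) with hφ1 | hφ1
  swap
  · have h1 : l2norm Δ ≤ 2 := (l2norm_sub_le θ θ').trans (by linarith)
    have h2 : 0 ≤ 4 * β * C * φ + 3 * β * √φ := by positivity
    linarith
  set g := ∑ s ∈ rounds a i A t, (restrictPa G i (X s) ⬝ᵥ Δ) ^ 2 with hg
  have hg0 : 0 ≤ g := Finset.sum_nonneg fun _ _ => sq_nonneg _
  set q := Δ ⬝ᵥ gram G a X w i A t *ᵥ Δ with hq
  -- the potential controls the Euclidean norm by the form of the data
  have hU : l2norm Δ ^ 2 ≤ 2 * φ * (g / (1 + m) ^ 2) := by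
    have h1 := dotProduct_sq_le_inv hUpos Δ Δ
    have h2 := quadForm_le_sum_diag hUpos.inv.posSemidef (G.pa i) Δ hΔs
    rw [← potential, ← hφ] at h2
    have h3 : Δ ⬝ᵥ gramMatrix (visitVec G a X (fun _ => 1 / (1 + m)) i A) t *ᵥ Δ =
        g / (1 + m) ^ 2 + l2norm Δ ^ 2 := by
      rw [quadForm_gramMatrix, sum_visitVec _ t (fun _ u => (u ⬝ᵥ Δ) ^ 2) (by simp), hg,
        Finset.sum_div]
      congr 1
      refine Finset.sum_congr rfl fun s _ => ?_
      rw [smul_dotProduct, smul_eq_mul]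
      field_simp
    rw [← l2norm_sq, h3] at h1
    have h4 : 0 ≤ g / (1 + m) ^ 2 := by positivity
    have h5 : (l2norm Δ ^ 2) ^ 2 ≤ φ * l2norm Δ ^ 2 * (g / (1 + m) ^ 2 + l2norm Δ ^ 2) :=
      h1.trans (mul_le_mul_of_nonneg_right h2 (by positivity))
    rcases (sq_nonneg (l2norm Δ)).eq_or_lt with h0 | h0
    · rw [← h0]; positivity
    · have h6 : l2norm Δ ^ 2 ≤ φ * (g / (1 + m) ^ 2 + l2norm Δ ^ 2) := by nlinarith
      nlinarith
  have hqg : g / (C * (1 + m)) ≤ q := by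
    rw [hq, quadForm_gram hw, hg, Finset.sum_div]
    have : ∑ s ∈ rounds a i A t, (restrictPa G i (X s) ⬝ᵥ Δ) ^ 2 / (C * (1 + m)) ≤
        ∑ s ∈ rounds a i A t, w i s * (restrictPa G i (X s) ⬝ᵥ Δ) ^ 2 := by
      refine Finset.sum_le_sum fun s hs => ?_
      rw [div_eq_mul_inv, mul_comm, ← one_div]
      exact mul_le_mul_of_nonneg_right (hw2 s hs) (sq_nonneg _)
    have := sq_nonneg (l2norm Δ)
    linarith
  have hq0 : 0 ≤ q := quadForm_nonneg hVpos.posSemidef Δ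
  have hΔq : l2norm Δ ^ 2 ≤ 2 * C * φ * q := by
    refine hU.trans ?_
    have h1 : g / (1 + m) ^ 2 ≤ C * q := by
      have h2 : g ≤ q * (C * (1 + m)) := (div_le_iff₀ (by positivity)).1 hqg
      rw [div_le_iff₀ (by positivity)]
      have h3 : 0 ≤ q * C := by positivity
      nlinarith [mul_nonneg h3 hm, mul_nonneg (mul_nonneg h3 hm) hm]
    nlinarith [mul_le_mul_of_nonneg_left h1 (mul_nonneg two_pos.le hφ0)]
  -- The upper bound on the weights enters here as `w² ≤ w/C`; the lower bound entered in `hqg`.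
  have hWq : Δ ⬝ᵥ gramSq G a X w i A t *ᵥ Δ ≤ l2norm Δ ^ 2 + q / C := by
    rw [hq, quadForm_gram hw, quadForm_gramSq]
    have h1 : ∑ s ∈ rounds a i A t, w i s ^ 2 * (restrictPa G i (X s) ⬝ᵥ Δ) ^ 2 ≤
        (∑ s ∈ rounds a i A t, w i s * (restrictPa G i (X s) ⬝ᵥ Δ) ^ 2) / C := by
      rw [Finset.sum_div]
      refine Finset.sum_le_sum fun s hs => ?_
      have h2 := mul_le_mul_of_nonneg_left (hw1 s hs) (hw s hs)
      have h3 := mul_le_mul_of_nonneg_right h2 (sq_nonneg (restrictPa G i (X s) ⬝ᵥ Δ))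
      calc _ = w i s * w i s * (restrictPa G i (X s) ⬝ᵥ Δ) ^ 2 := by ring
        _ ≤ _ := h3
        _ = _ := by ring
    have h2 : 0 ≤ l2norm Δ ^ 2 / C := by positivity
    rw [add_div]
    linarith
  have hwidth : matNorm (gramSq G a X w i A t)⁻¹ (gram G a X w i A t *ᵥ Δ) ≤ 2 * β := by
    rw [matNorm_sandwich hVpos.isHermitian] at hc hc'
    have h1 : gram G a X w i A t *ᵥ Δ = gram G a X w i A t *ᵥ (θ - e) +
        -(gram G a X w i A t *ᵥ (θ' - e)) := by
      rw [hΔ, ← mulVec_neg, ← mulVec_add]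
      congr 1
      abel
    rw [h1]
    have h2 := matNorm_add_le hWpos.inv.posSemidef (gram G a X w i A t *ᵥ (θ - e))
      (-(gram G a X w i A t *ᵥ (θ' - e)))
    rw [matNorm_neg] at h2
    linarith
  have hqq : q ^ 2 ≤ (2 * β) ^ 2 * (l2norm Δ ^ 2 + q / C) := by
    have h1 : q ≤ matNorm (gramSq G a X w i A t)⁻¹ (gram G a X w i A t *ᵥ Δ) *
        matNorm (gramSq G a X w i A t) Δ := by
      rw [hq, dotProduct_comm]
      exact dotProduct_le_matNorm_inv hWpos _ _
    have h2 : q ≤ 2 * β * matNorm (gramSq G a X w i A t) Δ :=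
      h1.trans (mul_le_mul_of_nonneg_right hwidth (matNorm_nonneg _ _))
    have h3 : q ^ 2 ≤ (2 * β * matNorm (gramSq G a X w i A t) Δ) ^ 2 := by gcongr
    rw [mul_pow, matNorm_sq hWpos.posSemidef] at h3
    exact h3.trans (mul_le_mul_of_nonneg_left hWq (sq_nonneg _))
  have h6 := width_le_of_sq_le hC hφ0 hβ hq0 hΔq hqq
  linarith

end RobustLCB

/-! ### Bounds and a closed form for the weights. -/

namespace RobustLCB

variable {n : ℕ} {G : CausalGraph n} {a : ℕ → Finset (Fin (n + 1))} {X : ℕ → Fin (n + 1) → ℝ}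
  {w : Fin (n + 1) → ℕ → ℝ} {ν : Fin (n + 1) → ℝ} {m C δ : ℝ} {T t : ℕ}

theorem gramSq_succ_self (i : Fin (n + 1)) (ht : 1 ≤ t) :
    gramSq G a X w i (a t) t = gramSq G a X w i (a t) (t - 1) +
      vecMulVec (w i t • restrictPa G i (X t)) (w i t • restrictPa G i (X t)) := by
  obtain ⟨k, rfl⟩ : ∃ k, t = k + 1 := ⟨t - 1, by omega⟩
  rw [gramSq_eq, gramSq_eq, gramMatrix_succ, Nat.add_sub_cancel]
  simp [visitVec]

namespace FollowsAlgorithm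

theorem weight_pos (h : FollowsAlgorithm G ν m C δ T a X w) (hC : 0 < C)
    (ht : t ∈ Finset.Icc 1 T) (i : Fin (n + 1)) : 0 < w i t := by
  rw [h.weight_eq t ht i]
  have : (0 : ℝ) < max 1 (matNorm (gramSq G a X w i (a t) t)⁻¹ (restrictPa G i (X t))) :=
    lt_max_of_lt_left one_pos
  positivity

theorem weight_le (h : FollowsAlgorithm G ν m C δ T a X w) (hC : 0 < C)
    (ht : t ∈ Finset.Icc 1 T) (i : Fin (n + 1)) : w i t ≤ 1 / C := by
  rw [h.weight_eq t ht i]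
  refine one_div_le_one_div_of_le hC ?_
  exact le_mul_of_one_le_right hC.le (le_max_left _ _)

/-- The Gram matrix dominates the identity, so the dual norm of the parent vector is at most `m`. -/
theorem le_weight (h : FollowsAlgorithm G ν m C δ T a X w) (hC : 0 < C)
    (ht : t ∈ Finset.Icc 1 T) (i : Fin (n + 1)) (hm : l2norm (X t) ≤ m) :
    1 / (C * (1 + m)) ≤ w i t := by
  rw [h.weight_eq t ht i]
  have h0 : (0 : ℝ) < max 1 (matNorm (gramSq G a X w i (a t) t)⁻¹ (restrictPa G i (X t))) :=
    lt_max_of_lt_left one_pos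
  have hm0 := (l2norm_nonneg (X t)).trans hm
  refine one_div_le_one_div_of_le (by positivity) ?_
  refine mul_le_mul_of_nonneg_left (max_le (by linarith) ?_) hC.le
  rw [gramSq_eq]
  have h1 := matNorm_gramMatrix_inv_le (visitVec G a X (w i) i (a t)) t (restrictPa G i (X t))
  have h2 := l2norm_restrictPa_le G i (X t)
  linarith

theorem weight_mul_matNorm_le (h : FollowsAlgorithm G ν m C δ T a X w) (hC : 0 < C)
    (ht : t ∈ Finset.Icc 1 T) (i : Fin (n + 1)) :
    w i t * matNorm (gramSq G a X w i (a t) t)⁻¹ (restrictPa G i (X t)) ≤ 1 / C := by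
  set r := matNorm (gramSq G a X w i (a t) t)⁻¹ (restrictPa G i (X t)) with hr
  have h0 : (0 : ℝ) < max 1 r := lt_max_of_lt_left one_pos
  rw [h.weight_eq t ht i, ← hr, one_div_mul_eq_div, div_le_div_iff₀ (by positivity) hC]
  nlinarith [le_max_right 1 r]

/-- The weight of a round in closed form, in terms of the Gram matrix of the rounds before. -/
theorem weight_formula (h : FollowsAlgorithm G ν m C δ T a X w) (hC : 0 < C)
    (ht : t ∈ Finset.Icc 1 T) (i : Fin (n + 1)) {ρ : ℝ}
    (hρ : ρ = restrictPa G i (X t) ⬝ᵥ (gramSq G a X w i (a t) (t - 1))⁻¹ *ᵥ restrictPa G i (X t)) :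
    w i t = open Classical in
      if ρ * (1 - 1 / C ^ 2) ≤ 1 then 1 / C else 1 / √(ρ * (C ^ 2 - 1)) := by
  set r := matNorm (gramSq G a X w i (a t) t)⁻¹ (restrictPa G i (X t)) with hr
  have hw : w i t = 1 / (C * max 1 r) := h.weight_eq t ht i
  have hpos : (gramSq G a X w i (a t) (t - 1)).PosDef := by
    rw [gramSq_eq]; exact posDef_gramMatrix _ _
  have hρ0 : 0 ≤ ρ := hρ ▸ quadForm_nonneg hpos.inv.posSemidef _
  have hr0 : 0 ≤ r := matNorm_nonneg _ _
  -- Sherman-Morrison for the contribution of round `t` turns the implicit equation into a scalar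
  -- one.
  have hr2 : r ^ 2 * (1 + w i t ^ 2 * ρ) = ρ := by
    rw [hr, matNorm_sq (by rw [gramSq_eq]; exact (posDef_gramMatrix _ _).inv.posSemidef),
      gramSq_succ_self i (Finset.mem_Icc.1 ht).1, inv_add_vecMulVec hpos]
    simp only [sub_mulVec, smul_mulVec, dotProduct_sub, dotProduct_smul, quadForm_vecMulVec,
      smul_eq_mul, mulVec_smul, smul_dotProduct, ← hρ]
    rw [dotProduct_comm _ (restrictPa G i (X t)), ← hρ]
    have : 1 + w i t * (w i t * ρ) ≠ 0 := by
      have : 0 ≤ w i t ^ 2 * ρ := by positivity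
      nlinarith
    field_simp
    ring
  rcases le_or_gt r 1 with h1 | h1
  · rw [max_eq_left h1, mul_one] at hw
    have h2 : r ^ 2 ≤ 1 := by nlinarith
    rw [if_pos, hw]
    rw [hw, _root_.one_div_pow] at hr2
    have h3 : 0 ≤ 1 + 1 / C ^ 2 * ρ := by positivity
    nlinarith
  · rw [max_eq_right h1.le] at hw
    have hr1 : 0 < r := by linarith
    -- For `r > 1` one has `w r = 1/C`, so the equation becomes `r² = ρ(1 - 1/C²)` and `ρ` alone
    -- decides the branch.
    have h2 : w i t ^ 2 * r ^ 2 = 1 / C ^ 2 := by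
      rw [hw]; field_simp
    have h3 : ρ * (1 - 1 / C ^ 2) = r ^ 2 := by
      have : r ^ 2 + (w i t ^ 2 * r ^ 2) * ρ = ρ := by linarith
      rw [h2] at this
      linarith
    have h4 : ρ * (C ^ 2 - 1) = (C * r) ^ 2 := by
      rw [mul_pow, ← h3]; field_simp
    rw [if_neg (by rw [h3]; nlinarith), h4, Real.sqrt_sq (by positivity), hw]

end FollowsAlgorithm

theorem measurable_restrictPa {Ω : Type*} {m' : MeasurableSpace Ω} {x : Ω → Fin (n + 1) → ℝ}
    {i : Fin (n + 1)} (hX : ∀ j ∈ G.pa i, Measurable fun ω => x ω j) (j : Fin (n + 1)) :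
    Measurable fun ω => restrictPa G i (x ω) j := by
  unfold restrictPa
  split_ifs with hj
  · exact hX j hj
  · exact measurable_const

end RobustLCB

/-! ### Measurability of a run and freshness of the noise. -/

namespace RobustLCBRun

open RobustLCB

variable {n : ℕ} {G : CausalGraph n} {M : CausalBandit G} {T : ℕ} {C m κ : ℝ} {Ω : Type*}
  {mΩ : MeasurableSpace Ω} {μ : Measure Ω} (R : RobustLCBRun M T C m κ μ)

/-- The actual weights in round `t` under the selected intervention. -/
def activeD (t : ℕ) (ω : Ω) : Matrix (Fin (n + 1)) (Fin (n + 1)) ℝ := R.D t ω (R.a t ω)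

theorem measurableSet_mem_a {t : ℕ} (ht : t ∈ Finset.Icc 1 T) (i : Fin (n + 1)) :
    MeasurableSet[R.ℱ (t - 1)] {ω | i ∈ R.a t ω} := by
  classical
  have : {ω | i ∈ R.a t ω} = ⋃ A ∈ Finset.univ.filter (fun A : Finset (Fin (n + 1)) => i ∈ A),
      {ω | R.a t ω = A} := by
    ext ω
    simp
  rw [this]
  exact Finset.measurableSet_biUnion _ fun A _ => R.action_predictable t ht A

theorem measurable_comp_a {t : ℕ} (ht : t ∈ Finset.Icc 1 T) {f : Ω → Finset (Fin (n + 1)) → ℝ}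
    (hf : ∀ A, Measurable[R.ℱ (t - 1)] fun ω => f ω A) :
    Measurable[R.ℱ (t - 1)] fun ω => f ω (R.a t ω) := by
  classical
  have : (fun ω => f ω (R.a t ω)) = fun ω => ∑ A, if R.a t ω = A then f ω A else 0 := by
    ext ω
    simp
  rw [this]
  exact Finset.measurable_sum _ fun A _ =>
    Measurable.ite (R.action_predictable t ht A) (hf A) measurable_const

theorem measurable_activeD {t : ℕ} (ht : t ∈ Finset.Icc 1 T) (j i : Fin (n + 1)) :
    Measurable[R.ℱ (t - 1)] fun ω => R.activeD t ω j i :=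
  R.measurable_comp_a ht fun A => R.model_predictable t ht A j i

theorem activeD_triangular {t : ℕ} (ht : t ∈ Finset.Icc 1 T) (ω : Ω) (j i : Fin (n + 1))
    (h : R.activeD t ω j i ≠ 0) : j < i :=
  R.model_triangular t ht ω (R.a t ω) j i h

/-- A state of a triangular model is measurable in the weights and in the noise of the nodes up to
its own. -/
theorem _root_.measurable_semSolution_apply {Ω' : Type*} {m' : MeasurableSpace Ω'}
    {D : Ω' → Matrix (Fin (n + 1)) (Fin (n + 1)) ℝ} {e : Ω' → Fin (n + 1) → ℝ}
    (hD : ∀ ω j i, D ω j i ≠ 0 → j < i) (hDm : ∀ j i, Measurable fun ω => D ω j i)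
    (k : Fin (n + 1)) (he : ∀ j ≤ k, Measurable fun ω => e ω j) :
    Measurable fun ω => semSolution (D ω) (e ω) k := by
  classical
  induction k using WellFoundedLT.induction with
  | ind k ih =>
    have : (fun ω => semSolution (D ω) (e ω) k) = fun ω =>
        (∑ j, if j < k then D ω j k * semSolution (D ω) (e ω) j else 0) + e ω k := by
      ext ω
      rw [semSolution_apply (hD ω)]
      congr 1
      refine Finset.sum_congr rfl fun j _ => ?_
      split_ifs with hj
      · rfl
      · have : D ω j k = 0 := by
          by_contra h0
          exact hj (hD ω j k h0)
        simp [column, this]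
    rw [this]
    refine (Finset.measurable_sum _ fun j _ => ?_).add (he k le_rfl)
    split_ifs with hj
    · exact (hDm j k).mul (ih j hj fun l hl => he l (hl.trans hj.le))
    · exact measurable_const

/-- `H` is any σ-algebra containing the past. The choice `ℱ t` gives adaptedness; the choice `pastOf
t i` shows that the parents of `i` do not involve its noise. -/
theorem measurable_X_of_le {t : ℕ} (ht : t ∈ Finset.Icc 1 T)
    (H : Set.Ici (R.ℱ (t - 1))) (k : Fin (n + 1))
    (he : ∀ j ≤ k, Measurable[H.1] fun ω => R.ε t ω j) : Measurable[H.1] fun ω => R.X t ω k := by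
  have : (fun ω => R.X t ω k) = fun ω => semSolution (R.activeD t ω) (R.ε t ω) k := by
    ext ω
    rw [R.data_eq t ht ω]
    rfl
  rw [this]
  exact measurable_semSolution_apply (m' := H.1) (R.activeD_triangular ht)
    (fun j i => (R.measurable_activeD ht j i).mono H.2 le_rfl) k he

theorem measurable_X {t : ℕ} (ht : t ∈ Finset.Icc 1 T) (k : Fin (n + 1)) :
    Measurable[R.ℱ t] fun ω => R.X t ω k :=
  R.measurable_X_of_le ht ⟨_, R.ℱ.mono (Nat.sub_le t 1)⟩ k fun j _ =>
    (measurable_pi_apply j).comp (R.noise_adapted t ht)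

theorem measurable_visitVec {t : ℕ} (ht : t ∈ Finset.Icc 1 T)
    (H : Set.Ici (R.ℱ (t - 1))) {i : Fin (n + 1)} {c : Ω → ℕ → ℝ}
    (hc : Measurable[H.1] fun ω => c ω t)
    (hX : ∀ j ∈ G.pa i, Measurable[H.1] fun ω => R.X t ω j)
    {A : Ω → Finset (Fin (n + 1))} (hA : MeasurableSet[H.1] {ω | i ∈ A ω}) (j : Fin (n + 1)) :
    Measurable[H.1] fun ω =>
      visitVec G (fun s => R.a s ω) (fun s => R.X s ω) (c ω) i (A ω) t j := by
  classical
  have : (fun ω => visitVec G (fun s => R.a s ω) (fun s => R.X s ω) (c ω) i (A ω) t j) =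
      fun ω => if (i ∈ R.a t ω ↔ i ∈ A ω) then c ω t * restrictPa G i (R.X t ω) j else 0 := by
    ext ω
    unfold visitVec
    split_ifs <;> rfl
  rw [this]
  have hs := H.2 _ (R.measurableSet_mem_a ht i)
  refine Measurable.ite ?_ (hc.mul (measurable_restrictPa (m' := H.1) hX j)) measurable_const
  have : {ω | i ∈ R.a t ω ↔ i ∈ A ω} = ({ω | i ∈ R.a t ω} ∩ {ω | i ∈ A ω}) ∪
      ({ω | i ∈ R.a t ω}ᶜ ∩ {ω | i ∈ A ω}ᶜ) := by
    ext ω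
    by_cases h1 : i ∈ R.a t ω <;> by_cases h2 : i ∈ A ω <;> simp [h1, h2]
  rw [this]
  exact (hs.inter hA).union (hs.compl.inter hA.compl)

/-- `weight_formula` expresses the weight through the current parents and earlier weights, which
opens the way to strong induction. -/
theorem measurable_w_of_le (hC : 0 < C) (i : Fin (n + 1)) (t : ℕ) (ht : t ∈ Finset.Icc 1 T)
    (H : Set.Ici (R.ℱ (t - 1)))
    (hX : ∀ j ∈ G.pa i, Measurable[H.1] fun ω => R.X t ω j) :
    Measurable[H.1] fun ω => R.w ω i t := by
  classical
  induction t using Nat.strong_induction_on with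
  | _ t ih =>
    obtain ⟨ht1, htT⟩ := Finset.mem_Icc.1 ht
    set ρ : Ω → ℝ := fun ω => restrictPa G i (R.X t ω) ⬝ᵥ
      (gramSq G (fun s => R.a s ω) (fun s => R.X s ω) (R.w ω) i (R.a t ω) (t - 1))⁻¹ *ᵥ
        restrictPa G i (R.X t ω) with hρ
    have hw : (fun ω => R.w ω i t) = fun ω =>
        if ρ ω * (1 - 1 / C ^ 2) ≤ 1 then 1 / C else 1 / √(ρ ω * (C ^ 2 - 1)) := by
      ext ω
      rw [(R.follows ω).weight_formula hC ht i (ρ := ρ ω) rfl]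
    have hρm : Measurable[H.1] ρ := by
      refine measurable_quadForm (mΩ := H.1) (measurable_matrix_inv (mΩ := H.1) fun j k => ?_)
        (measurable_restrictPa (m' := H.1) hX)
      simp only [gramSq_eq]
      refine measurable_gramMatrix (m := H.1)
        (z := fun s ω => visitVec G (fun s => R.a s ω) (fun s => R.X s ω) (R.w ω i) i (R.a t ω) s)
        (fun s hs => ?_) j k
      obtain ⟨hs1, hs2⟩ := Finset.mem_Icc.1 hs
      have hsT : s ∈ Finset.Icc 1 T := Finset.mem_Icc.2 ⟨hs1, by omega⟩
      have hle : R.ℱ s ≤ H.1 := (R.ℱ.mono hs2).trans H.2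
      have hle' : R.ℱ (s - 1) ≤ H.1 := (R.ℱ.mono (Nat.sub_le s 1)).trans hle
      have hXs : ∀ j ∈ G.pa i, Measurable[H.1] fun ω => R.X s ω j :=
        fun j _ => (R.measurable_X hsT j).mono hle le_rfl
      exact R.measurable_visitVec hsT ⟨H.1, hle'⟩ (ih s (by omega) hsT ⟨H.1, hle'⟩ hXs) hXs
        (H.2 _ (R.measurableSet_mem_a ht i))
    rw [hw]
    refine Measurable.ite (measurableSet_le (hρm.mul_const _) measurable_const) measurable_const ?_
    exact measurable_const.div (hρm.mul_const _).sqrt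

/-- The noise `η_i(t) = ε_i(t) - ν_i`. -/
noncomputable def centredNoise (t : ℕ) (i : Fin (n + 1)) (ω : Ω) : ℝ := R.ε t ω i - M.nu i

theorem measurable_noise {t : ℕ} (ht : t ∈ Finset.Icc 1 T) : Measurable (R.ε t) :=
  (R.noise_adapted t ht).mono (R.ℱ.le t) le_rfl

theorem measurable_centredNoise {t : ℕ} (ht : t ∈ Finset.Icc 1 T) (i : Fin (n + 1)) :
    Measurable[R.ℱ t] (R.centredNoise t i) :=
  ((measurable_pi_apply i).comp (R.noise_adapted t ht)).sub_const _

theorem hasSubgaussianMGF_centredNoise {t : ℕ} (ht : t ∈ Finset.Icc 1 T) (i : Fin (n + 1)) :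
    HasSubgaussianMGF (R.centredNoise t i) 1 μ := by
  have h := M.subgaussian_noise i
  rw [← R.noise_law t ht] at h
  have h2 := HasSubgaussianMGF.of_map (R.measurable_noise ht).aemeasurable h
  rw [R.noise_law t ht] at h2
  exact h2

/-- The information that determines the parents of node `i` in round `t`. -/
@[reducible] def pastOf (t : ℕ) (i : Fin (n + 1)) : MeasurableSpace Ω :=
  R.ℱ (t - 1) ⊔ MeasurableSpace.comap (fun ω (j : Finset.Iio i) => R.ε t ω j) inferInstance

theorem pastOf_le {t : ℕ} (ht : t ∈ Finset.Icc 1 T) (i : Fin (n + 1)) : R.pastOf t i ≤ mΩ := by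
  refine sup_le (R.ℱ.le _) (Measurable.comap_le ?_)
  exact measurable_pi_lambda _ fun j => (measurable_pi_apply _).comp (R.measurable_noise ht)

theorem measurable_noise_pastOf (t : ℕ) {i j : Fin (n + 1)} (hj : j < i) :
    Measurable[R.pastOf t i] fun ω => R.ε t ω j := by
  refine Measurable.mono ?_ (le_sup_right : _ ≤ R.pastOf t i) le_rfl
  exact (measurable_pi_apply (⟨j, Finset.mem_Iio.2 hj⟩ : Finset.Iio i)).comp
    (comap_measurable (fun ω (j : Finset.Iio i) => R.ε t ω j))

theorem measurable_X_pastOf {t : ℕ} (ht : t ∈ Finset.Icc 1 T) {i j : Fin (n + 1)}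
    (hj : j ∈ G.pa i) : Measurable[R.pastOf t i] fun ω => R.X t ω j :=
  R.measurable_X_of_le ht ⟨R.pastOf t i, Set.mem_Ici.2 le_sup_left⟩ j fun _ hk =>
    R.measurable_noise_pastOf t (hk.trans_lt (G.lt_of_mem_pa i j hj))

theorem indep_pastOf_centredNoise [IsProbabilityMeasure μ] {t : ℕ} (ht : t ∈ Finset.Icc 1 T)
    (i : Fin (n + 1)) :
    Indep (R.pastOf t i) (MeasurableSpace.comap (R.centredNoise t i) inferInstance) μ := by
  have hε := R.measurable_noise ht
  set f : (Fin (n + 1) → ℝ) → (Finset.Iio i → ℝ) := fun e j => e j with hf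
  set g : (Fin (n + 1) → ℝ) → ℝ := fun e => e i - M.nu i with hg
  have hfm : Measurable f := measurable_pi_lambda _ fun j => measurable_pi_apply _
  have hgm : Measurable g := (measurable_pi_apply i).sub_const _
  have hfg : IndepFun f g M.noise := by
    have := M.isProbabilityMeasure_noise
    have h := M.iIndepFun_noise.indepFun_finset (Finset.Iio i) {i} (by simp)
      (fun j => measurable_pi_apply j)
    exact h.comp (φ := id) (ψ := fun v : (({i} : Finset (Fin (n + 1))) → ℝ) =>
      v ⟨i, Finset.mem_singleton_self i⟩ - M.nu i) measurable_id
      ((measurable_pi_apply _).sub_const _)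
  have hfg' : IndepFun (f ∘ R.ε t) (g ∘ R.ε t) μ := by
    rw [indepFun_iff_measure_inter_preimage_eq_mul] at hfg ⊢
    intro s u hs hu
    have h := hfg s u hs hu
    rw [← R.noise_law t ht, Measure.map_apply hε ((hfm hs).inter (hgm hu)),
      Measure.map_apply hε (hfm hs), Measure.map_apply hε (hgm hu)] at h
    exact h
  refine indep_sup_of_indep (R.ℱ.le _) (hfm.comp hε).comap_le (hgm.comp hε).comap_le ?_
    ((IndepFun_iff_Indep _ _ _).1 hfg')
  refine indep_of_indep_of_le_left (R.noise_indep t ht) (sup_le ?_ ?_)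
  · exact (hfm.comp (comap_measurable (R.ε t))).comap_le
  · exact (hgm.comp (comap_measurable (R.ε t))).comap_le

/-- Rounds `s < t` are part of the past. The round `s = t` needs the noise of the nodes before `i`,
which is why `pastOf` enlarges the filtration. -/
theorem measurable_visitVec_w (hC : 0 < C) {s t : ℕ} (ht : t ∈ Finset.Icc 1 T)
    (hs : s ∈ Finset.Icc 1 t) (i : Fin (n + 1)) (A : Finset (Fin (n + 1))) (j : Fin (n + 1)) :
    Measurable[R.pastOf t i] fun ω =>
      visitVec G (fun s => R.a s ω) (fun s => R.X s ω) (R.w ω i) i A s j := by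
  obtain ⟨hs1, hst⟩ := Finset.mem_Icc.1 hs
  have hsT : s ∈ Finset.Icc 1 T := Finset.mem_Icc.2 ⟨hs1, hst.trans (Finset.mem_Icc.1 ht).2⟩
  have hm : R.ℱ (s - 1) ≤ R.pastOf t i :=
    (R.ℱ.mono (by omega)).trans (le_sup_left : R.ℱ (t - 1) ≤ R.pastOf t i)
  have hX : ∀ j ∈ G.pa i, Measurable[R.pastOf t i] fun ω => R.X s ω j := by
    intro j hj
    rcases hst.eq_or_lt with rfl | hlt
    · exact R.measurable_X_pastOf ht hj
    · exact (R.measurable_X hsT j).mono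
        ((R.ℱ.mono (by omega)).trans (le_sup_left : R.ℱ (t - 1) ≤ R.pastOf t i)) le_rfl
  exact R.measurable_visitVec hsT ⟨_, hm⟩ (R.measurable_w_of_le hC i s hsT ⟨_, hm⟩ hX) hX
    (MeasurableSet.const _) j

/-- The mixture value of node `i` under the treatment `A`, based on the first `t` rounds. -/
noncomputable def mixture (i : Fin (n + 1)) (A : Finset (Fin (n + 1))) (t : ℕ) (ω : Ω) : ℝ :=
  mixtureValue
    (gramMatrix (visitVec G (fun s => R.a s ω) (fun s => R.X s ω) (R.w ω i) i A) t)
    (∑ s ∈ Finset.Icc 1 t, R.centredNoise s i ω •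
      visitVec G (fun s => R.a s ω) (fun s => R.X s ω) (R.w ω i) i A s)

variable [IsProbabilityMeasure μ]

theorem lintegral_mixture_le_one (hC : 0 < C) (i : Fin (n + 1)) (A : Finset (Fin (n + 1))) {t : ℕ}
    (ht : t ≤ T) : ∫⁻ ω, ENNReal.ofReal (R.mixture i A t ω) ∂μ ≤ 1 :=
  lintegral_mixtureValue_le_one T (fun t => R.pastOf t i)
    (fun s ω => visitVec G (fun s => R.a s ω) (fun s => R.X s ω) (R.w ω i) i A s)
    (fun s => R.centredNoise s i)
    (fun _ ht => R.pastOf_le ht i)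
    (fun _ ht _ hs j => R.measurable_visitVec_w hC ht hs i A j)
    (fun t ht s hs => by
      obtain ⟨hs1, hs2⟩ := Finset.mem_Ico.1 hs
      exact (R.measurable_centredNoise (Finset.mem_Icc.2
        ⟨hs1, hs2.le.trans (Finset.mem_Icc.1 ht).2⟩) i).mono
        ((R.ℱ.mono (by omega)).trans (le_sup_left : R.ℱ (t - 1) ≤ R.pastOf t i)) le_rfl)
    (fun t ht => (R.measurable_centredNoise ht i).mono (R.ℱ.le t) le_rfl)
    (fun _ ht => R.indep_pastOf_centredNoise ht i)
    (fun _ ht => R.hasSubgaussianMGF_centredNoise ht i) t ht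

end RobustLCBRun

/-! ### From the mixture to the confidence radius; mean states and rewards. -/

theorem measurable_mixtureValue {Ω ι : Type*} [Fintype ι] [DecidableEq ι]
    {mΩ : MeasurableSpace Ω} {V : Ω → Matrix ι ι ℝ} {S : Ω → ι → ℝ}
    (hV : ∀ i j, Measurable fun ω => V ω i j) (hS : ∀ i, Measurable fun ω => S ω i) :
    Measurable fun ω => mixtureValue (V ω) (S ω) := by
  unfold mixtureValue
  have h1 := measurable_quadForm (measurable_matrix_inv hV) hS
  have h2 := measurable_matrix_det hV
  fun_prop

/-- Taking logarithms; with `K = 1/δ` and the determinant bound this is the square root in the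
confidence radius. -/
theorem matNorm_le_of_mixtureValue_lt {ι : Type*} [Fintype ι] [DecidableEq ι]
    {V : Matrix ι ι ℝ} (hV : V.PosDef) {S : ι → ℝ} {K D : ℝ} (hK : 0 < K)
    (h : mixtureValue V S < K) (hD : V.det ≤ D) :
    matNorm V⁻¹ S ≤ √(2 * Real.log K + Real.log D) := by
  have hdet := hV.det_pos
  have hs : 0 < √V.det := Real.sqrt_pos.2 hdet
  refine Real.sqrt_le_sqrt ?_
  unfold mixtureValue at h
  rw [div_lt_iff₀ hs] at h
  have h1 := Real.log_lt_log (Real.exp_pos _) h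
  rw [Real.log_exp, Real.log_mul hK.ne' hs.ne', Real.log_sqrt hdet.le] at h1
  have h2 := Real.log_le_log hdet hD
  linarith

namespace CausalBandit

variable {n : ℕ} {G : CausalGraph n} (M : CausalBandit G)

theorem integrable_coord (i : Fin (n + 1)) :
    Integrable (fun e : Fin (n + 1) → ℝ => e i) M.noise := by
  have := M.isProbabilityMeasure_noise
  have h := (M.subgaussian_noise i).integrable.add (integrable_const (M.nu i))
  refine h.congr (ae_of_all _ fun e => ?_)
  simp [nu]

theorem integral_mulVec (A : Matrix (Fin (n + 1)) (Fin (n + 1)) ℝ) (k : Fin (n + 1)) :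
    ∫ e, (A *ᵥ e) k ∂M.noise = (A *ᵥ M.nu) k := by
  simp only [mulVec, dotProduct]
  rw [integral_finsetSum _ fun i _ => (M.integrable_coord i).const_mul _]
  simp only [integral_const_mul]
  rfl

theorem integral_semSolution (D : Matrix (Fin (n + 1)) (Fin (n + 1)) ℝ) (k : Fin (n + 1)) :
    ∫ e, semSolution D e k ∂M.noise = semSolution D M.nu k :=
  M.integral_mulVec _ k

theorem integrable_semSolution (D : Matrix (Fin (n + 1)) (Fin (n + 1)) ℝ) (k : Fin (n + 1)) :
    Integrable (fun e => semSolution D e k) M.noise := by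
  simp only [semSolution, mulVec, dotProduct]
  exact integrable_finsetSum _ fun i _ => (M.integrable_coord i).const_mul _

/-- The state `u` at the mean noise is the mean state, so `‖u‖²` is the mean of `⟨u, X⟩`, at most
`‖u‖ m`. -/
theorem l2norm_semSolution_nu_le {D : Matrix (Fin (n + 1)) (Fin (n + 1)) ℝ} {m : ℝ}
    (h : ∀ᵐ e ∂M.noise, l2norm (semSolution D e) ≤ m) : l2norm (semSolution D M.nu) ≤ m := by
  have := M.isProbabilityMeasure_noise
  set u := semSolution D M.nu with hu
  have hint : ∀ k, Integrable (fun e => u k * semSolution D e k) M.noise :=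
    fun k => (M.integrable_semSolution D k).const_mul _
  have h1 : u ⬝ᵥ u = ∫ e, u ⬝ᵥ semSolution D e ∂M.noise := by
    simp only [dotProduct]
    rw [integral_finsetSum _ fun k _ => hint k]
    refine Finset.sum_congr rfl fun k _ => ?_
    rw [integral_const_mul, M.integral_semSolution]
  have h2 : ∫ e, u ⬝ᵥ semSolution D e ∂M.noise ≤ ∫ _, l2norm u * m ∂M.noise := by
    refine integral_mono_ae ?_ (integrable_const _) ?_
    · simp only [dotProduct]
      exact integrable_finsetSum _ fun k _ => hint k
    · filter_upwards [h] with e he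
      exact ((le_abs_self _).trans (abs_dotProduct_le _ _)).trans
        (mul_le_mul_of_nonneg_left he (l2norm_nonneg _))
  rw [← h1, ← l2norm_sq] at h2
  simp only [integral_const, probReal_univ, one_smul] at h2
  rcases (l2norm_nonneg u).eq_or_lt with h0 | h0
  · obtain ⟨e, he⟩ := h.exists
    rw [← h0]
    exact (l2norm_nonneg _).trans he
  · nlinarith

theorem meanReward_eq (A : Finset (Fin (n + 1))) :
    M.meanReward A = semSolution (M.weights A) M.nu (Fin.last n) :=
  M.integral_semSolution _ _

end CausalBandit

namespace RobustLCB

variable {n : ℕ} {G : CausalGraph n} {a : ℕ → Finset (Fin (n + 1))} {X : ℕ → Fin (n + 1) → ℝ}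
  {w : Fin (n + 1) → ℕ → ℝ} {ν : Fin (n + 1) → ℝ} {m C δ : ℝ} {T t : ℕ}

theorem supports_of_mem_confSet {A : Finset (Fin (n + 1))}
    {Θ : Matrix (Fin (n + 1)) (Fin (n + 1)) ℝ}
    (h : ∀ i, column Θ i ∈ confSet G ν m C δ a X w i A t) : G.Supports Θ := by
  intro j i hji
  by_contra hj
  exact hji ((h i).1 j hj)

theorem bddAbove_rewardOf (hd : 1 ≤ G.maxInDegree) (A : Finset (Fin (n + 1))) :
    BddAbove (rewardOf G ν '' {Θ | ∀ i, column Θ i ∈ confSet G ν m C δ a X w i A t}) := by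
  refine ⟨∑ i, ((G.longestPath + 1) * (G.maxInDegree : ℝ) ^ ((G.longestPath : ℝ) - 1 / 2)) * |ν i|,
    ?_⟩
  rintro _ ⟨Θ, hΘ, rfl⟩
  have hs := supports_of_mem_confSet hΘ
  rw [hs.rewardOf_eq, hs.semSolution_last]
  refine Finset.sum_le_sum fun i _ => ?_
  calc G.sensitivity Θ i * ν i ≤ |G.sensitivity Θ i * ν i| := le_abs_self _
    _ = |G.sensitivity Θ i| * |ν i| := abs_mul _ _
    _ ≤ _ := mul_le_mul_of_nonneg_right (hs.abs_sensitivity_le (fun i => (hΘ i).2.1) hd i)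
        (abs_nonneg _)

theorem confRadius_mono (hm : 0 < m) (hC : 0 < C) (hd : 1 ≤ G.maxInDegree) (h : t ≤ T) :
    confRadius G m C δ t ≤ confRadius G m C δ T := by
  have hd' : (0 : ℝ) < G.maxInDegree := by exact_mod_cast hd
  unfold confRadius
  have h1 : Real.log (1 + m ^ 2 * t / (G.maxInDegree * C ^ 2)) ≤
      Real.log (1 + m ^ 2 * T / (G.maxInDegree * C ^ 2)) := by
    refine Real.log_le_log (by positivity) ?_
    gcongr
  gcongr

theorem confRadius_nonneg (hm : 0 < m) (t : ℕ) : 0 ≤ confRadius G m C δ t := by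
  unfold confRadius
  positivity

end RobustLCB

/-! ### The good event and the regret of one round. -/

namespace RobustLCBRun

open RobustLCB

variable {n : ℕ} {G : CausalGraph n} {M : CausalBandit G} {T : ℕ} {C m κ : ℝ} {Ω : Type*}
  {mΩ : MeasurableSpace Ω} {μ : Measure Ω} (R : RobustLCBRun M T C m κ μ)

theorem mixture_congr {i : Fin (n + 1)} {A A' : Finset (Fin (n + 1))} (h : i ∈ A' ↔ i ∈ A)
    (t : ℕ) (ω : Ω) : R.mixture i A' t ω = R.mixture i A t ω := by
  simp only [mixture, visitVec_congr h]

theorem measurable_mixture (hC : 0 < C) (i : Fin (n + 1)) (A : Finset (Fin (n + 1))) {t : ℕ}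
    (ht : t ≤ T) : Measurable (R.mixture i A t) := by
  have hz : ∀ s ∈ Finset.Icc 1 t, ∀ j, Measurable fun ω =>
      visitVec G (fun s => R.a s ω) (fun s => R.X s ω) (R.w ω i) i A s j := by
    intro s hs j
    obtain ⟨hs1, hs2⟩ := Finset.mem_Icc.1 hs
    have hsT : s ∈ Finset.Icc 1 T := Finset.mem_Icc.2 ⟨hs1, hs2.trans ht⟩
    exact (R.measurable_visitVec_w hC hsT (Finset.mem_Icc.2 ⟨hs1, le_rfl⟩) i A j).mono
      (R.pastOf_le hsT i) le_rfl
  refine measurable_mixtureValue (measurable_gramMatrix hz) fun j => ?_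
  simp only [Finset.sum_apply, Pi.smul_apply, smul_eq_mul]
  refine Finset.measurable_sum _ fun s hs => Measurable.mul ?_ (hz s hs j)
  obtain ⟨hs1, hs2⟩ := Finset.mem_Icc.1 hs
  exact (R.measurable_centredNoise (Finset.mem_Icc.2 ⟨hs1, hs2.trans ht⟩) i).mono
    (R.ℱ.le s) le_rfl

/-- The event that the noise is under control in the confidence sets of round `t`. -/
def goodEvent (t : ℕ) : Set Ω :=
  {ω | ∀ i A, R.mixture i A (t - 1) ω < 2 * ((n : ℝ) + 1) * T}

theorem measurableSet_goodEvent (hC : 0 < C) {t : ℕ} (ht : t ∈ Finset.Icc 1 T) :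
    MeasurableSet (R.goodEvent t) := by
  have h := (Finset.mem_Icc.1 ht).2
  have : R.goodEvent t = ⋂ i, ⋂ A, {ω | R.mixture i A (t - 1) ω < 2 * ((n : ℝ) + 1) * T} := by
    ext ω
    simp [goodEvent]
  rw [this]
  exact MeasurableSet.iInter fun i => MeasurableSet.iInter fun A =>
    measurableSet_lt (R.measurable_mixture hC i A (by omega)) measurable_const

/-- Markov's inequality at the fixed time `t - 1` with threshold `1/δ = 2NT`, over `2N` events. -/
theorem measureReal_compl_goodEvent_le [IsProbabilityMeasure μ] (hC : 0 < C) {t : ℕ}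
    (ht : t ∈ Finset.Icc 1 T) : μ.real (R.goodEvent t)ᶜ ≤ 1 / T := by
  classical
  obtain ⟨ht1, htT⟩ := Finset.mem_Icc.1 ht
  have hT : (0 : ℝ) < T := by exact_mod_cast (by omega : 0 < T)
  set K : ℝ := 2 * ((n : ℝ) + 1) * T with hK
  have hK0 : 0 < K := by positivity
  -- The mixture depends on `A` only through `i ∈ A`, so two interventions represent them all.
  have hsub : (R.goodEvent t)ᶜ ⊆ ⋃ i ∈ (Finset.univ : Finset (Fin (n + 1))),
      ⋃ A ∈ ({Finset.univ, ∅} : Finset (Finset (Fin (n + 1)))),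
        {ω | K ≤ R.mixture i A (t - 1) ω} := by
    intro ω hω
    simp only [goodEvent, Set.mem_compl_iff, Set.mem_ofPred_eq, not_forall, not_lt] at hω
    obtain ⟨i, A, hA⟩ := hω
    simp only [Set.mem_iUnion]
    by_cases hi : i ∈ A
    · refine ⟨i, Finset.mem_univ i, Finset.univ, by simp, ?_⟩
      rw [R.mixture_congr (A := Finset.univ) (by simp [hi])] at hA
      exact hA
    · refine ⟨i, Finset.mem_univ i, ∅, by simp, ?_⟩
      rw [R.mixture_congr (A := ∅) (by simp [hi])] at hA
      exact hA
  have hone : ∀ i A, μ.real {ω | K ≤ R.mixture i A (t - 1) ω} ≤ 1 / K := by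
    intro i A
    have h1 := mul_meas_ge_le_lintegral
      (ENNReal.measurable_ofReal.comp (R.measurable_mixture hC i A (t := t - 1) (by omega)))
      (ENNReal.ofReal K) (μ := μ)
    have h2 := h1.trans (R.lintegral_mixture_le_one hC i A (t := t - 1) (by omega))
    have h3 : {ω | K ≤ R.mixture i A (t - 1) ω} ⊆
        {ω | ENNReal.ofReal K ≤ (ENNReal.ofReal ∘ R.mixture i A (t - 1)) ω} :=
      fun ω hω => ENNReal.ofReal_le_ofReal hω
    have h4 : ENNReal.ofReal K * μ {ω | K ≤ R.mixture i A (t - 1) ω} ≤ 1 :=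
      (mul_le_mul_right (measure_mono h3) _).trans h2
    have h5 := ENNReal.toReal_mono ENNReal.one_ne_top h4
    rw [ENNReal.toReal_mul, ENNReal.toReal_ofReal hK0.le, ENNReal.toReal_one] at h5
    rw [le_div_iff₀ hK0, mul_comm]
    exact h5
  calc μ.real (R.goodEvent t)ᶜ
      ≤ μ.real (⋃ i ∈ (Finset.univ : Finset (Fin (n + 1))),
          ⋃ A ∈ ({Finset.univ, ∅} : Finset (Finset (Fin (n + 1)))),
            {ω | K ≤ R.mixture i A (t - 1) ω}) := measureReal_mono hsub (measure_ne_top _ _)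
    _ ≤ ∑ i : Fin (n + 1), μ.real (⋃ A ∈ ({Finset.univ, ∅} : Finset (Finset (Fin (n + 1)))),
            {ω | K ≤ R.mixture i A (t - 1) ω}) := measureReal_biUnion_finset_le _ _
    _ ≤ ∑ i : Fin (n + 1), ∑ A ∈ ({Finset.univ, ∅} : Finset (Finset (Fin (n + 1)))),
            μ.real {ω | K ≤ R.mixture i A (t - 1) ω} :=
        Finset.sum_le_sum fun i _ => measureReal_biUnion_finset_le _ _
    _ ≤ ∑ _i : Fin (n + 1), ∑ _A ∈ ({Finset.univ, ∅} : Finset (Finset (Fin (n + 1)))), 1 / K :=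
        Finset.sum_le_sum fun i _ => Finset.sum_le_sum fun A _ => hone i A
    _ ≤ ∑ _i : Fin (n + 1), 2 * (1 / K) := by
        refine Finset.sum_le_sum fun i _ => ?_
        rw [Finset.sum_const, nsmul_eq_mul]
        gcongr
        exact_mod_cast Finset.card_le_two
    _ = 1 / T := by
        rw [Finset.sum_const, Finset.card_univ, Fintype.card_fin, nsmul_eq_mul, hK]
        push_cast
        field_simp

/-- The almost sure bounds on the data and on the fluctuations of the model. -/
structure Regular (ω : Ω) : Prop where
  bounded : ∀ t ∈ Finset.Icc 1 T, l2norm (R.X t ω) ≤ m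
  budget : ∀ i, ∑ t ∈ Finset.Icc 1 T, l2norm (column (R.activeD t ω - M.weights (R.a t ω)) i) ≤ C

theorem ae_regular : ∀ᵐ ω ∂μ, R.Regular ω := by
  have h1 : ∀ᵐ ω ∂μ, ∀ t ∈ Finset.Icc 1 T, l2norm (R.X t ω) ≤ m :=
    (Filter.eventually_all_finset _).2 R.data_bounded
  filter_upwards [h1, R.budget] with ω hω1 hω2
  refine ⟨hω1, fun i => (Finset.sum_le_sum fun t _ => ?_).trans (hω2 i)⟩
  exact le_ciSup (f := fun A => l2norm (column (R.D t ω A - M.weights A) i))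
    (Set.finite_range _).bddAbove (R.a t ω)

variable {R}

/-- The data follow the nominal weights up to `⟨[D - B_a]_i, X⟩` and the centred noise. The budget
bounds the sum of the former by `m C`; the good event bounds the self-normalised sum of the latter.
-/
theorem column_weights_mem_confSet (hC : 0 < C) (hm : 0 < m) (hd : 1 ≤ G.maxInDegree) {t : ℕ}
    (ht : t ∈ Finset.Icc 1 T) {ω : Ω} (hω : R.Regular ω) (hg : ω ∈ R.goodEvent t)
    (i : Fin (n + 1)) (A : Finset (Fin (n + 1))) :
    column (M.weights A) i ∈ confSet G M.nu m C (1 / (2 * ((n : ℝ) + 1) * T))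
      (fun s => R.a s ω) (fun s => R.X s ω) (R.w ω) i A t := by
  obtain ⟨ht1, htT⟩ := Finset.mem_Icc.1 ht
  have hT : (0 : ℝ) < T := by exact_mod_cast (by omega : 0 < T)
  have hd' : (0 : ℝ) < G.maxInDegree := by exact_mod_cast hd
  have hsup := M.supports_weights A
  have hmem : ∀ s ∈ rounds (fun s => R.a s ω) i A (t - 1),
      s ∈ Finset.Icc 1 T ∧ (i ∈ R.a s ω ↔ i ∈ A) := by
    intro s hs
    obtain ⟨h1, h2⟩ := mem_rounds.1 hs
    rw [Finset.mem_Icc] at h1 ⊢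
    exact ⟨⟨h1.1, by omega⟩, h2⟩
  have hcol : ∀ j, j ∉ G.pa i → column (M.weights A) i j = 0 := by
    intro j hj
    by_contra h0
    exact hj (hsup j i h0)
  refine ⟨hcol, M.l2norm_column_weights_le A i, ?_⟩
  rw [confRadius]
  refine matNorm_sub_estimate_le
    (c := fun s => column (R.activeD s ω - M.weights (R.a s ω)) i ⬝ᵥ R.X s ω)
    (η := fun s => R.centredNoise s i ω) hC (M.l2norm_column_weights_le A i)
    ?_ ?_ ?_ ?_ ?_
  · intro s hs
    obtain ⟨hsT, hsA⟩ := hmem s hs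
    have h1 : column (M.weights A) i = column (M.weights (R.a s ω)) i := by
      rw [M.column_weights, M.column_weights]
      simp only [hsA]
    have h2 := semSolution_apply (R.activeD_triangular hsT ω) (R.ε s ω) i
    have h3 : R.X s ω = semSolution (R.activeD s ω) (R.ε s ω) := R.data_eq s hsT ω
    rw [← h3] at h2
    rw [dotProduct_restrictPa G hcol, h1, column_sub, sub_dotProduct, centredNoise, h2]
    ring
  · exact fun s hs => ((R.follows ω).weight_pos hC (hmem s hs).1 i).le
  · exact fun s hs => (R.follows ω).weight_mul_matNorm_le hC (hmem s hs).1 i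
  · calc ∑ s ∈ rounds (fun s => R.a s ω) i A (t - 1),
          |column (R.activeD s ω - M.weights (R.a s ω)) i ⬝ᵥ R.X s ω|
        ≤ ∑ s ∈ rounds (fun s => R.a s ω) i A (t - 1),
          l2norm (column (R.activeD s ω - M.weights (R.a s ω)) i) * m := by
          refine Finset.sum_le_sum fun s hs => (abs_dotProduct_le _ _).trans ?_
          exact mul_le_mul_of_nonneg_left (hω.bounded s (hmem s hs).1) (l2norm_nonneg _)
      _ ≤ ∑ s ∈ Finset.Icc 1 T,
          l2norm (column (R.activeD s ω - M.weights (R.a s ω)) i) * m :=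
          Finset.sum_le_sum_of_subset_of_nonneg (fun s hs => (hmem s hs).1)
            fun s _ _ => mul_nonneg (l2norm_nonneg _) hm.le
      _ ≤ m * C := by
          rw [← Finset.sum_mul, mul_comm]
          exact mul_le_mul_of_nonneg_left (hω.budget i) hm.le
  · have hdet : (gramSq G (fun s => R.a s ω) (fun s => R.X s ω) (R.w ω) i A (t - 1)).det ≤
        (1 + (m ^ 2 / C ^ 2) * t / G.maxInDegree) ^ G.maxInDegree := by
      rw [gramSq_eq]
      refine det_gramMatrix_le _ (t - 1) t _ (G.pa i) _ (by omega) hd (G.card_pa_le i)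
        (fun s _ j hj => visitVec_of_notMem hj) (fun s hs => ?_) (by positivity)
      obtain ⟨hs1, hs2⟩ := Finset.mem_Icc.1 hs
      have hsT : s ∈ Finset.Icc 1 T := Finset.mem_Icc.2 ⟨hs1, by omega⟩
      refine (l2norm_visitVec_sq_le (G := G) (a := fun s => R.a s ω) (X := fun s => R.X s ω)
        (i := i) (A := A) (c := R.w ω i) (ρ := 1 / C ^ 2) (hω.bounded s hsT) ?_).trans_eq
        (by rw [one_div_mul_eq_div])
      have h1 := (R.follows ω).weight_pos hC hsT i
      have h2 := (R.follows ω).weight_le hC hsT i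
      calc R.w ω i s ^ 2 ≤ (1 / C) ^ 2 := by gcongr
        _ = 1 / C ^ 2 := by rw [_root_.one_div_pow]
    have hD : 1 + (m ^ 2 / C ^ 2) * t / G.maxInDegree =
        1 + m ^ 2 * t / (G.maxInDegree * C ^ 2) := by
      rw [div_mul_eq_mul_div, div_div, mul_comm (C ^ 2)]
    rw [hD] at hdet
    have hg' := hg i A
    rw [mixture, ← gramSq_eq] at hg'
    have h := matNorm_le_of_mixtureValue_lt (by rw [gramSq_eq]; exact posDef_gramMatrix _ _)
      (by positivity) hg' hdet
    rw [Real.log_pow] at h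
    rwa [one_div_one_div]

variable (R)

/-- The potential of node `i` under the treatment `A` after `t` rounds. -/
noncomputable def phi (i : Fin (n + 1)) (A : Finset (Fin (n + 1))) (t : ℕ) (ω : Ω) : ℝ :=
  potential G i (gramMatrix
    (visitVec G (fun s => R.a s ω) (fun s => R.X s ω) (fun _ => 1 / (1 + m)) i A) t)

theorem phi_nonneg (i : Fin (n + 1)) (A : Finset (Fin (n + 1))) (t : ℕ) (ω : Ω) :
    0 ≤ R.phi i A t ω :=
  Finset.sum_nonneg fun _ _ => (posDef_gramMatrix _ _).inv.posSemidef.diag_nonneg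

variable {R}

/-- The gap is expanded around `Θ`, and `Θ - D` is split at the nominal weights into an ellipsoid
width and the fluctuation of the round. -/
theorem rewardOf_sub_le (hC : 0 < C) (hm : 0 < m) (hd : 1 ≤ G.maxInDegree) {t : ℕ}
    (ht : t ∈ Finset.Icc 1 T) {ω : Ω} (hω : R.Regular ω) (hg : ω ∈ R.goodEvent t)
    (hx : l2norm (semSolution (R.activeD t ω) M.nu) ≤ m) {β : ℝ}
    (hβ : confRadius G m C (1 / (2 * ((n : ℝ) + 1) * T)) t ≤ β)
    {Θ : Matrix (Fin (n + 1)) (Fin (n + 1)) ℝ}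
    (hΘ : ∀ i, column Θ i ∈ confSet G M.nu m C (1 / (2 * ((n : ℝ) + 1) * T))
      (fun s => R.a s ω) (fun s => R.X s ω) (R.w ω) i (R.a t ω) t) :
    rewardOf G M.nu Θ - semSolution (R.activeD t ω) M.nu (Fin.last n) ≤
      ∑ i ∈ insert (Fin.last n) G.parents,
        ((G.longestPath + 1) * (G.maxInDegree : ℝ) ^ ((G.longestPath : ℝ) - 1 / 2)) *
        (m * (l2norm (column (R.activeD t ω - M.weights (R.a t ω)) i) +
          (4 * R.phi i (R.a t ω) (t - 1) ω + 4 * β * C * R.phi i (R.a t ω) (t - 1) ω +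
            3 * β * √(R.phi i (R.a t ω) (t - 1) ω)))) := by
  obtain ⟨ht1, htT⟩ := Finset.mem_Icc.1 ht
  have hs := supports_of_mem_confSet hΘ
  have hn : ∀ i, l2norm (column Θ i) ≤ 1 := fun i => (hΘ i).2.1
  rw [hs.rewardOf_eq, hs.semSolution_last_sub (R.activeD_triangular ht ω),
    ← Finset.sum_subset (Finset.subset_univ (insert (Fin.last n) G.parents))
      (fun i _ hi => by rw [hs.sensitivity_eq_zero hi, zero_mul])]
  refine Finset.sum_le_sum fun i _ => ?_
  have hB := column_weights_mem_confSet hC hm hd ht hω hg i (R.a t ω)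
  have hmem : ∀ s ∈ rounds (fun s => R.a s ω) i (R.a t ω) (t - 1), s ∈ Finset.Icc 1 T := by
    intro s hs
    have h1 := (mem_rounds.1 hs).1
    rw [Finset.mem_Icc] at h1 ⊢
    exact ⟨h1.1, by omega⟩
  have hΔ : l2norm (column Θ i - column (M.weights (R.a t ω)) i) ≤
      4 * R.phi i (R.a t ω) (t - 1) ω + 4 * β * C * R.phi i (R.a t ω) (t - 1) ω +
        3 * β * √(R.phi i (R.a t ω) (t - 1) ω) :=
    l2norm_sub_le_potential hC hm.le ((confRadius_nonneg hm t).trans hβ) (hΘ i).1 hB.1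
      (hΘ i).2.1 hB.2.1
      (fun s hs => (R.follows ω).weight_le hC (hmem s hs) i)
      (fun s hs => (R.follows ω).le_weight hC (hmem s hs) i (hω.bounded s (hmem s hs)))
      ((hΘ i).2.2.trans hβ) (hB.2.2.trans hβ) rfl
  set x := semSolution (R.activeD t ω) M.nu with hxdef
  have hcol : l2norm (column (Θ - R.activeD t ω) i) ≤
      l2norm (column (R.activeD t ω - M.weights (R.a t ω)) i) +
        (4 * R.phi i (R.a t ω) (t - 1) ω + 4 * β * C * R.phi i (R.a t ω) (t - 1) ω +
          3 * β * √(R.phi i (R.a t ω) (t - 1) ω)) := by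
    have h1 : column (Θ - R.activeD t ω) i = (column Θ i - column (M.weights (R.a t ω)) i) -
        column (R.activeD t ω - M.weights (R.a t ω)) i := by
      rw [column_sub, column_sub]; abel
    rw [h1]
    have := l2norm_sub_le (column Θ i - column (M.weights (R.a t ω)) i)
      (column (R.activeD t ω - M.weights (R.a t ω)) i)
    linarith
  calc G.sensitivity Θ i * (column (Θ - R.activeD t ω) i ⬝ᵥ x)
      ≤ |G.sensitivity Θ i * (column (Θ - R.activeD t ω) i ⬝ᵥ x)| := le_abs_self _
    _ = |G.sensitivity Θ i| * |column (Θ - R.activeD t ω) i ⬝ᵥ x| := abs_mul _ _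
    _ ≤ |G.sensitivity Θ i| * (m * l2norm (column (Θ - R.activeD t ω) i)) := by
        refine mul_le_mul_of_nonneg_left ((abs_dotProduct_le _ _).trans ?_) (abs_nonneg _)
        rw [mul_comm]
        exact mul_le_mul_of_nonneg_right hx (l2norm_nonneg _)
    _ ≤ _ := by
        have h1 := hs.abs_sensitivity_le hn hd i
        have h2 := l2norm_nonneg (column (Θ - R.activeD t ω) i)
        exact mul_le_mul h1 (mul_le_mul_of_nonneg_left hcol hm.le) (by positivity)
          ((abs_nonneg _).trans h1)

/-- The regret of a round in which the confidence sets are valid. -/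
theorem iSup_meanReward_sub_le (hC : 0 < C) (hm : 0 < m) (hd : 1 ≤ G.maxInDegree) {t : ℕ}
    (ht : t ∈ Finset.Icc 1 T) {ω : Ω} (hω : R.Regular ω) (hg : ω ∈ R.goodEvent t)
    (hx : l2norm (semSolution (R.activeD t ω) M.nu) ≤ m) {β : ℝ}
    (hβ : confRadius G m C (1 / (2 * ((n : ℝ) + 1) * T)) t ≤ β) :
    (⨆ A, M.meanReward A) - semSolution (R.activeD t ω) M.nu (Fin.last n) ≤
      ∑ i ∈ insert (Fin.last n) G.parents,
        ((G.longestPath + 1) * (G.maxInDegree : ℝ) ^ ((G.longestPath : ℝ) - 1 / 2)) *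
        (m * (l2norm (column (R.activeD t ω - M.weights (R.a t ω)) i) +
          (4 * R.phi i (R.a t ω) (t - 1) ω + 4 * β * C * R.phi i (R.a t ω) (t - 1) ω +
            3 * β * √(R.phi i (R.a t ω) (t - 1) ω)))) := by
  rw [sub_le_iff_le_add]
  refine ciSup_le fun A => ?_
  have hmem := fun i A => column_weights_mem_confSet hC hm hd ht hω hg i A
  rw [M.meanReward_eq, ← (M.supports_weights A).rewardOf_eq]
  refine (le_csSup (bddAbove_rewardOf hd A) ⟨M.weights A, fun i => hmem i A, rfl⟩).trans ?_
  -- Optimism: the nominal weights are feasible for every action, so no confidence set is empty and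
  -- the maximality of the played action is available.
  refine ((R.follows ω).action_max t ht (fun i A => ⟨_, hmem i A⟩) A).trans ?_
  refine csSup_le ⟨_, M.weights (R.a t ω), fun i => hmem i _, rfl⟩ ?_
  rintro _ ⟨Θ, hΘ, rfl⟩
  rw [← sub_le_iff_le_add]
  exact rewardOf_sub_le hC hm hd ht hω hg hx hβ hΘ

end RobustLCBRun

/-- A nonintegrable function has Bochner integral `0`, so integrability is not needed. -/
theorem ofReal_integral_le_lintegral_ofReal {Ω : Type*} {mΩ : MeasurableSpace Ω} {μ : Measure Ω}
    {f : Ω → ℝ} (hf : 0 ≤ f) : ENNReal.ofReal (∫ ω, f ω ∂μ) ≤ ∫⁻ ω, ENNReal.ofReal (f ω) ∂μ := by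
  by_cases hi : Integrable f μ
  · exact (ofReal_integral_eq_lintegral_ofReal hi (ae_of_all _ hf)).le
  · rw [integral_undef hi]
    simp

theorem measurable_l2norm {Ω ι : Type*} [Fintype ι] {mΩ : MeasurableSpace Ω} {v : Ω → ι → ℝ}
    (hv : ∀ i, Measurable fun ω => v ω i) : Measurable fun ω => l2norm (v ω) := by
  simp only [l2norm_eq_sqrt]
  exact (measurable_dotProduct hv hv).sqrt

/-! ### Decrease of the potential along a path. -/

namespace RobustLCB

variable {n : ℕ} {G : CausalGraph n} {i : Fin (n + 1)}

/-- The relative decrease of the potential, up to constants, when the vector `z` is added. -/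
noncomputable def potentialGain (G : CausalGraph n) (i : Fin (n + 1))
    (U : Matrix (Fin (n + 1)) (Fin (n + 1)) ℝ) (z : Fin (n + 1) → ℝ) : ℝ :=
  (∑ j ∈ G.pa i, ((U⁻¹ *ᵥ z) j) ^ 2) / potential G i U

theorem potential_pos {U : Matrix (Fin (n + 1)) (Fin (n + 1)) ℝ} (hU : U.PosDef)
    (hi : (G.pa i).Nonempty) : 0 < potential G i U :=
  Finset.sum_pos (fun _ _ => hU.inv.diag_pos) hi

/-- By Sherman-Morrison the potential drops by the numerator of the gain divided by `1 + zᵀU⁻¹z ≤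
2`; then `log x ≤ x - 1`. -/
theorem potentialGain_le_log {U : Matrix (Fin (n + 1)) (Fin (n + 1)) ℝ} (hU : U.PosDef)
    {z : Fin (n + 1) → ℝ} (hz : z ⬝ᵥ U⁻¹ *ᵥ z ≤ 1) :
    potentialGain G i U z ≤
      2 * (Real.log (potential G i U) - Real.log (potential G i (U + vecMulVec z z))) := by
  rcases (G.pa i).eq_empty_or_nonempty with he | hne
  · simp [potentialGain, potential, he]
  have h0 := potential_pos hU hne
  have h1 := potential_pos (posDef_add_vecMulVec hU z) hne
  set g := ∑ j ∈ G.pa i, ((U⁻¹ *ᵥ z) j) ^ 2 with hg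
  have hg0 : 0 ≤ g := Finset.sum_nonneg fun _ _ => sq_nonneg _
  have hq := quadForm_nonneg hU.inv.posSemidef z
  have hstep : potential G i (U + vecMulVec z z) =
      potential G i U - (1 + z ⬝ᵥ U⁻¹ *ᵥ z)⁻¹ * g := by
    rw [potential, inv_add_vecMulVec hU, potential, hg, Finset.mul_sum, ← Finset.sum_sub_distrib]
    refine Finset.sum_congr rfl fun j _ => ?_
    simp only [Matrix.sub_apply, Matrix.smul_apply, vecMulVec_apply, smul_eq_mul]
    ring
  have hhalf : g / 2 ≤ (1 + z ⬝ᵥ U⁻¹ *ᵥ z)⁻¹ * g := by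
    have : (2 : ℝ)⁻¹ ≤ (1 + z ⬝ᵥ U⁻¹ *ᵥ z)⁻¹ := by
      rw [inv_le_inv₀ (by norm_num) (by linarith)]
      linarith
    nlinarith
  have hlog := Real.log_le_sub_one_of_pos (div_pos h1 h0)
  rw [Real.log_div h1.ne' h0.ne'] at hlog
  have h2 : potential G i (U + vecMulVec z z) / potential G i U ≤
      1 - g / potential G i U / 2 := by
    rw [div_le_iff₀ h0, hstep]
    have : (1 - g / potential G i U / 2) * potential G i U = potential G i U - g / 2 := by
      field_simp
    rw [this]
    linarith
  rw [potentialGain, ← hg]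
  linarith

/-- The logarithms telescope. Diagonal entries of the final Gram matrix are at most `1 + T`, so
those of its inverse are at least `1/(1 + T)`, against `1` at the start. -/
theorem sum_potentialGain_le (z : ℕ → Fin (n + 1) → ℝ) (T : ℕ)
    (hz : ∀ t ∈ Finset.Icc 1 T, l2norm (z t) ≤ 1) :
    ∑ t ∈ Finset.Icc 1 T, potentialGain G i (gramMatrix z (t - 1)) (z t) ≤
      2 * Real.log (1 + T) := by
  have htel : ∀ k ≤ T, ∑ t ∈ Finset.Icc 1 k, potentialGain G i (gramMatrix z (t - 1)) (z t) ≤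
      2 * (Real.log (potential G i (gramMatrix z 0)) -
        Real.log (potential G i (gramMatrix z k))) := by
    intro k hk
    induction k with
    | zero => simp
    | succ k ih =>
      rw [Finset.sum_Icc_succ_top (by omega), Nat.add_sub_cancel]
      have h1 := ih (by omega)
      have hzk := hz (k + 1) (Finset.mem_Icc.2 ⟨by omega, hk⟩)
      have h2 := potentialGain_le_log (G := G) (i := i) (posDef_gramMatrix z k)
        (z := z (k + 1)) (by
          rw [← matNorm_sq (posDef_gramMatrix z k).inv.posSemidef]
          have h3 := (matNorm_gramMatrix_inv_le z k (z (k + 1))).trans hzk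
          have h4 := matNorm_nonneg (gramMatrix z k)⁻¹ (z (k + 1))
          nlinarith)
      rw [gramMatrix_succ]
      linarith
  refine (htel T le_rfl).trans ?_
  rcases (G.pa i).eq_empty_or_nonempty with he | hne
  · have : 0 ≤ Real.log (1 + (T : ℝ)) := Real.log_nonneg (by simp)
    simpa [potential, he] using this
  have hT : (0 : ℝ) < 1 + T := by positivity
  have h0 := potential_pos (posDef_gramMatrix z 0) hne
  have h1 := potential_pos (posDef_gramMatrix z T) hne
  have hcmp : potential G i (gramMatrix z 0) ≤ (1 + T) * potential G i (gramMatrix z T) := by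
    rw [potential, potential, Finset.mul_sum]
    refine Finset.sum_le_sum fun j _ => ?_
    have h2 := dotProduct_sq_le_inv (posDef_gramMatrix z T) (Pi.single j 1) (Pi.single j 1)
    simp only [mulVec_single_one, single_one_dotProduct, col_apply, Pi.single_eq_same,
      one_pow] at h2
    have h3 : gramMatrix z T j j ≤ 1 + T := by
      rw [gramMatrix_diag, add_comm]
      gcongr
      calc ∑ s ∈ Finset.Icc 1 T, z s j ^ 2 ≤ ∑ s ∈ Finset.Icc 1 T, (1 : ℝ) := by
            refine Finset.sum_le_sum fun s hs => ?_
            have h4 := (abs_apply_le_l2norm (z s) j).trans (hz s hs)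
            rw [← sq_abs]
            nlinarith [abs_nonneg (z s j)]
        _ = T := by simp
    have h5 : (0 : ℝ) ≤ (gramMatrix z T)⁻¹ j j :=
      (posDef_gramMatrix z T).inv.posSemidef.diag_nonneg
    have h6 : (gramMatrix z 0)⁻¹ j j = 1 := by simp [gramMatrix]
    rw [h6]
    nlinarith
  have h7 := Real.log_le_log h0 hcmp
  rw [Real.log_mul hT.ne' h1.ne'] at h7
  linarith

end RobustLCB

/-! ### Conditional decrease of the potential, and the number of parents. -/

namespace RobustLCBRun

open RobustLCB

variable {n : ℕ} {G : CausalGraph n} {M : CausalBandit G} {T : ℕ} {C m κ : ℝ} {Ω : Type*}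
  {mΩ : MeasurableSpace Ω} {μ : Measure Ω} (R : RobustLCBRun M T C m κ μ)

/-- The normalized parent vector of the potential. -/
noncomputable def unitVec (i : Fin (n + 1)) (A : Finset (Fin (n + 1))) (ω : Ω) (s : ℕ) :
    Fin (n + 1) → ℝ :=
  visitVec G (fun s => R.a s ω) (fun s => R.X s ω) (fun _ => 1 / (1 + m)) i A s

theorem phi_congr {i : Fin (n + 1)} {A A' : Finset (Fin (n + 1))} (h : i ∈ A' ↔ i ∈ A)
    (t : ℕ) (ω : Ω) : R.phi i A' t ω = R.phi i A t ω := by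
  simp only [phi, visitVec_congr h]

variable {R} in
theorem l2norm_unitVec_le (hm : 0 < m) (i : Fin (n + 1)) (A : Finset (Fin (n + 1))) {ω : Ω}
    (hω : R.Regular ω) {t : ℕ} (ht : t ∈ Finset.Icc 1 T) : l2norm (R.unitVec i A ω t) ≤ 1 := by
  have h := l2norm_visitVec_sq_le (G := G) (a := fun s => R.a s ω) (X := fun s => R.X s ω)
    (i := i) (A := A) (c := fun _ => 1 / (1 + m)) (s := t) (hω.bounded t ht) le_rfl
  have h1 : (1 / (1 + m)) ^ 2 * m ^ 2 ≤ 1 := by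
    rw [← mul_pow, one_div_mul_eq_div]
    have h2 : m / (1 + m) ≤ 1 := (div_le_one (by linarith)).2 (by linarith)
    exact pow_le_one₀ (by positivity) h2
  exact (sq_le_one_iff₀ (l2norm_nonneg _)).1 (h.trans h1)

theorem measurable_gram_unitVec {t : ℕ} (ht : t ∈ Finset.Icc 1 T) (i : Fin (n + 1))
    (A : Finset (Fin (n + 1))) (j k : Fin (n + 1)) :
    Measurable[R.ℱ (t - 1)] fun ω => gramMatrix (R.unitVec i A ω) (t - 1) j k := by
  refine measurable_gramMatrix (m := R.ℱ (t - 1)) (z := fun s ω => R.unitVec i A ω s)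
    (fun s hs => ?_) j k
  obtain ⟨hs1, hs2⟩ := Finset.mem_Icc.1 hs
  have hsT : s ∈ Finset.Icc 1 T := Finset.mem_Icc.2
    ⟨hs1, by have := (Finset.mem_Icc.1 ht).2; omega⟩
  exact R.measurable_visitVec hsT ⟨_, Set.mem_Ici.2 (R.ℱ.mono (by omega))⟩
    (c := fun _ _ => 1 / (1 + m)) measurable_const
    (fun j _ => (R.measurable_X hsT j).mono (R.ℱ.mono hs2) le_rfl) (MeasurableSet.const _)

theorem measurable_phi {t : ℕ} (ht : t ∈ Finset.Icc 1 T) (i : Fin (n + 1))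
    (A : Finset (Fin (n + 1))) : Measurable[R.ℱ (t - 1)] (R.phi i A (t - 1)) := by
  have h := measurable_matrix_inv (mΩ := R.ℱ (t - 1)) (R.measurable_gram_unitVec ht i A)
  exact Finset.measurable_sum (m := R.ℱ (t - 1)) _ fun j _ => h j j

theorem measurable_phi_a {t : ℕ} (ht : t ∈ Finset.Icc 1 T) (i : Fin (n + 1)) :
    Measurable fun ω => R.phi i (R.a t ω) (t - 1) ω :=
  (R.measurable_comp_a ht (f := fun ω A => R.phi i A (t - 1) ω)
    fun A => R.measurable_phi ht i A).mono (R.ℱ.le _) le_rfl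

theorem measurable_active_semSolution {t : ℕ} (ht : t ∈ Finset.Icc 1 T) (k : Fin (n + 1)) :
    Measurable[(R.ℱ (t - 1)).prod inferInstance]
      fun p : Ω × (Fin (n + 1) → ℝ) => semSolution (R.activeD t p.1) p.2 k := by
  have h := fun j i => R.measurable_activeD ht j i
  have htri := R.activeD_triangular ht
  generalize R.activeD t = D at *
  generalize R.ℱ (t - 1) = F at *
  exact measurable_semSolution_apply (m' := F.prod inferInstance) (fun p => htri p.1)
    (fun j i => (h j i).comp measurable_fst) k
    (fun j _ => (measurable_pi_apply j).comp measurable_snd)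

theorem indepFun_past_noise {t : ℕ} (ht : t ∈ Finset.Icc 1 T) :
    @IndepFun Ω Ω (Fin (n + 1) → ℝ) mΩ (R.ℱ (t - 1)) inferInstance id (R.ε t) μ :=
  indepFun_id_of_indep (R.noise_indep t ht).symm

variable [IsProbabilityMeasure μ]

theorem ae_ae_bounded {t : ℕ} (ht : t ∈ Finset.Icc 1 T) :
    ∀ᵐ ω ∂μ, ∀ᵐ e ∂M.noise, l2norm (semSolution (R.activeD t ω) e) ≤ m := by
  have h := @ae_ae_of_indepFun Ω mΩ μ _ Ω (Fin (n + 1) → ℝ) (R.ℱ (t - 1)) _ id (R.ε t)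
    (measurable_id'' (R.ℱ.le _)) (R.measurable_noise ht) (R.indepFun_past_noise ht)
    {p | l2norm (semSolution (R.activeD t p.1) p.2) ≤ m}
    (measurable_l2norm (mΩ := (R.ℱ (t - 1)).prod inferInstance)
      (R.measurable_active_semSolution ht) measurableSet_Iic)
    (by
      filter_upwards [R.data_bounded t ht] with ω hω
      rw [R.data_eq t ht ω] at hω
      exact hω)
  rw [R.noise_law t ht] at h
  exact h

/-- The state is linear in the noise while the active weights are known from the past, so
integrating the fresh noise replaces it by its mean. -/
theorem integral_X_eq {t : ℕ} (ht : t ∈ Finset.Icc 1 T) (k : Fin (n + 1)) :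
    ∫ ω, R.X t ω k ∂μ = ∫ ω, semSolution (R.activeD t ω) M.nu k ∂μ := by
  have hX : (fun ω => R.X t ω k) = fun ω => semSolution (R.activeD t ω) (R.ε t ω) k := by
    ext ω
    rw [R.data_eq t ht ω]
    rfl
  have hint : Integrable (fun ω => R.X t ω k) μ := by
    refine Integrable.of_bound ((R.measurable_X ht k).mono (R.ℱ.le t) le_rfl).aestronglyMeasurable m
      ?_
    filter_upwards [R.data_bounded t ht] with ω hω
    exact (abs_apply_le_l2norm _ k).trans hω
  rw [hX] at hint ⊢
  have h := @integral_comp_indepFun Ω mΩ μ _ Ω (Fin (n + 1) → ℝ) (R.ℱ (t - 1)) _ id (R.ε t)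
    (measurable_id'' (R.ℱ.le _)) (R.measurable_noise ht) (R.indepFun_past_noise ht)
    (fun p => semSolution (R.activeD t p.1) p.2 k) (R.measurable_active_semSolution ht k) hint
  simp only [id] at h
  rw [h, R.noise_law t ht]
  simp only [M.integral_semSolution]

/-- There are at most `m² / κ` nodes with a child. -/
theorem card_parents_le (R : RobustLCBRun M T C m κ μ) (hT : 1 ≤ T) (hκ : 0 < κ) :
    (G.parents.card : ℝ) ≤ m ^ 2 / κ := by
  have := M.isProbabilityMeasure_noise
  have ht : 1 ∈ Finset.Icc 1 T := Finset.mem_Icc.2 ⟨le_rfl, hT⟩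
  -- A single past of round `1` satisfying both almost sure conditions suffices.
  obtain ⟨ω, hω1, hω2⟩ := ((R.ae_ae_bounded ht).and (R.second_moment_ge 1 ht)).exists
  set x : (Fin (n + 1) → ℝ) → Fin (n + 1) → ℝ := fun e => semSolution (R.activeD 1 ω) e with hx
  have hint : ∀ j, Integrable (fun e => x e j ^ 2) M.noise := by
    intro j
    refine Integrable.of_bound
      ((M.integrable_semSolution (R.activeD 1 ω) j).aestronglyMeasurable.pow 2) (m ^ 2) ?_
    filter_upwards [hω1] with e he
    rw [norm_pow]
    exact pow_le_pow_left₀ (norm_nonneg _) ((abs_apply_le_l2norm _ j).trans he) 2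
  have h1 : ∀ j ∈ G.parents, κ ≤ ∫ e, x e j ^ 2 ∂M.noise := by
    intro j hj
    obtain ⟨i, hi⟩ := G.mem_parents.1 hj
    have h := hω2 (R.a 1 ω) i (Pi.single j 1) (fun k hk => by
      rw [Pi.single_eq_of_ne]
      rintro rfl
      exact hk hi)
    rw [l2norm_sq] at h
    simpa [hx, activeD, single_one_dotProduct] using h
  rw [le_div_iff₀ hκ]
  calc (G.parents.card : ℝ) * κ = ∑ j ∈ G.parents, κ := by simp
    _ ≤ ∑ j ∈ G.parents, ∫ e, x e j ^ 2 ∂M.noise := Finset.sum_le_sum h1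
    _ = ∫ e, ∑ j ∈ G.parents, x e j ^ 2 ∂M.noise :=
        (integral_finsetSum _ fun j _ => hint j).symm
    _ ≤ ∫ _, m ^ 2 ∂M.noise := by
        refine integral_mono_ae (integrable_finsetSum _ fun j _ => hint j) (integrable_const _) ?_
        filter_upwards [hω1] with e he
        calc ∑ j ∈ G.parents, x e j ^ 2 ≤ ∑ j, x e j ^ 2 :=
              Finset.sum_le_sum_of_subset_of_nonneg (Finset.subset_univ _) fun _ _ _ => sq_nonneg _
          _ = l2norm (x e) ^ 2 := by
              rw [l2norm_sq]
              exact Finset.sum_congr rfl fun j _ => pow_two _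
          _ ≤ m ^ 2 := pow_le_pow_left₀ (l2norm_nonneg _) he 2
    _ = m ^ 2 := by simp

/-- Conditionally on the past, a visit decreases the potential in proportion to its size. -/
theorem le_lintegral_potentialGain (hm : 0 < m) (hκ : 0 < κ) (hd : 1 ≤ G.maxInDegree)
    {t : ℕ} (ht : t ∈ Finset.Icc 1 T) (i : Fin (n + 1)) (A : Finset (Fin (n + 1))) :
    ∫⁻ ω, {ω | i ∈ R.a t ω ↔ i ∈ A}.indicator
        (fun ω => ENNReal.ofReal (κ / (G.maxInDegree * (1 + m) ^ 2) * R.phi i A (t - 1) ω)) ω ∂μ ≤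
      ∫⁻ ω, ENNReal.ofReal
        (potentialGain G i (gramMatrix (R.unitVec i A ω) (t - 1)) (R.unitVec i A ω t)) ∂μ := by
  classical
  set U : Ω → Matrix (Fin (n + 1)) (Fin (n + 1)) ℝ :=
    fun ω => gramMatrix (R.unitVec i A ω) (t - 1) with hU
  set V : Set Ω := {ω | i ∈ R.a t ω ↔ i ∈ A} with hV
  set z : Ω × (Fin (n + 1) → ℝ) → Fin (n + 1) → ℝ := fun p =>
    if p.1 ∈ V then (1 / (1 + m)) • restrictPa G i (semSolution (R.activeD t p.1) p.2) else 0
    with hz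
  have hVm : MeasurableSet[R.ℱ (t - 1)] V := by
    have hs := R.measurableSet_mem_a ht i
    by_cases hi : i ∈ A
    · simpa [hV, hi] using hs
    · have : V = {ω | i ∈ R.a t ω}ᶜ := by
        ext ω
        simp [hV, hi]
      rw [this]
      exact hs.compl
  have hUm := R.measurable_gram_unitVec ht i A
  have hφm := R.measurable_phi ht i A
  have hsem := R.measurable_active_semSolution ht
  have hFm : Measurable[(R.ℱ (t - 1)).prod inferInstance]
      fun p : Ω × (Fin (n + 1) → ℝ) => ENNReal.ofReal (potentialGain G i (U p.1) (z p)) := by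
    have hzm : ∀ j, Measurable[(R.ℱ (t - 1)).prod inferInstance] fun p => z p j := by
      intro j
      have h1 := measurable_restrictPa (G := G) (i := i)
        (m' := (R.ℱ (t - 1)).prod inferInstance) (fun j _ => hsem j) j
      have h2 : (fun p => z p j) = fun p : Ω × (Fin (n + 1) → ℝ) => if p.1 ∈ V then
          (1 / (1 + m)) * restrictPa G i (semSolution (R.activeD t p.1) p.2) j else 0 := by
        ext p
        simp only [hz]
        split_ifs <;> rfl
      rw [h2]
      exact Measurable.ite (@measurable_fst Ω _ (R.ℱ (t - 1)) _ V hVm)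
        (h1.const_mul _) measurable_const
    have hUi := measurable_matrix_inv (mΩ := R.ℱ (t - 1)) hUm
    have hUi' : ∀ j k, Measurable[(R.ℱ (t - 1)).prod inferInstance]
        fun p : Ω × (Fin (n + 1) → ℝ) => (U p.1)⁻¹ j k := fun j k =>
      (hUi j k).comp (@measurable_fst Ω _ (R.ℱ (t - 1)) _)
    have hmul := measurable_mulVec (mΩ := (R.ℱ (t - 1)).prod inferInstance) hUi' hzm
    refine ENNReal.measurable_ofReal.comp (Measurable.div ?_
      (hφm.comp (@measurable_fst Ω _ (R.ℱ (t - 1)) _)))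
    exact Finset.measurable_sum (m := (R.ℱ (t - 1)).prod inferInstance) _
      fun j _ => (hmul j).pow_const 2
  have h := @lintegral_comp_indepFun Ω mΩ μ _ Ω (Fin (n + 1) → ℝ) (R.ℱ (t - 1)) _ id (R.ε t)
    (measurable_id'' (R.ℱ.le _)) (R.measurable_noise ht) (R.indepFun_past_noise ht) _ hFm
  simp only [id] at h
  have hzX : ∀ ω, z (ω, R.ε t ω) = R.unitVec i A ω t := by
    intro ω
    simp only [hz, unitVec, visitVec, hV]
    congr 2
    rw [R.data_eq t ht ω]
    rfl
  simp only [hzX, R.noise_law t ht] at h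
  rw [h]
  refine lintegral_mono_ae ?_
  filter_upwards [R.second_moment_ge t ht] with ω hω
  by_cases hv : ω ∈ V
  swap
  · rw [Set.indicator_of_notMem hv]
    exact zero_le
  rw [Set.indicator_of_mem hv]
  have hUpos : (U ω).PosDef := posDef_gramMatrix _ _
  have hφ0 : 0 ≤ R.phi i A (t - 1) ω := R.phi_nonneg i A _ ω
  have hφ : R.phi i A (t - 1) ω = potential G i (U ω) := rfl
  -- Row `j` of `U⁻¹`, cut down to the parents and rescaled, so that pairing with the state gives
  -- `(U⁻¹z)_j`. In `hmom` only its diagonal entry is kept from `κ‖v j‖²`.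
  set v : Fin (n + 1) → Fin (n + 1) → ℝ := fun j =>
    (1 / (1 + m)) • restrictPa G i ((U ω)⁻¹ j) with hvdef
  have hgain : ∀ e, potentialGain G i (U ω) (z (ω, e)) =
      ∑ j ∈ G.pa i, (v j ⬝ᵥ semSolution (R.activeD t ω) e) ^ 2 / R.phi i A (t - 1) ω := by
    intro e
    rw [potentialGain, hφ, Finset.sum_div]
    refine Finset.sum_congr rfl fun j _ => ?_
    congr 2
    simp only [hz, hv, if_true, hvdef]
    rw [smul_dotProduct, restrictPa_dotProduct_comm, mulVec_smul]
    rfl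
  have hmom : ∀ j ∈ G.pa i, κ / (1 + m) ^ 2 * ((U ω)⁻¹ j j) ^ 2 ≤
      ∫ e, (v j ⬝ᵥ semSolution (R.activeD t ω) e) ^ 2 ∂M.noise := by
    intro j hj
    refine le_trans ?_ (hω (R.a t ω) i (v j) (fun k hk => by
      simp [hvdef, restrictPa_of_notMem G hk]))
    have h1 : |v j j| ≤ l2norm (v j) := abs_apply_le_l2norm _ _
    have h2 : v j j = 1 / (1 + m) * (U ω)⁻¹ j j := by simp [hvdef, restrictPa, hj]
    have h3 : (v j j) ^ 2 ≤ l2norm (v j) ^ 2 := by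
      rw [← sq_abs]
      exact pow_le_pow_left₀ (abs_nonneg _) h1 2
    rw [h2, mul_pow, _root_.one_div_pow] at h3
    calc κ / (1 + m) ^ 2 * ((U ω)⁻¹ j j) ^ 2 = κ * (1 / (1 + m) ^ 2 * ((U ω)⁻¹ j j) ^ 2) := by ring
      _ ≤ _ := mul_le_mul_of_nonneg_left h3 hκ.le
  have hmeas : ∀ j, Measurable fun e => ENNReal.ofReal
      ((v j ⬝ᵥ semSolution (R.activeD t ω) e) ^ 2 / R.phi i A (t - 1) ω) := by
    intro j
    refine ENNReal.measurable_ofReal.comp (Measurable.div_const (Measurable.pow_const ?_ 2) _)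
    refine measurable_dotProduct (fun _ => measurable_const) fun k => ?_
    exact measurable_semSolution_apply (fun _ => R.activeD_triangular ht ω)
      (fun _ _ => measurable_const) k fun j _ => measurable_pi_apply j
  calc ENNReal.ofReal (κ / (G.maxInDegree * (1 + m) ^ 2) * R.phi i A (t - 1) ω)
      ≤ ENNReal.ofReal (∑ j ∈ G.pa i,
          (∫ e, (v j ⬝ᵥ semSolution (R.activeD t ω) e) ^ 2 ∂M.noise) /
            R.phi i A (t - 1) ω) := by
        refine ENNReal.ofReal_le_ofReal ?_
        rw [← Finset.sum_div]
        rcases hφ0.eq_or_lt with h0 | h0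
        · rw [← h0]; simp
        rw [le_div_iff₀ h0]
        refine le_trans ?_ (Finset.sum_le_sum hmom)
        rw [← Finset.mul_sum]
        -- Cauchy-Schwarz turns the sum of squared diagonal entries into `φ²/d`; the division by `φ`
        -- in the gain leaves `φ/d`.
        have h1 : R.phi i A (t - 1) ω ^ 2 ≤
            (G.pa i).card * ∑ j ∈ G.pa i, ((U ω)⁻¹ j j) ^ 2 := sq_sum_le_card_mul_sum_sq
        have h2 : ((G.pa i).card : ℝ) ≤ G.maxInDegree := by exact_mod_cast G.card_pa_le i
        have h3 : (0 : ℝ) < G.maxInDegree := by exact_mod_cast hd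
        have h4 : 0 ≤ ∑ j ∈ G.pa i, ((U ω)⁻¹ j j) ^ 2 :=
          Finset.sum_nonneg fun _ _ => sq_nonneg _
        have h5 : R.phi i A (t - 1) ω ^ 2 / G.maxInDegree ≤
            ∑ j ∈ G.pa i, ((U ω)⁻¹ j j) ^ 2 := by
          rw [div_le_iff₀ h3, mul_comm]
          exact h1.trans (mul_le_mul_of_nonneg_right h2 h4)
        calc _ = κ / (1 + m) ^ 2 * (R.phi i A (t - 1) ω ^ 2 / G.maxInDegree) := by
              field_simp
          _ ≤ _ := mul_le_mul_of_nonneg_left h5 (by positivity)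
    _ = ∑ j ∈ G.pa i, ENNReal.ofReal
          ((∫ e, (v j ⬝ᵥ semSolution (R.activeD t ω) e) ^ 2 ∂M.noise) /
            R.phi i A (t - 1) ω) :=
        ENNReal.ofReal_sum_of_nonneg fun j _ =>
          div_nonneg (integral_nonneg fun _ => sq_nonneg _) hφ0
    _ ≤ ∑ j ∈ G.pa i, ∫⁻ e, ENNReal.ofReal
          ((v j ⬝ᵥ semSolution (R.activeD t ω) e) ^ 2 / R.phi i A (t - 1) ω) ∂M.noise := by
        refine Finset.sum_le_sum fun j _ => ?_
        rw [← integral_div]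
        exact ofReal_integral_le_lintegral_ofReal fun _ => div_nonneg (sq_nonneg _) hφ0
    _ = ∫⁻ e, ∑ j ∈ G.pa i, ENNReal.ofReal
          ((v j ⬝ᵥ semSolution (R.activeD t ω) e) ^ 2 / R.phi i A (t - 1) ω) ∂M.noise :=
        (lintegral_finsetSum _ fun j _ => hmeas j).symm
    _ = _ := by
        refine lintegral_congr fun e => ?_
        rw [hgain, ENNReal.ofReal_sum_of_nonneg fun j _ => div_nonneg (sq_nonneg _) hφ0]

end RobustLCBRun

/-! ### Summation over the rounds. -/

namespace RobustLCBRun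

open RobustLCB

variable {n : ℕ} {G : CausalGraph n} {M : CausalBandit G} {T : ℕ} {C m κ : ℝ} {Ω : Type*}
  {mΩ : MeasurableSpace Ω} {μ : Measure Ω} (R : RobustLCBRun M T C m κ μ)

theorem measurable_potentialGain {t : ℕ} (ht : t ∈ Finset.Icc 1 T) (i : Fin (n + 1))
    (A : Finset (Fin (n + 1))) : Measurable fun ω =>
      potentialGain G i (gramMatrix (R.unitVec i A ω) (t - 1)) (R.unitVec i A ω t) := by
  have hU := fun j k => (R.measurable_gram_unitVec ht i A j k).mono (R.ℱ.le _) le_rfl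
  have hz : ∀ j, Measurable fun ω => R.unitVec i A ω t j := fun j =>
    R.measurable_visitVec ht ⟨_, Set.mem_Ici.2 (R.ℱ.le _)⟩
      (c := fun _ _ => 1 / (1 + m)) measurable_const
      (fun j _ => (R.measurable_X ht j).mono (R.ℱ.le t) le_rfl) (MeasurableSet.const _) j
  refine Measurable.div ?_ ((R.measurable_phi ht i A).mono (R.ℱ.le _) le_rfl)
  exact Finset.measurable_sum _ fun j _ =>
    (measurable_mulVec (measurable_matrix_inv hU) hz j).pow_const 2

/-- The bound on the expected sum of the potentials of the selected treatments. -/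
noncomputable def potentialBound (G : CausalGraph n) (m κ : ℝ) (T : ℕ) : ℝ :=
  4 * Real.log (1 + T) / (κ / (G.maxInDegree * (1 + m) ^ 2))

theorem iSup_meanReward_le (R : RobustLCBRun M T C m κ μ) : (⨆ A, M.meanReward A) ≤ m := by
  refine ciSup_le fun A => ?_
  rw [M.meanReward_eq]
  exact (le_abs_self _).trans ((abs_apply_le_l2norm _ _).trans
    (M.l2norm_semSolution_nu_le (R.nominal_bounded A)))

variable [IsProbabilityMeasure μ]

/-- In each round one of the two treatments of node `i` is active, and almost surely the gains of
each treatment add up to at most `2 log(1+T)`. -/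
theorem sum_lintegral_phi_le (hm : 0 < m) (hκ : 0 < κ) (hd : 1 ≤ G.maxInDegree)
    (i : Fin (n + 1)) :
    ∑ t ∈ Finset.Icc 1 T, ∫⁻ ω, ENNReal.ofReal (R.phi i (R.a t ω) (t - 1) ω) ∂μ ≤
      ENNReal.ofReal (potentialBound G m κ T) := by
  have hd' : (0 : ℝ) < G.maxInDegree := by exact_mod_cast hd
  set c := κ / (G.maxInDegree * (1 + m) ^ 2) with hc
  have hc0 : 0 < c := by positivity
  have hgain : ∀ A, ∑ t ∈ Finset.Icc 1 T, ∫⁻ ω, ENNReal.ofReal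
      (potentialGain G i (gramMatrix (R.unitVec i A ω) (t - 1)) (R.unitVec i A ω t)) ∂μ ≤
      ENNReal.ofReal (2 * Real.log (1 + T)) := by
    intro A
    rw [← lintegral_finsetSum _ fun t ht => (R.measurable_potentialGain ht i A).ennreal_ofReal]
    calc ∫⁻ ω, ∑ t ∈ Finset.Icc 1 T, ENNReal.ofReal
          (potentialGain G i (gramMatrix (R.unitVec i A ω) (t - 1)) (R.unitVec i A ω t)) ∂μ
        ≤ ∫⁻ _, ENNReal.ofReal (2 * Real.log (1 + T)) ∂μ := by
          refine lintegral_mono_ae ?_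
          filter_upwards [R.ae_regular] with ω hω
          have h0 : ∀ t ∈ Finset.Icc 1 T, 0 ≤ potentialGain G i
              (gramMatrix (R.unitVec i A ω) (t - 1)) (R.unitVec i A ω t) := fun t _ =>
            div_nonneg (Finset.sum_nonneg fun _ _ => sq_nonneg _) (R.phi_nonneg i A (t - 1) ω)
          rw [← ENNReal.ofReal_sum_of_nonneg h0]
          exact ENNReal.ofReal_le_ofReal (sum_potentialGain_le _ T fun t ht =>
            l2norm_unitVec_le hm i A hω ht)
      _ = _ := by simp
  have hstep : ∀ t ∈ Finset.Icc 1 T,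
      ENNReal.ofReal c * ∫⁻ ω, ENNReal.ofReal (R.phi i (R.a t ω) (t - 1) ω) ∂μ ≤
      ∫⁻ ω, ENNReal.ofReal (potentialGain G i
        (gramMatrix (R.unitVec i Finset.univ ω) (t - 1)) (R.unitVec i Finset.univ ω t)) ∂μ +
      ∫⁻ ω, ENNReal.ofReal (potentialGain G i
        (gramMatrix (R.unitVec i ∅ ω) (t - 1)) (R.unitVec i ∅ ω t)) ∂μ := by
    intro t ht
    refine le_trans ?_ (add_le_add (R.le_lintegral_potentialGain hm hκ hd ht i Finset.univ)
      (R.le_lintegral_potentialGain hm hκ hd ht i ∅))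
    rw [← lintegral_const_mul _ (R.measurable_phi_a ht i).ennreal_ofReal,
      ← lintegral_add_left]
    · refine lintegral_mono fun ω => ?_
      rw [← ENNReal.ofReal_mul hc0.le]
      by_cases hi : i ∈ R.a t ω
      · rw [R.phi_congr (A := Finset.univ) (by simp [hi]), Set.indicator_of_mem (by simp [hi])]
        exact le_self_add
      · rw [R.phi_congr (A := ∅) (by simp [hi]),
          Set.indicator_of_mem (s := {ω | i ∈ R.a t ω ↔ i ∈ ∅}) (by simp [hi])]
        exact le_add_self
    · refine Measurable.indicator ?_ ?_
      · exact (((R.measurable_phi ht i Finset.univ).mono (R.ℱ.le _) le_rfl).const_mul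
          _).ennreal_ofReal
      · simpa using R.ℱ.le _ _ (R.measurableSet_mem_a ht i)
  have htot : ENNReal.ofReal c *
      ∑ t ∈ Finset.Icc 1 T, ∫⁻ ω, ENNReal.ofReal (R.phi i (R.a t ω) (t - 1) ω) ∂μ ≤
      ENNReal.ofReal (4 * Real.log (1 + T)) := by
    rw [Finset.mul_sum]
    refine (Finset.sum_le_sum hstep).trans ?_
    rw [Finset.sum_add_distrib]
    refine (add_le_add (hgain _) (hgain _)).trans ?_
    have h0 : 0 ≤ Real.log (1 + (T : ℝ)) := Real.log_nonneg (by simp)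
    rw [← ENNReal.ofReal_add (by positivity) (by positivity)]
    exact ENNReal.ofReal_le_ofReal (by linarith)
  rw [potentialBound, ← hc, ENNReal.ofReal_div_of_pos hc0]
  rw [ENNReal.le_div_iff_mul_le (Or.inl (by simpa using hc0)) (Or.inl ENNReal.ofReal_ne_top),
    mul_comm]
  exact htot

theorem integrable_phi (hm : 0 < m) (hκ : 0 < κ) (hd : 1 ≤ G.maxInDegree)
    (i : Fin (n + 1)) {t : ℕ} (ht : t ∈ Finset.Icc 1 T) :
    Integrable (fun ω => R.phi i (R.a t ω) (t - 1) ω) μ := by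
  refine ⟨(R.measurable_phi_a ht i).aestronglyMeasurable, ?_⟩
  rw [hasFiniteIntegral_iff_ofReal (ae_of_all _ fun ω => R.phi_nonneg _ _ _ _)]
  refine lt_of_le_of_lt ?_ ENNReal.ofReal_lt_top (b := ENNReal.ofReal (potentialBound G m κ T))
  exact (Finset.single_le_sum (f := fun t =>
    ∫⁻ ω, ENNReal.ofReal (R.phi i (R.a t ω) (t - 1) ω) ∂μ) (fun _ _ => zero_le) ht).trans
    (R.sum_lintegral_phi_le hm hκ hd i)

theorem sum_integral_phi_le (hm : 0 < m) (hκ : 0 < κ) (hd : 1 ≤ G.maxInDegree)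
    (i : Fin (n + 1)) :
    ∑ t ∈ Finset.Icc 1 T, ∫ ω, R.phi i (R.a t ω) (t - 1) ω ∂μ ≤ potentialBound G m κ T := by
  have hb : 0 ≤ potentialBound G m κ T := by
    have h0 : 0 ≤ Real.log (1 + (T : ℝ)) := Real.log_nonneg (by simp)
    unfold potentialBound
    positivity
  refine (ENNReal.ofReal_le_ofReal_iff hb).1 ?_
  rw [ENNReal.ofReal_sum_of_nonneg fun t _ => integral_nonneg fun ω => R.phi_nonneg _ _ _ _]
  refine le_trans (Finset.sum_le_sum fun t ht => ?_) (R.sum_lintegral_phi_le hm hκ hd i)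
  exact ofReal_integral_le_lintegral_ofReal fun ω => R.phi_nonneg _ _ _ _

theorem integrable_mean {t : ℕ} (ht : t ∈ Finset.Icc 1 T) :
    Integrable (fun ω => semSolution (R.activeD t ω) M.nu (Fin.last n)) μ := by
  have hmeas : Measurable fun ω => semSolution (R.activeD t ω) M.nu (Fin.last n) :=
    measurable_semSolution_apply (D := fun ω => R.activeD t ω) (e := fun _ => M.nu)
      (R.activeD_triangular ht)
      (fun j i => (R.measurable_activeD ht j i).mono (R.ℱ.le _) le_rfl) _
      fun j _ => measurable_const
  refine Integrable.of_bound hmeas.aestronglyMeasurable m ?_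
  filter_upwards [R.ae_ae_bounded ht] with ω hω
  exact (abs_apply_le_l2norm _ _).trans (M.l2norm_semSolution_nu_le hω)

theorem expectedRegret_eq : R.expectedRegret =
    ∫ ω, ∑ t ∈ Finset.Icc 1 T,
      ((⨆ A, M.meanReward A) - semSolution (R.activeD t ω) M.nu (Fin.last n)) ∂μ := by
  have hi : ∀ t ∈ Finset.Icc 1 T, Integrable (fun ω =>
      (⨆ A, M.meanReward A) - semSolution (R.activeD t ω) M.nu (Fin.last n)) μ :=
    fun t ht => (integrable_const _).sub (R.integrable_mean ht)
  rw [integral_finsetSum _ hi]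
  rw [expectedRegret, Finset.sum_congr rfl fun t ht => R.integral_X_eq ht (Fin.last n)]
  rw [Finset.sum_congr rfl fun t ht => integral_sub (integrable_const _) (R.integrable_mean ht)]
  rw [Finset.sum_sub_distrib]
  simp

/-- The regret bound in terms of the confidence radius. -/
theorem expectedRegret_le (hT : 1 ≤ T) (hd : 1 ≤ G.maxInDegree) (hC : 0 < C) (hm : 0 < m)
    (hκ : 0 < κ) {β : ℝ} (hβ : β = confRadius G m C (1 / (2 * ((n : ℝ) + 1) * T)) T) :
    R.expectedRegret ≤ 2 * m + (G.parents.card + 1) *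
      (((G.longestPath + 1) * (G.maxInDegree : ℝ) ^ ((G.longestPath : ℝ) - 1 / 2)) *
        (m * (C + (4 + 4 * β * C + 3 * β * √T / 2) * potentialBound G m κ T +
          3 * β * √T / 2))) := by
  classical
  have hT0 : (0 : ℝ) < T := by exact_mod_cast (by omega : 0 < T)
  have hd' : (0 : ℝ) < G.maxInDegree := by exact_mod_cast hd
  have hβ0 : 0 ≤ β := hβ ▸ confRadius_nonneg hm T
  set S : ℝ := (G.longestPath + 1) * (G.maxInDegree : ℝ) ^ ((G.longestPath : ℝ) - 1 / 2) with hS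
  have hS0 : 0 ≤ S := by positivity
  set N := insert (Fin.last n) G.parents with hN
  set α : ℝ := 4 + 4 * β * C + 3 * β * √T / 2 with hα
  have hα0 : 0 ≤ α := by positivity
  have hb0 : 0 ≤ 3 * β * √T / 2 := by positivity
  have hsT : √(T : ℝ) ^ 2 = T := Real.sq_sqrt hT0.le
  have hsT0 : 0 < √(T : ℝ) := Real.sqrt_pos.2 hT0
  have hround : ∀ᵐ ω ∂μ, ∀ t ∈ Finset.Icc 1 T,
      (⨆ A, M.meanReward A) - semSolution (R.activeD t ω) M.nu (Fin.last n) ≤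
        (R.goodEvent t)ᶜ.indicator (fun _ => 2 * m) ω +
        ∑ i ∈ N, S * (m * (l2norm (column (R.activeD t ω - M.weights (R.a t ω)) i) +
          (α * R.phi i (R.a t ω) (t - 1) ω + 3 * β * √T / 2 / T))) := by
    have hb : ∀ᵐ ω ∂μ, ∀ t ∈ Finset.Icc 1 T,
        l2norm (semSolution (R.activeD t ω) M.nu) ≤ m := by
      refine (Filter.eventually_all_finset _).2 fun t ht => ?_
      filter_upwards [R.ae_ae_bounded ht] with ω hω
      exact M.l2norm_semSolution_nu_le hω
    filter_upwards [R.ae_regular, hb] with ω hω hbω t ht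
    have hx := hbω t ht
    by_cases hg : ω ∈ R.goodEvent t
    · rw [Set.indicator_of_notMem (by simpa using hg), zero_add]
      have hβt : confRadius G m C (1 / (2 * ((n : ℝ) + 1) * T)) t ≤ β :=
        hβ ▸ confRadius_mono hm hC hd (Finset.mem_Icc.1 ht).2
      refine (iSup_meanReward_sub_le hC hm hd ht hω hg hx hβt).trans ?_
      refine Finset.sum_le_sum fun i _ => ?_
      have hφ := R.phi_nonneg i (R.a t ω) (t - 1) ω
      set φ := R.phi i (R.a t ω) (t - 1) ω with hφdef
      -- AM-GM with weight `√T` makes the bound linear in `φ`, so only the expected sum of `φ`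
      -- matters; the constants add up to `√T/2` over `T` rounds.
      have hsφ : √φ ≤ √T / 2 * φ + √T / 2 / T := by
        have h1 : √φ ^ 2 = φ := Real.sq_sqrt hφ
        have h2 : √T / 2 * φ + √T / 2 / T - √φ = √(T : ℝ) / (2 * T) * (√T * √φ - 1) ^ 2 := by
          have h3 : (√(T : ℝ) * √φ - 1) ^ 2 = √(T : ℝ) ^ 2 * √φ ^ 2 - 2 * (√T * √φ) + 1 := by ring
          rw [h3, h1, hsT]
          field_simp
          have h4 : √(T : ℝ) ^ 2 = T := hsT
          linear_combination (2 * √φ) * h4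
        have h5 : 0 ≤ √(T : ℝ) / (2 * T) * (√T * √φ - 1) ^ 2 := by positivity
        linarith
      refine mul_le_mul_of_nonneg_left (mul_le_mul_of_nonneg_left ?_ hm.le) hS0
      have h6 := mul_le_mul_of_nonneg_left hsφ (by positivity : 0 ≤ 3 * β)
      have h7 : 3 * β * (√T / 2 * φ + √T / 2 / T) =
          3 * β * √T / 2 * φ + 3 * β * √T / 2 / T := by ring
      have h8 : α * φ = 4 * φ + 4 * β * C * φ + 3 * β * √T / 2 * φ := by rw [hα]; ring
      linarith
    -- On failure the best mean is at most `m` and the current one at least `-m`.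
    · rw [Set.indicator_of_mem (by simpa using hg)]
      have h1 := R.iSup_meanReward_le
      have h2 := neg_le_of_abs_le ((abs_apply_le_l2norm _ (Fin.last n)).trans hx)
      have h3 : 0 ≤ ∑ i ∈ N, S * (m *
          (l2norm (column (R.activeD t ω - M.weights (R.a t ω)) i) +
          (α * R.phi i (R.a t ω) (t - 1) ω + 3 * β * √T / 2 / T))) := by
        refine Finset.sum_nonneg fun i _ => ?_
        have h4 := R.phi_nonneg i (R.a t ω) (t - 1) ω
        have h5 := l2norm_nonneg (column (R.activeD t ω - M.weights (R.a t ω)) i)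
        positivity
      linarith
  have hpath : ∀ᵐ ω ∂μ, ∑ t ∈ Finset.Icc 1 T,
      ((⨆ A, M.meanReward A) - semSolution (R.activeD t ω) M.nu (Fin.last n)) ≤
        ∑ t ∈ Finset.Icc 1 T, (R.goodEvent t)ᶜ.indicator (fun _ => 2 * m) ω +
        ∑ i ∈ N, S * (m * (C + 3 * β * √T / 2 +
          α * ∑ t ∈ Finset.Icc 1 T, R.phi i (R.a t ω) (t - 1) ω)) := by
    filter_upwards [R.ae_regular, hround] with ω hω hr
    refine (Finset.sum_le_sum hr).trans ?_
    rw [Finset.sum_add_distrib, Finset.sum_comm]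
    gcongr with i hi
    rw [← Finset.mul_sum, ← Finset.mul_sum]
    refine mul_le_mul_of_nonneg_left (mul_le_mul_of_nonneg_left ?_ hm.le) hS0
    rw [Finset.sum_add_distrib, Finset.sum_add_distrib, ← Finset.mul_sum, Finset.sum_const,
      Nat.card_Icc, nsmul_eq_mul, Nat.add_sub_cancel]
    have h1 := hω.budget i
    have h2 : (T : ℝ) * (3 * β * √T / 2 / T) = 3 * β * √T / 2 := by field_simp
    linarith
  have hind : ∀ t ∈ Finset.Icc 1 T,
      Integrable ((R.goodEvent t)ᶜ.indicator (fun _ => 2 * m)) μ := fun t ht =>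
    (integrable_const _).indicator (R.measurableSet_goodEvent hC ht).compl
  have hphi : ∀ i, Integrable (fun ω => S * (m * (C + 3 * β * √T / 2 +
      α * ∑ t ∈ Finset.Icc 1 T, R.phi i (R.a t ω) (t - 1) ω))) μ := by
    intro i
    refine Integrable.const_mul (Integrable.const_mul ((integrable_const _).add
      (Integrable.const_mul ?_ _)) _) _
    exact integrable_finsetSum _ fun t ht => R.integrable_phi hm hκ hd i ht
  rw [R.expectedRegret_eq]
  calc ∫ ω, ∑ t ∈ Finset.Icc 1 T,
        ((⨆ A, M.meanReward A) - semSolution (R.activeD t ω) M.nu (Fin.last n)) ∂μ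
      ≤ ∫ ω, (∑ t ∈ Finset.Icc 1 T, (R.goodEvent t)ᶜ.indicator (fun _ => 2 * m) ω +
        ∑ i ∈ N, S * (m * (C + 3 * β * √T / 2 +
          α * ∑ t ∈ Finset.Icc 1 T, R.phi i (R.a t ω) (t - 1) ω))) ∂μ := by
        refine integral_mono_ae ?_ ?_ hpath
        · exact integrable_finsetSum _ fun t ht => (integrable_const _).sub (R.integrable_mean ht)
        · exact (integrable_finsetSum _ hind).add (integrable_finsetSum _ fun i _ => hphi i)
    _ = ∑ t ∈ Finset.Icc 1 T, μ.real (R.goodEvent t)ᶜ * (2 * m) +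
        ∑ i ∈ N, S * (m * (C + 3 * β * √T / 2 +
          α * ∑ t ∈ Finset.Icc 1 T, ∫ ω, R.phi i (R.a t ω) (t - 1) ω ∂μ)) := by
        rw [integral_add (integrable_finsetSum _ hind) (integrable_finsetSum _ fun i _ => hphi i),
          integral_finsetSum _ hind, integral_finsetSum _ fun i _ => hphi i]
        congr 1
        · refine Finset.sum_congr rfl fun t ht => ?_
          rw [integral_indicator_const _ (R.measurableSet_goodEvent hC ht).compl, smul_eq_mul]
        · refine Finset.sum_congr rfl fun i _ => ?_
          have hi := integrable_finsetSum (Finset.Icc 1 T)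
            fun t ht => R.integrable_phi hm hκ hd i ht
          rw [integral_const_mul, integral_const_mul,
            integral_add (integrable_const _) (hi.const_mul _), integral_const_mul,
            integral_finsetSum _ fun t ht => R.integrable_phi hm hκ hd i ht]
          simp
    _ ≤ ∑ t ∈ Finset.Icc 1 T, 1 / (T : ℝ) * (2 * m) +
        ∑ i ∈ N, S * (m * (C + 3 * β * √T / 2 + α * potentialBound G m κ T)) := by
        gcongr with t ht i hi
        · exact R.measureReal_compl_goodEvent_le hC ht
        · exact R.sum_integral_phi_le hm hκ hd i
    _ = 2 * m + N.card * (S * (m * (C + α * potentialBound G m κ T + 3 * β * √T / 2))) := by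
        rw [Finset.sum_const, Finset.sum_const, Nat.card_Icc, nsmul_eq_mul, nsmul_eq_mul,
          Nat.add_sub_cancel]
        field_simp
        ring
    _ ≤ _ := by
        have h0 : 0 ≤ Real.log (1 + (T : ℝ)) := Real.log_nonneg (by simp)
        have h1 : 0 ≤ potentialBound G m κ T := by
          unfold potentialBound
          positivity
        gcongr
        exact_mod_cast Finset.card_insert_le _ _

end RobustLCBRun

/-! ### Absorbing the parameters into the polynomial factors. -/

theorem RobustLCB.confRadius_le {n T : ℕ} {G : CausalGraph n} {C m q ℓ : ℝ} (hT : 1 ≤ T)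
    (hd : 1 ≤ G.maxInDegree) (hC : 0 < C) (hm : 0 < m) (hq : 1 + m ≤ q)
    (hdq : (G.maxInDegree : ℝ) ≤ q ^ 2)
    (hℓ : 1 + Real.log ((n : ℝ) + 1) + Real.log T + Real.log (1 + 1 / C) ≤ ℓ) :
    RobustLCB.confRadius G m C (1 / (2 * ((n : ℝ) + 1) * T)) T ≤ 8 * (q ^ 3 * ℓ) := by
  have hT1 : (1 : ℝ) ≤ T := by exact_mod_cast hT
  have hd1 : (1 : ℝ) ≤ G.maxInDegree := by exact_mod_cast hd
  have hT0 : (0 : ℝ) < T := by linarith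
  have hn : 0 ≤ Real.log ((n : ℝ) + 1) := Real.log_nonneg (by simp)
  have hlT : 0 ≤ Real.log (T : ℝ) := Real.log_nonneg hT1
  have hlC : 0 ≤ Real.log (1 + 1 / C) := Real.log_nonneg (by simp [hC.le])
  have hq1 : 1 ≤ q := by linarith
  have hℓ1 : 1 ≤ ℓ := by linarith
  have hlog2 : Real.log 2 ≤ 1 := Real.log_two_lt_d9.le.trans (by norm_num)
  have h1 : Real.log (1 / (1 / (2 * ((n : ℝ) + 1) * T))) ≤ ℓ := by
    rw [one_div_one_div, Real.log_mul (by positivity) hT0.ne',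
      Real.log_mul (by norm_num) (by positivity)]
    linarith
  have h2 : Real.log (1 + m ^ 2 * T / (G.maxInDegree * C ^ 2)) ≤ 4 * (q * ℓ) := by
    have h3 : 1 + m ^ 2 * T / (G.maxInDegree * C ^ 2) ≤ (1 + m) ^ 2 * T * (1 + 1 / C) ^ 2 := by
      have h4 : m ^ 2 * T / (G.maxInDegree * C ^ 2) ≤ m ^ 2 * T / C ^ 2 := by
        gcongr
        nlinarith [sq_nonneg C]
      have h5 : m ^ 2 * T / C ^ 2 = m ^ 2 * T * (1 / C) ^ 2 := by field_simp
      have hc : 0 < 1 / C := by positivity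
      have h6 : 1 + m ^ 2 * (1 / C) ^ 2 ≤ (1 + m) ^ 2 * (1 + 1 / C) ^ 2 := by
        have : (1 + m) ^ 2 * (1 + 1 / C) ^ 2 = 1 + m ^ 2 * (1 / C) ^ 2 +
          (2 * m + m ^ 2) + (1 + m) ^ 2 * (2 * (1 / C)) + (1 + 2 * m) * (1 / C) ^ 2 := by ring
        have : 0 ≤ (2 * m + m ^ 2) + (1 + m) ^ 2 * (2 * (1 / C)) +
          (1 + 2 * m) * (1 / C) ^ 2 := by positivity
        linarith
      have h7 := mul_le_mul_of_nonneg_left h6 hT0.le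
      linarith
    refine (Real.log_le_log (by positivity) h3).trans ?_
    rw [Real.log_mul (by positivity) (by positivity), Real.log_mul (by positivity) hT0.ne',
      Real.log_pow, Real.log_pow]
    have h8 : Real.log (1 + m) ≤ m := by
      have := Real.log_le_sub_one_of_pos (by positivity : 0 < 1 + m)
      linarith
    have h9 : q ≤ q * ℓ := le_mul_of_one_le_right (by linarith) hℓ1
    have h10 : ℓ ≤ q * ℓ := le_mul_of_one_le_left (by linarith) hq1
    push_cast
    linarith
  have h3 : 2 * Real.log (1 / (1 / (2 * ((n : ℝ) + 1) * T))) +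
      G.maxInDegree * Real.log (1 + m ^ 2 * T / (G.maxInDegree * C ^ 2)) ≤ 6 * (q ^ 3 * ℓ) := by
    have h4 : G.maxInDegree * Real.log (1 + m ^ 2 * T / (G.maxInDegree * C ^ 2)) ≤
        q ^ 2 * (4 * (q * ℓ)) :=
      mul_le_mul hdq h2 (Real.log_nonneg (le_add_of_nonneg_right (by positivity))) (sq_nonneg q)
    have h5 : ℓ ≤ q ^ 3 * ℓ := le_mul_of_one_le_left (by linarith) (one_le_pow₀ hq1)
    linarith
  have h6 : q ≤ q ^ 3 * ℓ := by
    have := mul_le_mul (le_self_pow₀ hq1 three_ne_zero) hℓ1 zero_le_one (by positivity)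
    linarith
  have h7 : √(2 * Real.log (1 / (1 / (2 * ((n : ℝ) + 1) * T))) +
      G.maxInDegree * Real.log (1 + m ^ 2 * T / (G.maxInDegree * C ^ 2))) ≤
      6 * (q ^ 3 * ℓ) := by
    refine Real.sqrt_le_iff.2 ⟨by positivity, h3.trans ?_⟩
    exact le_self_pow₀ (by linarith) two_ne_zero
  rw [confRadius]
  linarith

/-- The exponent of `q` is `2 + 2 + 1 + 7`, from the node count, `L + 1`, `m` and the inner bracket,
and `820 = 2 · 2 · 205` with `205 = 1 + 192 + 12`. The power of `ℓ` is raised from `2` to `12` so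
that one exponent serves both factors. -/
theorem regret_arithmetic {q ℓ s C m F P L β b : ℝ} (hq1 : 1 ≤ q) (hℓ1 : 1 ≤ ℓ) (hs1 : 1 ≤ s)
    (hC : 0 < C) (hm : 0 < m) (hmq : m ≤ q) (hF : 0 ≤ F) (_hP0 : 0 ≤ P) (hP : P ≤ q ^ 2)
    (hL0 : 0 ≤ L) (hLq : L ≤ q ^ 2) (hβ0 : 0 ≤ β) (hβq : β ≤ 8 * (q ^ 3 * ℓ)) (hb0 : 0 ≤ b)
    (hb : b ≤ 4 * (q ^ 4 * ℓ)) :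
    (P + 1) * (((L + 1) * F) * (m * (C + (4 + 4 * β * C + 3 * β * s / 2) * b + 3 * β * s / 2))) ≤
      820 * q ^ 12 * ℓ ^ 12 * (F * (s + C)) := by
  set W := s + C with hW
  have hW1 : 1 ≤ W := by linarith
  have h1q : 1 ≤ q ^ 2 := one_le_pow₀ hq1
  have hqℓ : 1 ≤ q ^ 3 * ℓ := one_le_mul_of_one_le_of_one_le (one_le_pow₀ hq1) hℓ1
  have hqℓ7 : q ^ 3 * ℓ ≤ q ^ 7 * ℓ ^ 2 :=
    mul_le_mul (pow_le_pow_right₀ hq1 (by norm_num)) (le_self_pow₀ hℓ1 two_ne_zero)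
      (by positivity) (by positivity)
  have hu : 4 + 4 * β * C + 3 * β * s / 2 ≤ 48 * (q ^ 3 * ℓ * W) := by
    have h1 : β * C ≤ 8 * (q ^ 3 * ℓ) * C := mul_le_mul_of_nonneg_right hβq hC.le
    have h2 : β * s ≤ 8 * (q ^ 3 * ℓ) * s := mul_le_mul_of_nonneg_right hβq (by linarith)
    have h3 : 1 ≤ q ^ 3 * ℓ * W := one_le_mul_of_one_le_of_one_le hqℓ hW1
    have h4 : 0 ≤ q ^ 3 * ℓ * s := by positivity
    have h5 : 0 ≤ q ^ 3 * ℓ * C := by positivity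
    have h6 : q ^ 3 * ℓ * W = q ^ 3 * ℓ * s + q ^ 3 * ℓ * C := by rw [hW]; ring
    linarith
  have hinner : C + (4 + 4 * β * C + 3 * β * s / 2) * b + 3 * β * s / 2 ≤
      205 * (q ^ 7 * ℓ ^ 2 * W) := by
    have h1 : (4 + 4 * β * C + 3 * β * s / 2) * b ≤
        48 * (q ^ 3 * ℓ * W) * (4 * (q ^ 4 * ℓ)) := mul_le_mul hu hb hb0 (by positivity)
    have h2 : β * s ≤ 8 * (q ^ 3 * ℓ) * W :=
      mul_le_mul hβq (by linarith) (by linarith) (by positivity)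
    have h3 : q ^ 3 * ℓ * W ≤ q ^ 7 * ℓ ^ 2 * W :=
      mul_le_mul_of_nonneg_right hqℓ7 (by linarith)
    have h4 : W ≤ q ^ 3 * ℓ * W := le_mul_of_one_le_left (by linarith) hqℓ
    have h5 : 48 * (q ^ 3 * ℓ * W) * (4 * (q ^ 4 * ℓ)) = 192 * (q ^ 7 * ℓ ^ 2 * W) := by ring
    linarith
  have hℓ12 : ℓ ^ 2 ≤ ℓ ^ 12 := pow_le_pow_right₀ hℓ1 (by norm_num)
  set I := C + (4 + 4 * β * C + 3 * β * s / 2) * b + 3 * β * s / 2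
  have hI : m * I ≤ q * (205 * (q ^ 7 * ℓ ^ 2 * W)) :=
    mul_le_mul hmq hinner (by positivity) (by linarith)
  have hLI : ((L + 1) * F) * (m * I) ≤ (2 * q ^ 2 * F) * (q * (205 * (q ^ 7 * ℓ ^ 2 * W))) :=
    mul_le_mul (mul_le_mul_of_nonneg_right (by linarith) hF) hI (by positivity) (by positivity)
  calc (P + 1) * (((L + 1) * F) * (m * I))
      ≤ (2 * q ^ 2) * ((2 * q ^ 2 * F) * (q * (205 * (q ^ 7 * ℓ ^ 2 * W)))) :=
        mul_le_mul (by linarith) hLI (by positivity) (by positivity)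
    _ = 820 * q ^ 12 * (F * W) * ℓ ^ 2 := by ring
    _ ≤ 820 * q ^ 12 * (F * W) * ℓ ^ 12 := mul_le_mul_of_nonneg_left hℓ12 (by positivity)
    _ = _ := by ring

namespace RobustLCBRun

open RobustLCB

theorem expectedRegret_le_polynomial {n T : ℕ} {G : CausalGraph n} {M : CausalBandit G}
    {C m κ : ℝ} {Ω : Type*} [MeasurableSpace Ω] {μ : Measure Ω} [IsProbabilityMeasure μ]
    (R : RobustLCBRun M T C m κ μ) (hT : 1 ≤ T) (hd : 1 ≤ G.maxInDegree) (hC : 0 < C)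
    (hm : 0 < m) (hκ : 0 < κ) :
    R.expectedRegret ≤
      2 * m + 820 * ((1 + m) * (1 + 1 / κ)) ^ 12 *
        (1 + Real.log ((n : ℝ) + 1) + Real.log T + Real.log (1 + 1 / C)) ^ 12 *
        ((G.maxInDegree : ℝ) ^ ((G.longestPath : ℝ) - 1 / 2) * (Real.sqrt T + C)) := by
  have hT1 : (1 : ℝ) ≤ T := by exact_mod_cast hT
  have hd1 : (1 : ℝ) ≤ G.maxInDegree := by exact_mod_cast hd
  have hn : 0 ≤ Real.log ((n : ℝ) + 1) := Real.log_nonneg (by simp)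
  have hlT : 0 ≤ Real.log (T : ℝ) := Real.log_nonneg hT1
  have hlC : 0 ≤ Real.log (1 + 1 / C) := Real.log_nonneg (by simp [hC.le])
  have hk : 0 < 1 / κ := by positivity
  set q := (1 + m) * (1 + 1 / κ) with hq
  set ℓ := 1 + Real.log ((n : ℝ) + 1) + Real.log T + Real.log (1 + 1 / C) with hℓ
  set β := confRadius G m C (1 / (2 * ((n : ℝ) + 1) * T)) T with hβ
  set F := (G.maxInDegree : ℝ) ^ ((G.longestPath : ℝ) - 1 / 2)
  have hF : 0 ≤ F := by positivity
  have hmq : 1 + m ≤ q := le_mul_of_one_le_right (by positivity) (by linarith)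
  have hq1 : 1 ≤ q := by linarith
  have hℓ1 : 1 ≤ ℓ := by linarith
  -- Through this inequality the node count, `d`, `L` and the potential bound all become powers of
  -- `q`.
  have hmκ : (1 + m) ^ 2 / κ ≤ q ^ 2 := by
    rw [hq, mul_pow, div_eq_mul_one_div]
    gcongr
    nlinarith
  have hP : (G.parents.card : ℝ) ≤ q ^ 2 := by
    refine (R.card_parents_le hT hκ).trans (le_trans ?_ hmκ)
    gcongr
    linarith
  have hdq : (G.maxInDegree : ℝ) ≤ q ^ 2 :=
    le_trans (by exact_mod_cast G.maxInDegree_le_card_parents) hP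
  have hLq : (G.longestPath : ℝ) ≤ q ^ 2 :=
    le_trans (by exact_mod_cast G.longestPath_le_card_parents) hP
  have hβ0 : 0 ≤ β := confRadius_nonneg hm T
  have hβq : β ≤ 8 * (q ^ 3 * ℓ) := confRadius_le hT hd hC hm hmq hdq le_rfl
  have hpot : potentialBound G m κ T ≤ 4 * (q ^ 4 * ℓ) := by
    have h1 : Real.log (1 + (T : ℝ)) ≤ ℓ := by
      have h2 : Real.log (1 + (T : ℝ)) ≤ Real.log (2 * T) :=
        Real.log_le_log (by positivity) (by linarith)
      rw [Real.log_mul (by norm_num) (by positivity)] at h2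
      linarith [Real.log_two_lt_d9]
    have h3 : potentialBound G m κ T =
        4 * Real.log (1 + T) * (G.maxInDegree * ((1 + m) ^ 2 / κ)) := by
      rw [potentialBound]
      field_simp
    rw [h3]
    calc 4 * Real.log (1 + T) * (G.maxInDegree * ((1 + m) ^ 2 / κ))
        ≤ 4 * ℓ * (q ^ 2 * q ^ 2) := by gcongr
      _ = _ := by ring
  have hpot0 : 0 ≤ potentialBound G m κ T := by
    have h0 : 0 ≤ Real.log (1 + (T : ℝ)) := Real.log_nonneg (by simp)
    unfold potentialBound
    positivity
  refine (R.expectedRegret_le hT hd hC hm hκ hβ).trans ?_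
  gcongr 2 * m + ?_
  exact regret_arithmetic hq1 hℓ1 (Real.one_le_sqrt.2 hT1) hC hm (by linarith) hF
    (Nat.cast_nonneg _) hP (Nat.cast_nonneg _) hLq hβ0 hβq hpot0 hpot

end RobustLCBRun

/-- For `C = 1` the term `x = log 2` is at most `ℓ`, and `s + 1 ≤ 2s`. This costs `2^13`, and
`6717440 = 820 · 2^13`. -/
theorem regret_arithmetic_of_le_one {q ℓ s F x : ℝ} (hℓ : 1 ≤ ℓ) (hs : 1 ≤ s)
    (hF : 0 ≤ F) (hx0 : 0 ≤ x) (hx : x ≤ 1) :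
    820 * q ^ 12 * (ℓ + x) ^ 12 * (F * (s + 1)) ≤ 6717440 * q ^ 12 * ℓ ^ 12 * (F * s) := by
  have h1 : (ℓ + x) ^ 12 ≤ (2 * ℓ) ^ 12 := pow_le_pow_left₀ (by linarith) (by linarith) 12
  have h2 : F * (s + 1) ≤ F * (2 * s) := mul_le_mul_of_nonneg_left (by linarith) hF
  calc 820 * q ^ 12 * (ℓ + x) ^ 12 * (F * (s + 1))
      ≤ 820 * q ^ 12 * (2 * ℓ) ^ 12 * (F * (2 * s)) :=
        mul_le_mul (mul_le_mul_of_nonneg_left h1 (by positivity)) h2 (by positivity)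
          (by positivity)
    _ = _ := by ring

theorem mainTheorem1 :
    ∃ (K : ℝ) (p : ℕ), 0 < K ∧
      ∀ (n T : ℕ) (G : CausalGraph n) (M : CausalBandit G) (C m κ : ℝ)
        (Ω : Type*) [MeasurableSpace Ω] (μ : Measure Ω) [IsProbabilityMeasure μ]
        (R : RobustLCBRun M T C m κ μ),
        1 ≤ T → 1 ≤ G.maxInDegree → 0 < C → 0 < m → 0 < κ →
          (R.expectedRegret ≤
            2 * m + K * ((1 + m) * (1 + 1 / κ)) ^ p *
              (1 + Real.log ((n : ℝ) + 1) + Real.log T + Real.log (1 + 1 / C)) ^ p *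
              ((G.maxInDegree : ℝ) ^ ((G.longestPath : ℝ) - 1 / 2) * (Real.sqrt T + C))) ∧
          (C = 1 → (∀ t ∈ Finset.Icc 1 T, ∀ ω A, R.D t ω A = M.weights A) →
            R.expectedRegret ≤
              2 * m + K * ((1 + m) * (1 + 1 / κ)) ^ p *
                (1 + Real.log ((n : ℝ) + 1) + Real.log T) ^ p *
                ((G.maxInDegree : ℝ) ^ ((G.longestPath : ℝ) - 1 / 2) * Real.sqrt T)) := by
  refine ⟨6717440, 12, by norm_num, ?_⟩
  intro n T G M C m κ Ω _ μ _ R hT hd hC hm hκ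
  have hT1 : (1 : ℝ) ≤ T := by exact_mod_cast hT
  have hn : 0 ≤ Real.log ((n : ℝ) + 1) := Real.log_nonneg (by simp)
  have hlT : 0 ≤ Real.log (T : ℝ) := Real.log_nonneg hT1
  have hlC : 0 ≤ Real.log (1 + 1 / C) := Real.log_nonneg (by simp [hC.le])
  have hℓ : 1 ≤ 1 + Real.log ((n : ℝ) + 1) + Real.log T := by linarith
  have hq : 0 ≤ (1 + m) * (1 + 1 / κ) := by positivity
  have hF : 0 ≤ (G.maxInDegree : ℝ) ^ ((G.longestPath : ℝ) - 1 / 2) := by positivity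
  have h := R.expectedRegret_le_polynomial hT hd hC hm hκ
  refine ⟨h.trans (add_le_add le_rfl ?_), ?_⟩
  · refine mul_le_mul_of_nonneg_right (mul_le_mul_of_nonneg_right
      (mul_le_mul_of_nonneg_right (by norm_num) (pow_nonneg hq _))
      (pow_nonneg (add_nonneg (zero_le_one.trans hℓ) hlC) _)) ?_
    exact mul_nonneg hF (add_nonneg (Real.sqrt_nonneg _) hC.le)
  · rintro rfl -
    have hl1 : Real.log (1 + 1 / 1) ≤ 1 :=
      (Real.log_le_sub_one_of_pos (by norm_num)).trans_eq (by norm_num)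
    exact h.trans (add_le_add le_rfl (regret_arithmetic_of_le_one hℓ
      (Real.one_le_sqrt.2 hT1) hF hlC hl1))
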